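/- Let $d,N\in\mathbb N$, $U=\mathbb R^N$, $0<T\le\infty$, and let $D$ be a spatial domain without boundary: $D=\mathbb R^d$, or a box $\prod_{j=1}^d(0,L_j)$ with periodic boundary conditions (or, more generally, $D$ is periodic in some of the coordinate directions and unbounded in the others). Test functions, and classical solutions, are required to be periodic in the periodic directions. Consider the system $\partial_t u+\nabla_x\cdot f(u)=0$, where $f=(f^1,\dots,f^d):\mathbb R^N\to\mathbb R^{N\times d}$ is $C^2$ with bounded Hessian, $\|f''\|_{L^\infty(\mathbb R^N)}<\infty$. Assume that it has an entropy pair $(\eta,q)$ (that is, $\eta$ is convex and $q'=\eta' f'$) with $\eta\in C^2$ and, for some constants $c,C>0$, $$c\le(\eta''(u)w,w)\le C\qquad\forall\,u,w\in\mathbb R^N,\ |w|=1,$$ and that the total entropy $\int_D\eta(u(x))\,dx$ is defined, i.e. $\eta\circ u\in L^1(D)$, for every $u\in L^2(D;U)$ (this is automatic if $D$ has finite measure). *Definitions.* $\mathcal P_T(L^2(D;U))$ is the set of maps $\mu:[0,T)\to\mathcal P(L^2(D;U))$ with $\operatorname{ess\,sup}_t\int\|u\|_{L^2}^2\,d\mu_t(u)<\infty$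 that have a time-dependent correlation measure, i.e. weak* measurable families $(\nu^k_{t,x})_{(t,x)\in[0,T)\times D^k}$ of probability measures on $U^k$, $k\in\mathbb N$, such that for a.e. $t$, $\int_{D^k}\langle\nu^k_{t,x},g(x)\rangle\,dx=\int_{L^2}\int_{D^k}g(x,u(x))\,dx\,d\mu_t(u)$ for all $k$ and all $g\in L^1(D^k;C_0(U^k))$; here $u(x)=(u(x_1),\dots,u(x_k))$. Let $\bar\mu\in\mathcal P(L^2(D;U))$ have bounded support and correlation measure $\bar\nu$. A *statistical solution* with initial data $\bar\mu$ is a $\mu\in\mathcal P_T(L^2(D;U))$ with $\mu_0=\bar\mu$ such that every $\mu_t$ has bounded support and, for every $k\ge1$, the moments $\langle\nu^k_{t,x},\xi_1\otimes\cdots\otimes\xi_k\rangle$ and $\langle\nu^k_{t,x},\xi_1\otimes\cdots\otimes f(\xi_i)\otimes\cdots\otimes\xi_k\rangle$ are locally integrable and $$\partial_t\langle\nu^k_{t,x},\xi_1\otimes\cdots\otimes\xi_k\rangle+\sum_{i=1}^k\nabla_{x_i}\cdot\langle\nu^k_{t,x},\xi_1\otimes\cdots\otimes f(\xi_i)\otimes\cdots\otimes\xi_k\rangle=0$$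 in the sense of distributions on $D^k\times[0,T)$ with initial value $\langle\bar\nu^k_x,\xi_1\otimes\cdots\otimes\xi_k\rangle$ (test functions in $C_c^\infty(D^k\times[0,T))$, not necessarily vanishing at $t=0$). It is a *dissipative statistical solution* (with respect to $\eta$) if, moreover, (i) for all $\alpha_1,\dots,\alpha_M>0$ with $\sum_i\alpha_i=1$ and all $\bar\mu_1,\dots,\bar\mu_M\in\mathcal P(L^2(D;U))$ with $\sum_i\alpha_i\bar\mu_i=\bar\mu$ there are statistical solutions $\mu_1,\dots,\mu_M$ with initial data $\bar\mu_1,\dots,\bar\mu_M$ such that $\sum_i\alpha_i\mu_{i,t}=\mu_t$ for all $t\in[0,T)$; and (ii) for all $0\le\theta\in C_c^\infty([0,T))$, $$\int_0^T\int_{L^2}\int_D\eta(u(x))\,\theta'(t)\,dx\,d\mu_t(u)\,dt+\int_{L^2}\int_D\eta(\bar u(x))\,\theta(0)\,dx\,d\bar\mu(\bar u)\ge0.$$ It is a *strong statistical solution* if there is an $R>0$ such that for every $n\ge1$ there is a $\rho_n\in\mathcal P_T(L^2(D;U))$ of the form $\rho_{n,t}=\sum_{i=1}^{M}\alpha_i\delta_{v_i(t)}$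 with $\alpha_i\ge0$, $\sum_i\alpha_i=1$ (where $M$, $\alpha_i$, $v_i$ may depend on $n$), where every $v_i$ is a classical solution (a bounded Lipschitz function that satisfies the system a.e.) in the ball of radius $R$ of $W^{1,\infty}(D\times(0,T);U)$, and $W_2(\mu_t,\rho_{n,t})\le\frac1n$ for all $t\in[0,T)$. Here $W_2$ is the 2-Wasserstein distance on $\mathcal P(L^2(D;U))$. **Theorem.** Let $\mu$ be a strong statistical solution with initial data $\bar\mu$. Then $\mu$ is unique in the class of dissipative statistical solutions: every dissipative statistical solution $\gamma$ with the same initial data $\bar\mu$ satisfies $\gamma_t=\mu_t$ for almost every $t\in[0,T)$. -/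

import Mathlib

open MeasureTheory Set
open scoped ENNReal NNReal ContDiff ZeroAtInfty BoundedContinuousFunction

noncomputable section

namespace StatSol

/-- Physical space `ℝ^d`. -/
abbrev Space (d : ℕ) : Type := EuclideanSpace ℝ (Fin d)

/-- Phase space `U = ℝ^N`. -/
abbrev State (N : ℕ) : Type := EuclideanSpace ℝ (Fin N)

/-- The time interval `[0, T)`, where `T` may be `∞`. -/
def timeInterval (T : EReal) : Set ℝ := {t | 0 ≤ t ∧ (t : EReal) < T}

/-- The spatial domain `D`: periodic with period `L j` in the directions `j ∈ J`, unbounded in the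
others. For `J = ∅` it is `ℝ^d`, for `J` everything it is an open box with periodic boundary
conditions. The set is one open period cell; periodicity enters through the test functions and
the classical solutions. -/
def cell {d : ℕ} (J : Finset (Fin d)) (L : Fin d → ℝ) : Set (Space d) :=
  {x | ∀ j ∈ J, 0 < x j ∧ x j < L j}

/-- The product `D^k`. -/
def domPow {d : ℕ} (D : Set (Space d)) (k : ℕ) : Set (Fin k → Space d) :=
  Set.univ.pi fun _ => D

/-- The space `L²(D; U)`. -/
abbrev L2 {d : ℕ} (D : Set (Space d)) (N : ℕ) : Type :=
  Lp (State N) 2 ((volume : Measure (Space d)).restrict D)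

instance instMeasurableSpaceL2 {d : ℕ} (D : Set (Space d)) (N : ℕ) :
    MeasurableSpace (L2 D N) := borel _

instance instBorelSpaceL2 {d : ℕ} (D : Set (Space d)) (N : ℕ) : BorelSpace (L2 D N) := ⟨rfl⟩

/-! ### Wasserstein distance -/

/-- Transport plans from `μ` to `ρ`. -/
def couplings {X : Type*} [MeasurableSpace X] (μ ρ : Measure X) : Set (Measure (X × X)) :=
  {π | π.map Prod.fst = μ ∧ π.map Prod.snd = ρ}

/-- The `p`-Wasserstein distance, with values in `[0, ∞]`. -/
def wasserstein {X : Type*} [MeasurableSpace X] [EDist X] (p : ℝ) (μ ρ : Measure X) : ℝ≥0∞ :=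
  (⨅ π ∈ couplings μ ρ, ∫⁻ z, edist z.1 z.2 ^ p ∂π) ^ (1 / p)

/-! ### Young measures and correlation measures -/

/-- A Young measure on the base space `(Z, m)`: a weak* measurable family of probability measures,
defined almost everywhere. -/
structure IsYoungMeasure {Z V : Type*} [MeasurableSpace Z] [TopologicalSpace V]
    [MeasurableSpace V] (m : Measure Z) (ν : Z → Measure V) : Prop where
  prob : ∀ᵐ z ∂m, IsProbabilityMeasure (ν z)
  meas : ∀ h : V →ᵇ ℝ, AEMeasurable (fun z => ∫ ξ, h ξ ∂(ν z)) m

/-- The family `ν = (ν^k)` is dual to the probability measure `μ` on `L²(D; U)`: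
`∫_{D^k} ⟨ν^k_x, g(x)⟩ dx = ∫_{L²} ∫_{D^k} g(x, u(x)) dx dμ(u)` for all `k` and all
`g ∈ L¹(D^k; C₀(U^k))`. -/
def IsDual {d N : ℕ} (D : Set (Space d)) (μ : Measure (L2 D N))
    (ν : (k : ℕ) → (Fin k → Space d) → Measure (Fin k → State N)) : Prop :=
  ∀ (k : ℕ) (g : (Fin k → Space d) → C₀(Fin k → State N, ℝ)),
    Integrable g (volume.restrict (domPow D k)) →
      ∫ x in domPow D k, ∫ ξ, g x ξ ∂(ν k x)
        = ∫ u, ∫ x in domPow D k, g x (fun i => u (x i)) ∂volume ∂μ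

/-- `ν` is the correlation measure of `μ ∈ P(L²(D; U))`. The duality relation determines every
`ν^k` almost everywhere on `D^k`, so that symmetry, consistency and diagonal continuity need not
be listed. -/
structure IsCorrelationMeasure {d N : ℕ} (D : Set (Space d)) (μ : Measure (L2 D N))
    (ν : (k : ℕ) → (Fin k → Space d) → Measure (Fin k → State N)) : Prop where
  young : ∀ k, IsYoungMeasure (volume.restrict (domPow D k)) (ν k)
  dual : IsDual D μ ν

/-- `ν` is the time-dependent correlation measure of `μ : [0, T) → P(L²(D; U))`. -/
structure IsTimeCorrelationMeasure {d N : ℕ} (D : Set (Space d)) (T : EReal)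
    (μ : ℝ → ProbabilityMeasure (L2 D N))
    (ν : (k : ℕ) → ℝ → (Fin k → Space d) → Measure (Fin k → State N)) : Prop where
  young : ∀ k, IsYoungMeasure (volume.restrict (timeInterval T ×ˢ domPow D k))
    (fun z : ℝ × (Fin k → Space d) => ν k z.1 z.2)
  dual : ∀ᵐ t ∂(volume.restrict (timeInterval T)), IsDual D (μ t) (fun k => ν k t)

/-- Second moments that are essentially bounded in time. -/
def L2Bounded {d N : ℕ} (D : Set (Space d)) (T : EReal)
    (μ : ℝ → ProbabilityMeasure (L2 D N)) : Prop :=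
  ∃ c : ℝ≥0, ∀ᵐ t ∂(volume.restrict (timeInterval T)),
    ∫⁻ u, ‖u‖ₑ ^ 2 ∂(μ t : Measure (L2 D N)) ≤ c

/-- The class `P_T(L²(D; U))` of `L²`-bounded time-parametrized probability measures that are dual
to a time-dependent correlation measure. -/
def MemPT {d N : ℕ} (D : Set (Space d)) (T : EReal)
    (μ : ℝ → ProbabilityMeasure (L2 D N)) : Prop :=
  L2Bounded D T μ ∧ ∃ ν, IsTimeCorrelationMeasure D T μ ν

/-- Bounded support: `‖u‖ ≤ M` for almost every `u`. -/
def BoundedSupport {d N : ℕ} {D : Set (Space d)} (μ : ProbabilityMeasure (L2 D N)) : Prop :=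
  ∃ M : ℝ, ∀ᵐ u ∂(μ : Measure (L2 D N)), ‖u‖ ≤ M

/-! ### Statistical solutions -/

/-- Smooth test functions on `D^k × [0, T)` with compact support (modulo the periods in the
periodic directions). -/
structure IsTestFunction {d : ℕ} (J : Finset (Fin d)) (L : Fin d → ℝ) (T : EReal) (k : ℕ)
    (φ : (Fin k → Space d) × ℝ → ℝ) : Prop where
  smooth : ContDiff ℝ ∞ φ
  periodic : ∀ (i : Fin k), ∀ j ∈ J, ∀ (x : Fin k → Space d) (t : ℝ),
    φ (x + Pi.single i (EuclideanSpace.single j (L j)), t) = φ (x, t)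
  support : ∃ R T' : ℝ, (T' : EReal) < T ∧
    ∀ (x : Fin k → Space d) (t : ℝ), φ (x, t) ≠ 0 → t ≤ T' ∧ ∀ i, ∀ j ∉ J, |x i j| ≤ R

/-- The component `a` of the tensor `ξ₁ ⊗ ⋯ ⊗ ξ_k`. -/
def moment {N k : ℕ} (a : Fin k → Fin N) (ξ : Fin k → State N) : ℝ := ∏ i, ξ i (a i)

/-- The component `a` of the tensor `ξ₁ ⊗ ⋯ ⊗ f^m(ξ_i) ⊗ ⋯ ⊗ ξ_k`. -/
def fluxMoment {d N k : ℕ} (f : Fin d → State N → State N) (a : Fin k → Fin N) (i : Fin k)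
    (m : Fin d) (ξ : Fin k → State N) : ℝ :=
  f m (ξ i) (a i) * ∏ j ∈ Finset.univ.erase i, ξ j (a j)

/-- The observable `h` has a moment `⟨ν_{t,x}, h⟩` that is absolutely convergent and locally
integrable on `[0, T) × D^k`, up to the boundary of the period cell. -/
def HasLocallyIntegrableMoment {d N k : ℕ} (D : Set (Space d)) (T : EReal)
    (ν : ℝ → (Fin k → Space d) → Measure (Fin k → State N)) (h : (Fin k → State N) → ℝ) : Prop :=
  ∀ R T' : ℝ, (T' : EReal) < T →
    ∫⁻ z in (timeInterval T ∩ Set.Iic T') ×ˢ (domPow D k ∩ Metric.closedBall 0 R),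
      ∫⁻ ξ, ‖h ξ‖ₑ ∂(ν z.1 z.2) < ⊤

/-- The evolution equation of the `k`-th correlation marginal, in the sense of distributions and
component by component, with initial values given by `νbar`. -/
def MomentEquation {d N : ℕ} (f : Fin d → State N → State N) (J : Finset (Fin d)) (L : Fin d → ℝ)
    (T : EReal) (k : ℕ) (νbar : (Fin k → Space d) → Measure (Fin k → State N))
    (ν : ℝ → (Fin k → Space d) → Measure (Fin k → State N)) : Prop :=
  ∀ a : Fin k → Fin N,
    HasLocallyIntegrableMoment (cell J L) T ν (moment a) ∧
    (∀ i m, HasLocallyIntegrableMoment (cell J L) T ν (fluxMoment f a i m)) ∧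
    ∀ φ : (Fin k → Space d) × ℝ → ℝ, IsTestFunction J L T k φ →
      (∫ t in timeInterval T, ∫ x in domPow (cell J L) k,
          ((∫ ξ, moment a ξ ∂(ν t x)) * fderiv ℝ φ (x, t) (0, 1)
            + ∑ i, ∑ m, (∫ ξ, fluxMoment f a i m ξ ∂(ν t x)) *
                fderiv ℝ φ (x, t) (Pi.single i (EuclideanSpace.single m 1), 0)))
        + ∫ x in domPow (cell J L) k, (∫ ξ, moment a ξ ∂(νbar x)) * φ (x, 0) = 0

/-- Statistical solutions on `[0, T)` of `∂_t u + ∑_m ∂_{x_m} f^m(u) = 0` with initial data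
`μbar`. Only the values of `μ` on `[0, T)` matter. -/
structure IsStatisticalSolution {d N : ℕ} (f : Fin d → State N → State N) (J : Finset (Fin d))
    (L : Fin d → ℝ) (T : EReal) (μbar : ProbabilityMeasure (L2 (cell J L) N))
    (μ : ℝ → ProbabilityMeasure (L2 (cell J L) N)) : Prop where
  initial : μ 0 = μbar
  initial_bounded : BoundedSupport μbar
  bounded : ∀ t ∈ timeInterval T, BoundedSupport (μ t)
  l2_bounded : L2Bounded (cell J L) T μ
  equation : ∃ νbar ν, IsCorrelationMeasure (cell J L) (μbar : Measure (L2 (cell J L) N)) νbar ∧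
    IsTimeCorrelationMeasure (cell J L) T μ ν ∧
    ∀ k, 0 < k → MomentEquation f J L T k (νbar k) (ν k)

/-! ### Dissipative statistical solutions -/

/-- An entropy pair: `η` convex and `q' = η' f'`. -/
structure IsEntropyPair {d N : ℕ} (f : Fin d → State N → State N) (η : State N → ℝ)
    (q : Fin d → State N → ℝ) : Prop where
  convex : ConvexOn ℝ Set.univ η
  differentiable : ∀ m, Differentiable ℝ (q m)
  compat : ∀ m u, fderiv ℝ (q m) u = (fderiv ℝ η u).comp (fderiv ℝ (f m) u)

/-- The set `Λ(α, μ)` of decompositions `μ = ∑ α_i μ_i` into probability measures. -/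
def decompositions {X : Type*} [MeasurableSpace X] {M : ℕ} (α : Fin M → ℝ≥0)
    (μ : ProbabilityMeasure X) : Set (Fin M → ProbabilityMeasure X) :=
  {μs | ∑ i, α i • (μs i : Measure X) = (μ : Measure X)}

/-- Dissipative statistical solutions, with respect to the entropy `η`. -/
structure IsDissipativeStatisticalSolution {d N : ℕ} (f : Fin d → State N → State N)
    (η : State N → ℝ) (J : Finset (Fin d)) (L : Fin d → ℝ) (T : EReal)
    (μbar : ProbabilityMeasure (L2 (cell J L) N))
    (μ : ℝ → ProbabilityMeasure (L2 (cell J L) N)) : Prop where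
  solution : IsStatisticalSolution f J L T μbar μ
  decomposition : ∀ (M : ℕ) (α : Fin M → ℝ≥0), (∀ i, 0 < α i) → ∑ i, α i = 1 →
    ∀ μsbar ∈ decompositions α μbar,
      ∃ μs : Fin M → ℝ → ProbabilityMeasure (L2 (cell J L) N),
        (∀ t ∈ timeInterval T, (fun i => μs i t) ∈ decompositions α (μ t)) ∧
        ∀ i, IsStatisticalSolution f J L T (μsbar i) (μs i)
  entropy : ∀ θ : ℝ → ℝ, ContDiff ℝ ∞ θ → (∀ t, 0 ≤ θ t) →
    (∃ T' : ℝ, (T' : EReal) < T ∧ ∀ t, θ t ≠ 0 → t ≤ T') →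
      0 ≤ (∫ t in timeInterval T,
            (∫ u, ∫ x in cell J L, η (u x) ∂volume ∂(μ t : Measure (L2 (cell J L) N)))
              * deriv θ t)
          + (∫ u, ∫ x in cell J L, η (u x) ∂volume ∂(μbar : Measure (L2 (cell J L) N))) * θ 0

/-! ### Strong statistical solutions -/

/-- A classical solution in the ball of radius `R` of `W^{1,∞}(D × [0, T); U)`: a bounded Lipschitz
function, periodic in the directions `j ∈ J`, that satisfies the equation almost everywhere. -/
structure IsClassicalSolution {d N : ℕ} (f : Fin d → State N → State N) (J : Finset (Fin d))
    (L : Fin d → ℝ) (T : EReal) (R : ℝ≥0) (v : ℝ → Space d → State N) : Prop where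
  periodic : ∀ t ∈ timeInterval T, ∀ j ∈ J, ∀ x,
    v t (x + EuclideanSpace.single j (L j)) = v t x
  bounded : ∀ t ∈ timeInterval T, ∀ x, ‖v t x‖ ≤ R
  lipschitz : LipschitzOnWith R (fun z : ℝ × Space d => v z.1 z.2) (timeInterval T ×ˢ Set.univ)
  equation : ∀ᵐ z : ℝ × Space d ∂(volume.restrict (timeInterval T ×ˢ cell J L)),
    deriv (fun s => v s z.2) z.1
      + ∑ m, fderiv ℝ (fun y => f m (v z.1 y)) z.2 (EuclideanSpace.single m 1) = 0

/-- Strong statistical solutions: statistical solutions that are `W₂`-approximable, uniformly in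
time, by finite convex combinations of Dirac masses on classical solutions from one ball of
`W^{1,∞}`. Here `V i t` is the class of `v i t` in `L²(D; U)`. -/
structure IsStrongStatisticalSolution {d N : ℕ} (f : Fin d → State N → State N)
    (J : Finset (Fin d)) (L : Fin d → ℝ) (T : EReal)
    (μbar : ProbabilityMeasure (L2 (cell J L) N))
    (μ : ℝ → ProbabilityMeasure (L2 (cell J L) N)) : Prop where
  solution : IsStatisticalSolution f J L T μbar μ
  approx : ∃ R : ℝ≥0, 0 < R ∧ ∀ n : ℕ, 0 < n →
    ∃ (M : ℕ) (α : Fin M → ℝ≥0) (v : Fin M → ℝ → Space d → State N)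
      (V : Fin M → ℝ → L2 (cell J L) N) (ρ : ℝ → ProbabilityMeasure (L2 (cell J L) N)),
      ∑ i, α i = 1 ∧
      (∀ i, IsClassicalSolution f J L T R (v i)) ∧
      (∀ i, ∀ t ∈ timeInterval T, V i t =ᵐ[volume.restrict (cell J L)] v i t) ∧
      (∀ t ∈ timeInterval T,
        (ρ t : Measure (L2 (cell J L) N)) = ∑ i, α i • Measure.dirac (V i t)) ∧
      MemPT (cell J L) T ρ ∧
      ∀ t ∈ timeInterval T,
        wasserstein 2 (μ t : Measure (L2 (cell J L) N)) (ρ t) ≤ (n : ℝ≥0∞)⁻¹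

end StatSol

end

open Filter Topology ProbabilityTheory

namespace StatSol

/-! ### Young measures are Markov kernels -/

/-! The proof is the relative entropy method of Dafermos and DiPerna, carried out for probability
measures on `L²`. Fix a finite `S < T` and approximate the strong solution by `ρ_t = ∑ α_i
δ_{v_i(t)}`, with `v_i` classical solutions bounded in `W^{1,∞}` by one constant `R`.

A nearly optimal plan from `μbar` to `ρ_0`, conditioned on its second coordinate, splits `μbar = ∑
α_i μbar_i` so that `∑ α_i ∫ ‖u - v_i(0)‖² dμbar_i` is the cost of the plan
(`exists_mem_decompositions`). Dissipativity supplies statistical solutions `γ_i` that start from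
`μbar_i` and satisfy `∑ α_i γ_{i,t} = γ_t`. Each `γ_i` is then compared with its own `v_i`.

The relative entropy `η(ξ) - η(v) - η'(v)(ξ - v)` lies between `c/2 |ξ - v|²` and `C/2 |ξ - v|²`.
Its subtracted part is affine in `ξ`, so its evolution follows from the equation for the first
moments alone, tested with `θ η'(v)`; no marginal beyond `k = 1` enters. By the equation for `v` and
the symmetry of `η'' f'`, the terms linear in `ξ - v` cancel, and what is left is a Taylor remainder
of the flux, at most `d C R K |ξ - v|²` (`localized_balance`, `tangent_balance`). The part `η(ξ)` is
controlled only for the mixture `γ`, by the entropy inequality, which is why the estimate is summed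
over `i` before Gronwall is applied (`ae_sum_sqDist_le`). The outcome is `∑ α_i ∫ ‖u - v_i(t)‖²
dγ_{i,t} ≤ (C/c) exp(2 d C R K t / c) ∑ α_i ∫ ‖u - v_i(0)‖² dμbar_i`. Sending each `γ_{i,t}` to its
atom turns the left side into the cost of a plan from `γ_t` to `ρ_t` (`exists_coupling_stability`).
The constant does not depend on the approximation, so `γ_t` and `μ_t` are both transported to common
measures at arbitrarily small cost, hence agree (`eq_of_couplings`).

Three technical points carry the rest. The first marginals are realised as Markov kernels, whose
joint law with Lebesgue measure is the law of `(x, u(x))` (`compProd_eq_jointLaw`). The test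
functions `θ η'(v)` are only Lipschitz, so the weak form is extended by mollification
(`IsWeakSolution.equation_lipschitz`). In unbounded directions a spatial cutoff is removed in the
limit, which needs all majorants to be integrable over `D`; this holds because on a domain of
infinite measure `η` must vanish to first order at the origin (`exists_integrableOn_const_entropy`).
-/

theorem exists_countable_isPiSystem_isOpen (V : Type*) [TopologicalSpace V]
    [SecondCountableTopology V] :
    ∃ S : Set (Set V), S.Countable ∧ IsPiSystem S ∧ (∀ G ∈ S, IsOpen G) ∧
      borel V = MeasurableSpace.generateFrom S := by
  set B := TopologicalSpace.countableBasis V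
  have hB := TopologicalSpace.isBasis_countableBasis V
  refine ⟨(fun F : Set (Set V) => ⋂₀ F) '' {F | F.Finite ∧ F ⊆ B}, ?_, ?_, ?_, ?_⟩
  · exact (Set.countable_ofPred_finite_subset (TopologicalSpace.countable_countableBasis V)).image _
  · rintro _ ⟨F, hF, rfl⟩ _ ⟨G, hG, rfl⟩ -
    exact ⟨F ∪ G, ⟨hF.1.union hG.1, union_subset hF.2 hG.2⟩, sInter_union F G⟩
  · rintro _ ⟨F, hF, rfl⟩
    exact hF.1.isOpen_sInter fun s hs => hB.isOpen (hF.2 hs)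
  · rw [hB.borel_eq_generateFrom]
    apply le_antisymm
    · refine MeasurableSpace.generateFrom_mono fun s hs => ⟨{s}, ⟨finite_singleton s, ?_⟩, by simp⟩
      simpa using hs
    · refine MeasurableSpace.generateFrom_le ?_
      rintro _ ⟨F, hF, rfl⟩
      exact MeasurableSet.sInter hF.1.countable
        fun s hs => MeasurableSpace.measurableSet_generateFrom (hF.2 hs)

/-- The indicator of a closed set is a limit of continuous functions with values in `[0, 1]`, whose
integrals are measurable by hypothesis. Open sets follow by taking complements, since almost every
measure has mass one. -/
theorem IsYoungMeasure.aemeasurable_apply_isOpen {Z V : Type*} [MeasurableSpace Z]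
    [TopologicalSpace V] [MeasurableSpace V] [OpensMeasurableSpace V] [HasOuterApproxClosed V]
    {m : Measure Z} {ν : Z → Measure V} (h : IsYoungMeasure m ν) {G : Set V} (hG : IsOpen G) :
    AEMeasurable (fun z => ν z G) m := by
  have hF : IsClosed Gᶜ := hG.isClosed_compl
  have key : AEMeasurable (fun z => ν z Gᶜ) m := by
    refine aemeasurable_of_tendsto_metrizable_ae (u := atTop)
      (f := fun n z => ENNReal.ofReal (∫ ξ, (hF.apprSeq n ξ : ℝ) ∂(ν z))) ?_ ?_
    · intro n
      exact (h.meas (BoundedContinuousFunction.ofNormedAddCommGroup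
        (fun ξ => (hF.apprSeq n ξ : ℝ)) (by fun_prop) 1
        (fun ξ => by simpa using HasOuterApproxClosed.apprSeq_apply_le_one hF n ξ))).ennreal_ofReal
    · filter_upwards [h.prob] with z hz
      refine (HasOuterApproxClosed.tendsto_lintegral_apprSeq hF (ν z)).congr fun n => ?_
      rw [← BoundedContinuousFunction.toReal_lintegral_coe_eq_integral, ENNReal.ofReal_toReal]
      exact (BoundedContinuousFunction.lintegral_lt_top_of_nnreal _ _).ne
  refine (key.const_sub 1).congr ?_
  filter_upwards [h.prob] with z hz
  rw [prob_compl_eq_one_sub hG.measurableSet, ENNReal.sub_sub_cancel ENNReal.one_ne_top prob_le_one]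

/-- Measurability on a countable π-system of open sets determines measurability of the whole family.
Countability allows all exceptional null sets to be collected into a single measurable one, on which
the measure is replaced by a Dirac mass. -/
theorem IsYoungMeasure.exists_kernel {Z V : Type*} [MeasurableSpace Z] [TopologicalSpace V]
    [MeasurableSpace V] [BorelSpace V] [HasOuterApproxClosed V] [SecondCountableTopology V]
    [Nonempty V] {m : Measure Z} {ν : Z → Measure V} (h : IsYoungMeasure m ν) :
    ∃ κ : Kernel Z V, IsMarkovKernel κ ∧ ∀ᵐ z ∂m, κ z = ν z := by
  classical
  obtain ⟨S, hSc, hSpi, hSo, hSgen⟩ := exists_countable_isPiSystem_isOpen V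
  have hS : ∀ G : S, AEMeasurable (fun z => ν z G) m :=
    fun G => h.aemeasurable_apply_isOpen (hSo G G.2)
  have : Countable S := hSc
  have hbad : ∀ᵐ z ∂m, IsProbabilityMeasure (ν z) ∧ ∀ G : S, ν z G = (hS G).mk _ z :=
    h.prob.and (ae_all_iff.2 fun G => (hS G).ae_eq_mk)
  set bad := toMeasurable m {z | ¬ (IsProbabilityMeasure (ν z) ∧ ∀ G : S, ν z G = (hS G).mk _ z)}
  have hbadm : MeasurableSet bad := measurableSet_toMeasurable _ _
  have hbad0 : m bad = 0 := by rw [measure_toMeasurable]; exact hbad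
  have hgood : ∀ z, z ∉ bad → IsProbabilityMeasure (ν z) ∧ ∀ G : S, ν z G = (hS G).mk _ z := by
    intro z hz
    by_contra hc
    exact hz (subset_toMeasurable m _ hc)
  let κ : Z → Measure V := fun z => if z ∈ bad then Measure.dirac (Classical.arbitrary V) else ν z
  have hκ : ∀ z, IsProbabilityMeasure (κ z) := by
    intro z
    by_cases hz : z ∈ bad
    · simp only [κ, hz, if_true]; infer_instance
    · simp only [κ, hz, if_false]; exact (hgood z hz).1
  have hmeas : Measurable κ := by
    refine Measurable.measure_of_isPiSystem_of_isProbabilityMeasure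
      ((BorelSpace.measurable_eq (α := V)).trans hSgen) hSpi fun G hG => ?_
    have : (fun z => κ z G) = fun z => if z ∈ bad then Measure.dirac (Classical.arbitrary V) G
        else (hS ⟨G, hG⟩).mk _ z := by
      funext z
      by_cases hz : z ∈ bad
      · simp [κ, hz]
      · simp only [κ, hz, if_false]; exact (hgood z hz).2 ⟨G, hG⟩
    rw [this]
    exact Measurable.ite hbadm measurable_const (hS ⟨G, hG⟩).measurable_mk
  refine ⟨⟨κ, hmeas⟩, ⟨hκ⟩, ?_⟩
  filter_upwards [(measure_eq_zero_iff_ae_notMem.1 hbad0)] with z hz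
  simp [κ, hz]

/-! ### A jointly measurable evaluation on `Lᵖ` -/

theorem enorm_sq_eq_lintegral {X E : Type*} [MeasurableSpace X] [NormedAddCommGroup E]
    {m : Measure X} (u : Lp E 2 m) : ‖u‖ₑ ^ 2 = ∫⁻ x, ‖u x‖ₑ ^ 2 ∂m := by
  have := eLpNorm_nnreal_pow_eq_lintegral (f := u) (μ := m) (p := 2) (by norm_num)
  simp only [NNReal.coe_ofNat, ENNReal.coe_ofNat, ENNReal.rpow_ofNat] at this
  rw [← this, Lp.enorm_def]

theorem enorm_sub_sq_eq_lintegral {X E : Type*} [MeasurableSpace X] [NormedAddCommGroup E]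
    {m : Measure X} (u w : Lp E 2 m) : ‖u - w‖ₑ ^ 2 = ∫⁻ x, ‖u x - w x‖ₑ ^ 2 ∂m := by
  rw [enorm_sq_eq_lintegral]
  refine lintegral_congr_ae ?_
  filter_upwards [Lp.coeFn_sub u w] with x hx
  rw [hx, Pi.sub_apply]

/-- There is a jointly measurable version of the evaluation `(u, x) ↦ u x` on `L² × X`. -/
theorem exists_measurable_eval {X E : Type*} [MeasurableSpace X] [NormedAddCommGroup E]
    [MeasurableSpace E] [BorelSpace E] [CompleteSpace E] [SecondCountableTopology E]
    (m : Measure X) [MeasurableSpace (Lp E 2 m)] [BorelSpace (Lp E 2 m)]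
    [TopologicalSpace.SeparableSpace (Lp E 2 m)] :
    ∃ ev : Lp E 2 m × X → E, Measurable ev ∧ ∀ u : Lp E 2 m, ∀ᵐ x ∂m, ev (u, x) = u x := by
  classical
  -- Round `u` to the first member of a dense sequence within distance `2⁻ᵏ`. The index depends
  -- measurably on `u`, and each of the countably many members has a fixed measurable
  -- representative.
  let s : ℕ → Lp E 2 m := TopologicalSpace.denseSeq (Lp E 2 m)
  have hs : ∀ (k : ℕ) (u : Lp E 2 m), ∃ n, dist u (s n) < (1 / 2 : ℝ) ^ k := by
    intro k u
    obtain ⟨_, hn, n, rfl⟩ := Metric.dense_iff.1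
      (TopologicalSpace.denseRange_denseSeq (Lp E 2 m)) u ((1 / 2 : ℝ) ^ k) (by positivity)
    exact ⟨n, by simpa [dist_comm] using hn⟩
  obtain ⟨idx, hidx, hidx'⟩ : ∃ idx : ℕ → Lp E 2 m → ℕ, (∀ k, Measurable (idx k)) ∧
      ∀ k u, dist u (s (idx k u)) < (1 / 2 : ℝ) ^ k :=
    ⟨fun k u => Nat.find (hs k u), fun k => measurable_find (hs k) fun n =>
      measurableSet_lt (measurable_id.dist measurable_const) measurable_const,
      fun k u => Nat.find_spec (hs k u)⟩
  obtain ⟨rep, hrep, hrep'⟩ : ∃ rep : ℕ → X → E, (∀ n, Measurable (rep n)) ∧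
      ∀ n, s n =ᵐ[m] rep n :=
    ⟨fun n => (Lp.aestronglyMeasurable (s n)).mk _, fun n =>
      (Lp.aestronglyMeasurable (s n)).stronglyMeasurable_mk.measurable,
      fun n => (Lp.aestronglyMeasurable (s n)).ae_eq_mk⟩
  let F : ℕ → Lp E 2 m × X → E := fun k z => rep (idx k z.1) z.2
  have hF : ∀ k, Measurable (F k) := by
    intro k
    have h1 : Measurable (fun q : ℕ × X => rep q.1 q.2) :=
      measurable_from_prod_countable_right fun n => hrep n
    exact h1.comp (((hidx k).comp measurable_fst).prodMk measurable_snd)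
  -- The rounded evaluations are cut off outside their measurable set of convergence, so that a
  -- limit exists everywhere and is measurable.
  let C : Set (Lp E 2 m × X) := {z | ∃ c, Tendsto (fun k => F k z) atTop (𝓝 c)}
  have hC : MeasurableSet C := measurableSet_exists_tendsto hF
  let G : ℕ → Lp E 2 m × X → E := fun k => C.indicator (F k)
  have hG : ∀ z, ∃ c, Tendsto (fun k => G k z) atTop (𝓝 c) := by
    intro z
    by_cases hz : z ∈ C
    · simpa [G, hz] using (id hz : ∃ c, Tendsto (fun k => F k z) atTop (𝓝 c))
    · exact ⟨0, by simp [G, hz]⟩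
  choose ev hev using hG
  refine ⟨ev, measurable_of_tendsto_metrizable (fun k => (hF k).indicator hC)
    (tendsto_pi_nhds.2 hev), fun u => ?_⟩
  have hterm : ∀ k, AEMeasurable (fun x => ‖u x - s (idx k u) x‖ₑ ^ 2) m := fun k =>
    ((Lp.aestronglyMeasurable u).sub (Lp.aestronglyMeasurable (s (idx k u)))).enorm.pow_const 2
  -- The rounding errors decay geometrically in `L²`, so their squares are summable at almost every
  -- point and the full sequence converges there.
  have hsum : ∫⁻ x, ∑' k, ‖u x - s (idx k u) x‖ₑ ^ 2 ∂m ≠ ⊤ := by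
    rw [lintegral_tsum hterm]
    have hle : ∀ k, ∫⁻ x, ‖u x - s (idx k u) x‖ₑ ^ 2 ∂m ≤ (2⁻¹ : ℝ≥0∞) ^ k := by
      intro k
      rw [← enorm_sub_sq_eq_lintegral]
      have h1 : ‖u - s (idx k u)‖ₑ ≤ (2⁻¹ : ℝ≥0∞) ^ k := by
        have := (hidx' k u).le
        rw [dist_eq_norm] at this
        rw [← ofReal_norm]
        refine (ENNReal.ofReal_le_ofReal this).trans_eq ?_
        rw [ENNReal.ofReal_pow (by norm_num), one_div, ENNReal.ofReal_inv_of_pos (by norm_num),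
          ENNReal.ofReal_ofNat]
      refine (pow_le_pow_left' h1 2).trans ?_
      rw [← pow_mul]
      exact pow_le_pow_right_of_le_one' (by simp) (by omega)
    refine ((ENNReal.tsum_le_tsum hle).trans_lt ?_).ne
    rw [ENNReal.tsum_geometric]
    simp [ENNReal.one_sub_inv_two]
  have hmeas : AEMeasurable (fun x => ∑' k, ‖u x - s (idx k u) x‖ₑ ^ 2) m :=
    AEMeasurable.tsum hterm
  filter_upwards [ae_lt_top' hmeas hsum,
    ae_all_iff.2 fun k => hrep' (idx k u)] with x hx hk
  have h0 := ENNReal.tendsto_atTop_zero_of_tsum_ne_top hx.ne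
  have hlim : Tendsto (fun k => F k (u, x)) atTop (𝓝 (u x)) := by
    rw [tendsto_iff_edist_tendsto_0]
    have h1 : Tendsto (fun k => (‖u x - s (idx k u) x‖ₑ ^ 2) ^ (1 / 2 : ℝ)) atTop (𝓝 0) := by
      simpa [Function.comp_def] using (ENNReal.continuous_rpow_const (y := (1 / 2 : ℝ))).tendsto 0 |>.comp h0
    refine h1.congr fun k => ?_
    rw [← ENNReal.rpow_natCast, ← ENNReal.rpow_mul]
    norm_num
    rw [edist_comm, edist_eq_enorm_sub, hk k]
  have hz : (u, x) ∈ C := ⟨_, hlim⟩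
  refine tendsto_nhds_unique (hev (u, x)) ?_
  simpa [G, hz] using hlim

end StatSol

namespace StatSol

/-! ### The first correlation marginal as a joint law -/

theorem measurePreserving_const_fin_one {d : ℕ} (D : Set (Space d)) (hD : MeasurableSet D) :
    MeasurePreserving (MeasurableEquiv.funUnique (Fin 1) (Space d)).symm
      (volume.restrict D) (volume.restrict (domPow D 1)) := by
  have h := (volume_preserving_funUnique (Fin 1) (Space d)).symm
  have h2 : domPow D 1 = (MeasurableEquiv.funUnique (Fin 1) (Space d)) ⁻¹' D := by
    ext x
    simp [domPow]
  have h3 : D = (MeasurableEquiv.funUnique (Fin 1) (Space d)).symm ⁻¹' (domPow D 1) := by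
    ext x
    simp [domPow]
  have := h.restrict_preimage (s := domPow D 1) (by
    rw [h2]; exact (MeasurableEquiv.funUnique (Fin 1) (Space d)).measurable hD)
  rwa [← h3] at this

theorem setIntegral_domPow_one {d : ℕ} {D : Set (Space d)} (hD : MeasurableSet D)
    {E : Type*} [NormedAddCommGroup E] [NormedSpace ℝ E] (F : (Fin 1 → Space d) → E) :
    ∫ x in domPow D 1, F x = ∫ x in D, F (fun _ => x) :=
  ((measurePreserving_const_fin_one D hD).integral_comp
    (MeasurableEquiv.funUnique (Fin 1) (Space d)).symm.measurableEmbedding F).symm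

theorem ae_domPow_one_iff {d : ℕ} {D : Set (Space d)} (hD : MeasurableSet D)
    {P : (Fin 1 → Space d) → Prop} :
    (∀ᵐ x ∂volume.restrict (domPow D 1), P x) ↔ ∀ᵐ x ∂volume.restrict D, P fun _ => x := by
  rw [← (measurePreserving_const_fin_one D hD).map_eq]
  exact (MeasurableEquiv.funUnique (Fin 1) (Space d)).symm.measurableEmbedding.ae_map_iff

/-- A function in `C₀(U)`, as a function of the single entry of a vector in `U¹`. -/
def zeroAtInftyFinOne {N : ℕ} (c : C₀(State N, ℝ)) : C₀(Fin 1 → State N, ℝ) where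
  toFun ξ := c (ξ 0)
  continuous_toFun := by fun_prop
  zero_at_infty' := (zero_at_infty c).comp
    (Homeomorph.funUnique (Fin 1) (State N)).isClosedEmbedding.tendsto_cocompact

/-- Duality for `k = 1`, tested with products `a(x) c(ξ)`. These already determine the joint law. -/
theorem IsDual.integral_mul {d N : ℕ} {D : Set (Space d)} (hD : MeasurableSet D)
    {γ : Measure (L2 D N)} {ν : (k : ℕ) → (Fin k → Space d) → Measure (Fin k → State N)}
    (h : IsDual D γ ν) {a : Space d → ℝ} (ha : Integrable a (volume.restrict D))
    (c : C₀(State N, ℝ)) :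
    ∫ x in D, a x * ∫ ξ, c (ξ 0) ∂(ν 1 (fun _ => x)) = ∫ u, ∫ x in D, a x * c (u x) ∂volume ∂γ := by
  have hmp := measurePreserving_const_fin_one D hD
  have hg : Integrable (fun x : Fin 1 → Space d => a (x 0) • zeroAtInftyFinOne c)
      (volume.restrict (domPow D 1)) := by
    rw [← hmp.integrable_comp_emb
      (MeasurableEquiv.funUnique (Fin 1) (Space d)).symm.measurableEmbedding]
    exact ha.smul_const _
  have := h 1 _ hg
  simp only [setIntegral_domPow_one hD] at this
  simpa [zeroAtInftyFinOne, integral_const_mul] using this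

/-- The law of `(x, u(x))`, for `u` distributed according to `γ` and `x` to Lebesgue measure
on `D`. -/
noncomputable def jointLaw {d N : ℕ} {D : Set (Space d)} (ev : L2 D N × Space d → State N)
    (γ : Measure (L2 D N)) : Measure (Space d × State N) :=
  (γ.prod (volume.restrict D)).map fun z => (z.2, ev z)

theorem lintegral_jointLaw {d N : ℕ} {D : Set (Space d)} {ev : L2 D N × Space d → State N}
    (hev : Measurable ev) (hev' : ∀ u : L2 D N, ∀ᵐ x ∂volume.restrict D, ev (u, x) = u x)
    (γ : Measure (L2 D N)) [SFinite γ] {h : Space d × State N → ℝ≥0∞} (hh : Measurable h) :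
    ∫⁻ z, h z ∂(jointLaw ev γ) = ∫⁻ u, ∫⁻ x in D, h (x, u x) ∂volume ∂γ := by
  rw [jointLaw, lintegral_map hh (by fun_prop), lintegral_prod _ (by fun_prop)]
  refine lintegral_congr fun u => lintegral_congr_ae ?_
  filter_upwards [hev' u] with x hx
  rw [hx]

theorem integral_jointLaw {d N : ℕ} {D : Set (Space d)} {ev : L2 D N × Space d → State N}
    (hev : Measurable ev) (hev' : ∀ u : L2 D N, ∀ᵐ x ∂volume.restrict D, ev (u, x) = u x)
    (γ : Measure (L2 D N)) [SFinite γ] {h : Space d × State N → ℝ} (hm : Measurable h)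
    (hh : Integrable h (jointLaw ev γ)) :
    Integrable (fun u : L2 D N => ∫ x in D, h (x, u x)) γ ∧
      ∫ z, h z ∂(jointLaw ev γ) = ∫ u, ∫ x in D, h (x, u x) ∂volume ∂γ := by
  have hmeas : Measurable fun z : L2 D N × Space d => (z.2, ev z) := by fun_prop
  have hint := (integrable_map_measure hm.aestronglyMeasurable hmeas.aemeasurable).1 hh
  have heq : ∀ u : L2 D N, ∫ x in D, h (x, ev (u, x)) = ∫ x in D, h (x, u x) := by
    intro u
    refine integral_congr_ae ?_
    filter_upwards [hev' u] with x hx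
    rw [hx]
  refine ⟨?_, ?_⟩
  · simpa [Function.comp_def, heq] using hint.integral_prod_left
  · rw [jointLaw, integral_map hmeas.aemeasurable hm.aestronglyMeasurable, 
      integral_prod (fun z => h (z.2, ev z)) hint]
    exact integral_congr_ae (.of_forall heq)

/-- Over a base set `A` of finite measure both sides are finite measures, and duality with `a = 1_A`
equates their integrals of compactly supported functions of `ξ`; these determine a measure. The base
is then exhausted by sets of finite measure, because `D` itself may have infinite measure. -/
theorem compProd_eq_jointLaw {d N : ℕ} {D : Set (Space d)} (hD : MeasurableSet D)
    {ev : L2 D N × Space d → State N}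
    (hev : Measurable ev) (hev' : ∀ u : L2 D N, ∀ᵐ x ∂volume.restrict D, ev (u, x) = u x)
    (γ : Measure (L2 D N)) [IsProbabilityMeasure γ]
    {ν : (k : ℕ) → (Fin k → Space d) → Measure (Fin k → State N)} (h : IsDual D γ ν)
    (κ : Kernel (Space d) (State N)) [IsMarkovKernel κ]
    (hκ : ∀ᵐ x ∂volume.restrict D, κ x = (ν 1 fun _ => x).map fun ξ => ξ 0) :
    (volume.restrict D) ⊗ₘ κ = jointLaw ev γ := by
  have hmeas : Measurable fun z : L2 D N × Space d => (z.2, ev z) := by fun_prop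
  -- agreement on rectangles
  have key : ∀ A : Set (Space d), MeasurableSet A → volume.restrict D A ≠ ⊤ →
      ∀ B : Set (State N), MeasurableSet B →
        ((volume.restrict D) ⊗ₘ κ) (A ×ˢ B) = jointLaw ev γ (A ×ˢ B) := by
    intro A hA hAfin B hB
    set m1 : Measure (State N) := (((volume.restrict D) ⊗ₘ κ).restrict (A ×ˢ univ)).map Prod.snd
    set m2 : Measure (State N) := ((jointLaw ev γ).restrict (A ×ˢ univ)).map Prod.snd
    have hA1 : ((volume.restrict D) ⊗ₘ κ) (A ×ˢ univ) = volume.restrict D A := by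
      rw [Measure.compProd_apply_prod hA MeasurableSet.univ]; simp
    have hA2 : jointLaw ev γ (A ×ˢ univ) = volume.restrict D A := by
      rw [jointLaw, Measure.map_apply hmeas (hA.prod MeasurableSet.univ)]
      have : (fun z : L2 D N × Space d => (z.2, ev z)) ⁻¹' A ×ˢ univ = univ ×ˢ A := by
        ext z; simp
      rw [this, Measure.prod_prod, measure_univ, one_mul]
    have : IsFiniteMeasure (((volume.restrict D) ⊗ₘ κ).restrict (A ×ˢ univ)) :=
      isFiniteMeasure_restrict.2 (by rwa [hA1])
    have : IsFiniteMeasure ((jointLaw ev γ).restrict (A ×ˢ univ)) :=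
      isFiniteMeasure_restrict.2 (by rwa [hA2])
    have hm : m1 = m2 := by
      refine Measure.ext_of_integral_eq_on_compactlySupported fun c => ?_
      let c0 : C₀(State N, ℝ) := ⟨⟨c, c.continuous⟩, c.hasCompactSupport.is_zero_at_infty⟩
      have hc0 : ∀ ξ, c ξ = c0 ξ := fun _ => rfl
      have hcm : Measurable c0 := c0.continuous.measurable
      obtain ⟨K, hK⟩ : ∃ K, ∀ ξ, ‖c0 ξ‖ ≤ K := ⟨‖c0.toBCF‖, fun ξ => c0.toBCF.norm_coe_le_norm ξ⟩
      have hbd : ∀ (M : Measure (Space d × State N)), M (A ×ˢ univ) ≠ ⊤ →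
          Integrable (fun z : Space d × State N => A.indicator (1 : Space d → ℝ) z.1 * c0 z.2) M := by
        intro M hM
        have : IntegrableOn (fun _ : Space d × State N => K) (A ×ˢ univ) M :=
          integrableOn_const hM
        refine (this.integrable_indicator (hA.prod MeasurableSet.univ)).mono'
          (by fun_prop (disch := assumption)) (.of_forall fun z => ?_)
        by_cases hz : z.1 ∈ A
        · simpa [hz] using hK z.2
        · simp [hz]
      have hloc : ∀ (M : Measure (Space d × State N)), ∫ ξ, c ξ ∂((M.restrict (A ×ˢ univ)).map Prod.snd)
          = ∫ z, A.indicator (1 : Space d → ℝ) z.1 * c0 z.2 ∂M := by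
        intro M
        rw [integral_map measurable_snd.aemeasurable (by fun_prop),
          ← integral_indicator (hA.prod MeasurableSet.univ)]
        refine integral_congr_ae (.of_forall fun z => ?_)
        by_cases hz : z.1 ∈ A <;> simp [hz, hc0]
      rw [hloc, hloc, Measure.integral_compProd (hbd _ (by rwa [hA1])),
        (integral_jointLaw hev hev' γ (by fun_prop (disch := assumption))
          (hbd _ (by rwa [hA2]))).2]
      simp only [integral_const_mul]
      rw [← h.integral_mul hD (a := A.indicator 1) (by
        exact (integrable_indicator_iff hA).2 (integrableOn_const hAfin)) c0]
      refine integral_congr_ae ?_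
      filter_upwards [hκ] with x hx
      rw [hx, integral_map (measurable_pi_apply 0).aemeasurable hcm.aestronglyMeasurable]
    have hB1 : ∀ M : Measure (Space d × State N),
        ((M.restrict (A ×ˢ univ)).map Prod.snd) B = M (A ×ˢ B) := by
      intro M
      rw [Measure.map_apply measurable_snd hB, Measure.restrict_apply (measurable_snd hB)]
      congr 1
      ext z; simp [and_comm]
    rw [← hB1, ← hB1]
    exact congrArg (· B) hm
  let S : ℕ → Set (Space d) := spanningSets (volume.restrict D)
  have hS : ∀ n, MeasurableSet (S n) := measurableSet_spanningSets _
  have hSfin : ∀ n, volume.restrict D (S n) ≠ ⊤ := fun n => (measure_spanningSets_lt_top _ n).ne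
  have hcover : ⋃ n, (S n ×ˢ (univ : Set (State N))) = univ := by
    rw [← iUnion_prod_const, iUnion_spanningSets, univ_prod_univ]
  refine (Measure.ext_iff_of_iUnion_eq_univ hcover).2 fun n => ?_
  have hn : ∀ {A : Set (Space d)} {B : Set (State N)}, MeasurableSet A → MeasurableSet B →
      ((volume.restrict D ⊗ₘ κ).restrict (S n ×ˢ univ)) (A ×ˢ B)
        = ((jointLaw ev γ).restrict (S n ×ˢ univ)) (A ×ˢ B) := by
    intro A B hA hB
    rw [Measure.restrict_apply (hA.prod hB), Measure.restrict_apply (hA.prod hB), prod_inter_prod,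
      inter_univ]
    exact key _ (hA.inter (hS n)) (ne_top_of_le_ne_top (hSfin n) (measure_mono inter_subset_right))
      B hB
  have : IsFiniteMeasure ((volume.restrict D ⊗ₘ κ).restrict (S n ×ˢ univ)) := by
    refine isFiniteMeasure_restrict.2 ?_
    rw [Measure.compProd_apply_prod (hS n) MeasurableSet.univ]
    simpa using hSfin n
  exact Measure.ext_prod hn

end StatSol

namespace StatSol

/-! ### Integration against kernels with finite second moment -/

theorem quasiMeasurePreserving_fst_compProd {B V : Type*} [MeasurableSpace B] [MeasurableSpace V]
    (m : Measure B) [SFinite m] (κ : Kernel B V) [IsMarkovKernel κ] :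
    Measure.QuasiMeasurePreserving Prod.fst (m ⊗ₘ κ) m := by
  refine ⟨measurable_fst, ?_⟩
  have := Measure.fst_compProd m κ
  rw [Measure.fst] at this
  rw [this]

theorem ae_compProd_of_ae {B V : Type*} [MeasurableSpace B] [MeasurableSpace V]
    {m : Measure B} [SFinite m] (κ : Kernel B V) [IsMarkovKernel κ] {p : B → Prop}
    (h : ∀ᵐ z ∂m, p z) : ∀ᵐ z ∂(m ⊗ₘ κ), p z.1 :=
  (quasiMeasurePreserving_fst_compProd m κ).ae h

theorem integrable_comp_fst_compProd {B V : Type*} [MeasurableSpace B] [MeasurableSpace V]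
    {m : Measure B} [SFinite m] (κ : Kernel B V) [IsMarkovKernel κ] {b : B → ℝ}
    (h : Integrable b m) : Integrable (fun z : B × V => b z.1) (m ⊗ₘ κ) := by
  have hm := Measure.fst_compProd m κ
  rw [Measure.fst] at hm
  rw [← hm] at h
  exact h.comp_measurable measurable_fst

theorem integral_comp_fst_compProd {B V : Type*} [MeasurableSpace B] [MeasurableSpace V]
    {m : Measure B} [SFinite m] (κ : Kernel B V) [IsMarkovKernel κ] {b : B → ℝ}
    (h : AEStronglyMeasurable b m) : ∫ z : B × V, b z.1 ∂(m ⊗ₘ κ) = ∫ z, b z ∂m := by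
  have hm := Measure.fst_compProd m κ
  rw [Measure.fst] at hm
  rw [← hm] at h
  conv_rhs => rw [← hm]
  exact (integral_map measurable_fst.aemeasurable h).symm

/-- Finite second moment of the second component. -/
def FiniteEnergy {B V : Type*} [MeasurableSpace B] [MeasurableSpace V] [NormedAddCommGroup V]
    (Γ : Measure (B × V)) : Prop :=
  ∫⁻ z, ‖z.2‖ₑ ^ 2 ∂Γ < ⊤

theorem FiniteEnergy.integrable_sq {B V : Type*} [MeasurableSpace B] [MeasurableSpace V]
    [NormedAddCommGroup V] [BorelSpace V] {Γ : Measure (B × V)} (h : FiniteEnergy Γ) :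
    Integrable (fun z : B × V => ‖z.2‖ ^ 2) Γ := by
  refine ⟨(by fun_prop : Measurable fun z : B × V => ‖z.2‖ ^ 2).aestronglyMeasurable, ?_⟩
  simpa [HasFiniteIntegral, FiniteEnergy] using h

/-- Every integrand below grows at most quadratically in `ξ`. The part `b` that does not grow must
be integrable over the base, where constants may fail to be. -/
theorem FiniteEnergy.integrable {B V : Type*} [MeasurableSpace B] [MeasurableSpace V]
    [NormedAddCommGroup V] [BorelSpace V] {m : Measure B} [SFinite m] {κ : Kernel B V}
    [IsMarkovKernel κ] (h : FiniteEnergy (m ⊗ₘ κ)) {b : B → ℝ} (hb : Integrable b m) {C : ℝ}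
    {E : Type*} [NormedAddCommGroup E]
    {G : B × V → E} (hG : AEStronglyMeasurable G (m ⊗ₘ κ))
    (hle : ∀ᵐ z ∂(m ⊗ₘ κ), ‖G z‖ ≤ b z.1 + C * ‖z.2‖ ^ 2) : Integrable G (m ⊗ₘ κ) :=
  ((integrable_comp_fst_compProd κ hb).add (h.integrable_sq.const_mul C)).mono' hG hle

/-! ### The space-time domain and its test functions -/

theorem isOpen_cell {d : ℕ} (J : Finset (Fin d)) (L : Fin d → ℝ) : IsOpen (cell J L) := by
  have : cell J L = ⋂ j ∈ J, {x | 0 < x j ∧ x j < L j} := by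
    ext x; simp [cell]
  rw [this]
  refine isOpen_biInter_finset fun j _ => ?_
  have hj : Continuous fun x : Space d => x j := by fun_prop
  exact (isOpen_lt continuous_const hj).inter (isOpen_lt hj continuous_const)

theorem measurableSet_cell {d : ℕ} (J : Finset (Fin d)) (L : Fin d → ℝ) :
    MeasurableSet (cell J L) := (isOpen_cell J L).measurableSet

/-- Lebesgue measure on `[0, S] × D`. -/
noncomputable def spaceTime {d : ℕ} (J : Finset (Fin d)) (L : Fin d → ℝ) (S : ℝ) :
    Measure (ℝ × Space d) :=
  volume.restrict (Icc 0 S ×ˢ cell J L)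

theorem spaceTime_eq_prod {d : ℕ} (J : Finset (Fin d)) (L : Fin d → ℝ) (S : ℝ) :
    spaceTime J L S = (volume.restrict (Icc 0 S)).prod (volume.restrict (cell J L)) := by
  rw [spaceTime, Measure.volume_eq_prod, Measure.prod_restrict]

instance {d : ℕ} (J : Finset (Fin d)) (L : Fin d → ℝ) (S : ℝ) : SigmaFinite (spaceTime J L S) := by
  rw [spaceTime]; infer_instance

/-- Functions on space-time that are periodic in the directions in `J` and vanish for large
arguments in the other directions and for times close to `S`. -/
structure IsAdmissible {d : ℕ} (J : Finset (Fin d)) (L : Fin d → ℝ) (S : ℝ)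
    (Φ : ℝ × Space d → ℝ) : Prop where
  periodic : ∀ j ∈ J, ∀ (t : ℝ) (x : Space d), Φ (t, x + EuclideanSpace.single j (L j)) = Φ (t, x)
  support : ∃ R T' : ℝ, T' < S ∧ ∀ t x, Φ (t, x) ≠ 0 → t ≤ T' ∧ ∀ j ∉ J, |x j| ≤ R

theorem exists_norm_le_of_mem_cell {d : ℕ} (J : Finset (Fin d)) (L : Fin d → ℝ) (R : ℝ) :
    ∃ R' : ℝ, ∀ x ∈ cell J L, (∀ j ∉ J, |x j| ≤ R) → ‖x‖ ≤ R' := by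
  refine ⟨Real.sqrt (∑ j, (|L j| + |R|) ^ 2), fun x hx hR => ?_⟩
  rw [EuclideanSpace.norm_eq]
  refine Real.sqrt_le_sqrt (Finset.sum_le_sum fun j _ => ?_)
  refine pow_le_pow_left₀ (norm_nonneg _) ?_ 2
  rw [Real.norm_eq_abs]
  by_cases hj : j ∈ J
  · have h1 := hx j hj
    rw [abs_of_pos h1.1]
    exact h1.2.le.trans ((le_abs_self _).trans (by linarith [abs_nonneg R]))
  · exact (hR j hj).trans ((le_abs_self _).trans (by linarith [abs_nonneg (L j)]))

/-- The region allowed by the support condition is closed, so off it `Φ` vanishes in a whole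
neighbourhood. -/
theorem IsAdmissible.fderiv_eq_zero {d : ℕ} {J : Finset (Fin d)} {Φ : ℝ × Space d → ℝ}
    {R T' : ℝ} (h : ∀ t x, Φ (t, x) ≠ 0 → t ≤ T' ∧ ∀ j ∉ J, |x j| ≤ R) (t : ℝ) (x : Space d)
    (hx : fderiv ℝ Φ (t, x) ≠ 0) : t ≤ T' ∧ ∀ j ∉ J, |x j| ≤ R := by
  have hcl : IsClosed {z : ℝ × Space d | z.1 ≤ T' ∧ ∀ j ∉ J, |z.2 j| ≤ R} := by
    simp only [ofPred_and, ofPred_forall]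
    refine (isClosed_le (by fun_prop) (by fun_prop)).inter
      (isClosed_iInter fun j => isClosed_iInter fun _ => isClosed_le (by fun_prop) (by fun_prop))
  by_contra hc
  refine hx ?_
  have : Φ =ᶠ[𝓝 (t, x)] fun _ => 0 := by
    filter_upwards [hcl.isOpen_compl.mem_nhds hc] with z hz
    by_contra hne
    exact hz (h z.1 z.2 hne)
  rw [this.fderiv_eq]
  simp

/-- An admissible function and its derivative vanish on `[0, S] × D` outside a bounded set. -/
theorem IsAdmissible.exists_radius {d : ℕ} {J : Finset (Fin d)} {L : Fin d → ℝ} {S : ℝ}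
    {Φ : ℝ × Space d → ℝ} (h : IsAdmissible J L S Φ) :
    ∃ R : ℝ, ∀ t, ∀ x ∈ cell J L, R < ‖x‖ → Φ (t, x) = 0 ∧ fderiv ℝ Φ (t, x) = 0 := by
  obtain ⟨R, T', -, hR⟩ := h.support
  obtain ⟨R', hR'⟩ := exists_norm_le_of_mem_cell J L R
  refine ⟨R', fun t x hx hlt => ⟨?_, ?_⟩⟩
  · by_contra hc
    exact hlt.not_ge (hR' x hx (hR t x hc).2)
  · by_contra hc
    exact hlt.not_ge (hR' x hx (IsAdmissible.fderiv_eq_zero hR t x hc).2)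

theorem integrable_indicator_closedBall_spaceTime {d : ℕ} (J : Finset (Fin d)) (L : Fin d → ℝ)
    (S R C : ℝ) :
    Integrable (fun z : ℝ × Space d => (Metric.closedBall (0 : Space d) R).indicator
      (fun _ => C) z.2) (spaceTime J L S) := by
  have h1 : Integrable ((Metric.closedBall (0 : Space d) R).indicator (fun _ => C))
      (volume.restrict (cell J L)) := by
    refine (integrable_indicator_iff Metric.isClosed_closedBall.measurableSet).2
      (integrableOn_const ?_)
    exact ((Measure.restrict_apply_le _ _).trans_lt measure_closedBall_lt_top).ne
  rw [spaceTime_eq_prod]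
  have := (integrable_const (μ := volume.restrict (Icc 0 S)) (1 : ℝ)).mul_prod h1
  simpa using this

theorem integrable_indicator_closedBall_cell {d : ℕ} (J : Finset (Fin d)) (L : Fin d → ℝ)
    (R C : ℝ) :
    Integrable ((Metric.closedBall (0 : Space d) R).indicator (fun _ => C))
      (volume.restrict (cell J L)) := by
  refine (integrable_indicator_iff Metric.isClosed_closedBall.measurableSet).2
    (integrableOn_const ?_)
  exact ((Measure.restrict_apply_le _ _).trans_lt measure_closedBall_lt_top).ne

theorem ae_mem_spaceTime {d : ℕ} (J : Finset (Fin d)) (L : Fin d → ℝ) (S : ℝ) :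
    ∀ᵐ z ∂spaceTime J L S, z.1 ∈ Icc 0 S ∧ z.2 ∈ cell J L :=
  ae_restrict_mem (measurableSet_Icc.prod (measurableSet_cell J L))

/-- The pairing `ξ_a ∂_tΦ + ∑_m f^m(ξ)_a ∂_mΦ`, as a function of the derivative `A` of `Φ`. -/
noncomputable def fluxPairing {d N : ℕ} (f : Fin d → State N → State N) (a : Fin N)
    (A : ℝ × Space d →L[ℝ] ℝ) (ξ : State N) : ℝ :=
  ξ a * A (1, 0) + ∑ m, f m ξ a * A (0, EuclideanSpace.single m 1)

theorem norm_apply_le {N : ℕ} (ξ : State N) (a : Fin N) : |ξ a| ≤ ‖ξ‖ :=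
  PiLp.norm_apply_le ξ a

theorem continuous_fluxPairing {d N : ℕ} {f : Fin d → State N → State N}
    (hf : ∀ m, Continuous (f m)) (a : Fin N) :
    Continuous fun z : (ℝ × Space d →L[ℝ] ℝ) × State N => fluxPairing f a z.1 z.2 := by
  unfold fluxPairing
  have : ∀ m (a : Fin N), Continuous fun ξ => f m ξ a := fun m a => by
    have := hf m; fun_prop
  fun_prop

theorem norm_fluxPairing_le {d N : ℕ} {f : Fin d → State N → State N} {K : ℝ}
    (hK : ∀ m ξ, ‖f m ξ‖ ≤ K * (1 + ‖ξ‖ ^ 2)) (a : Fin N) (A : ℝ × Space d →L[ℝ] ℝ)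
    (ξ : State N) : ‖fluxPairing f a A ξ‖ ≤ (1 + d * K) * ‖A‖ * (1 + ‖ξ‖ ^ 2) := by
  have h1 : |A (1, 0)| ≤ ‖A‖ := by
    have := A.le_opNorm (1, 0)
    simpa [Prod.norm_def] using this
  have h2 : ∀ m : Fin d, |A (0, EuclideanSpace.single m 1)| ≤ ‖A‖ := fun m => by
    have := A.le_opNorm (0, EuclideanSpace.single m 1)
    simpa [Prod.norm_def] using this
  have h3 : |ξ a| ≤ 1 + ‖ξ‖ ^ 2 :=
    (norm_apply_le ξ a).trans (by nlinarith [sq_nonneg (‖ξ‖ - 1 / 2)])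
  have h4 : ∀ m : Fin d, |f m ξ a| ≤ K * (1 + ‖ξ‖ ^ 2) := fun m =>
    (norm_apply_le _ a).trans (hK m ξ)
  calc ‖fluxPairing f a A ξ‖
      ≤ |ξ a * A (1, 0)| + ∑ m, |f m ξ a * A (0, EuclideanSpace.single m 1)| := by
        refine (abs_add_le _ _).trans (add_le_add le_rfl (Finset.abs_sum_le_sum_abs _ _))
    _ ≤ (1 + ‖ξ‖ ^ 2) * ‖A‖ + ∑ _m : Fin d, K * (1 + ‖ξ‖ ^ 2) * ‖A‖ := by
        refine add_le_add ?_ (Finset.sum_le_sum fun m _ => ?_)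
        · rw [abs_mul]
          exact mul_le_mul h3 h1 (abs_nonneg _) (by positivity)
        · rw [abs_mul]
          exact mul_le_mul (h4 m) (h2 m) (abs_nonneg _) ((abs_nonneg _).trans (h4 m))
    _ = (1 + d * K) * ‖A‖ * (1 + ‖ξ‖ ^ 2) := by
        simp; ring

/-- The weak form of the conservation law for the first correlation marginal, on `[0, S] × D`. -/
structure IsWeakSolution {d N : ℕ} (f : Fin d → State N → State N) (J : Finset (Fin d))
    (L : Fin d → ℝ) (S : ℝ) (κ0 : Kernel (Space d) (State N))
    (κ : Kernel (ℝ × Space d) (State N)) : Prop where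
  energy0 : FiniteEnergy (volume.restrict (cell J L) ⊗ₘ κ0)
  energy : FiniteEnergy (spaceTime J L S ⊗ₘ κ)
  equation : ∀ (a : Fin N) (Φ : ℝ × Space d → ℝ), ContDiff ℝ ∞ Φ → IsAdmissible J L S Φ →
    ∫ z, fluxPairing f a (fderiv ℝ Φ z.1) z.2 ∂(spaceTime J L S ⊗ₘ κ)
      + ∫ z, z.2 a * Φ (0, z.1) ∂(volume.restrict (cell J L) ⊗ₘ κ0) = 0

end StatSol

namespace StatSol

/-! ### The weak formulation of statistical solutions -/

theorem lintegral_spaceTime_compProd {d N : ℕ} (J : Finset (Fin d)) (L : Fin d → ℝ) (S : ℝ)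
    (κ : Kernel (ℝ × Space d) (State N)) [IsMarkovKernel κ]
    {h : (ℝ × Space d) × State N → ℝ≥0∞} (hh : Measurable h) :
    ∫⁻ z, h z ∂(spaceTime J L S ⊗ₘ κ)
      = ∫⁻ t in Icc 0 S, ∫⁻ z, h ((t, z.1), z.2) ∂(volume.restrict (cell J L) ⊗ₘ κ.sectR t) := by
  rw [Measure.lintegral_compProd hh, spaceTime_eq_prod,
    lintegral_prod _ (Measurable.lintegral_kernel_prod_right' hh).aemeasurable]
  refine lintegral_congr fun t => ?_
  rw [Measure.lintegral_compProd (by fun_prop)]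
  simp

/-- Fubini with time outermost. It links integrals over space-time, where the weak equation lives,
to integrals against `μ t`, which are known for almost every `t`. -/
theorem integral_spaceTime_compProd {d N : ℕ} (J : Finset (Fin d)) (L : Fin d → ℝ) (S : ℝ)
    (κ : Kernel (ℝ × Space d) (State N)) [IsMarkovKernel κ]
    {h : (ℝ × Space d) × State N → ℝ} (hm : StronglyMeasurable h)
    (hh : Integrable h (spaceTime J L S ⊗ₘ κ)) :
    Integrable (fun t => ∫ z, h ((t, z.1), z.2) ∂(volume.restrict (cell J L) ⊗ₘ κ.sectR t))
      (volume.restrict (Icc 0 S)) ∧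
    (∀ᵐ t ∂volume.restrict (Icc 0 S), Integrable (fun z => h ((t, z.1), z.2))
      (volume.restrict (cell J L) ⊗ₘ κ.sectR t)) ∧
    ∫ z, h z ∂(spaceTime J L S ⊗ₘ κ)
      = ∫ t in Icc 0 S, ∫ z, h ((t, z.1), z.2) ∂(volume.restrict (cell J L) ⊗ₘ κ.sectR t) := by
  have hae : ∀ᵐ t ∂volume.restrict (Icc 0 S), Integrable (fun z => h ((t, z.1), z.2))
      (volume.restrict (cell J L) ⊗ₘ κ.sectR t) := by
    have h1 := (lintegral_spaceTime_compProd J L S κ hm.enorm).symm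
    have h2 : ∫⁻ t in Icc 0 S, ∫⁻ z, ‖h ((t, z.1), z.2)‖ₑ
        ∂(volume.restrict (cell J L) ⊗ₘ κ.sectR t) ≠ ⊤ := by
      rw [h1]; exact hh.2.ne
    have h3 : Measurable fun t => ∫⁻ z, ‖h ((t, z.1), z.2)‖ₑ
        ∂(volume.restrict (cell J L) ⊗ₘ κ.sectR t) := by
      have h4 : ∀ t, ∫⁻ z, ‖h ((t, z.1), z.2)‖ₑ ∂(volume.restrict (cell J L) ⊗ₘ κ.sectR t)
          = ∫⁻ x in cell J L, ∫⁻ ξ, ‖h ((t, x), ξ)‖ₑ ∂κ (t, x) := by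
        intro t
        have h5 : Measurable fun z : Space d × State N => ‖h ((t, z.1), z.2)‖ₑ :=
          hm.enorm.comp (by fun_prop : Measurable fun z : Space d × State N => ((t, z.1), z.2))
        rw [Measure.lintegral_compProd h5]
        simp
      simp_rw [h4]
      exact (Measurable.lintegral_kernel_prod_right' hm.enorm).lintegral_prod_right'
    filter_upwards [ae_lt_top h3 h2] with t ht
    exact ⟨(hm.comp_measurable (by fun_prop :
      Measurable fun z : Space d × State N => ((t, z.1), z.2))).aestronglyMeasurable, ht⟩
  have hinner : ∀ᵐ t ∂volume.restrict (Icc 0 S),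
      ∫ z, h ((t, z.1), z.2) ∂(volume.restrict (cell J L) ⊗ₘ κ.sectR t)
        = ∫ x in cell J L, ∫ ξ, h ((t, x), ξ) ∂κ (t, x) := by
    filter_upwards [hae] with t ht
    rw [Measure.integral_compProd ht]
    simp
  have h1 := ((Measure.integrable_compProd_iff hm.aestronglyMeasurable).1 hh).2
  have h2 : Integrable (fun z : ℝ × Space d => ∫ ξ, h (z, ξ) ∂κ z) (spaceTime J L S) := by
    refine h1.mono' ?_ (.of_forall fun z => norm_integral_le_integral_norm _)
    exact (StronglyMeasurable.integral_kernel_prod_right' hm).aestronglyMeasurable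
  rw [spaceTime_eq_prod] at h2
  refine ⟨?_, hae, ?_⟩
  · exact h2.integral_prod_left.congr (hinner.mono fun t ht => ht.symm)
  · rw [Measure.integral_compProd hh, spaceTime_eq_prod, integral_prod _ h2]
    exact integral_congr_ae (hinner.mono fun t ht => ht.symm)

theorem lintegral_sq_jointLaw {d N : ℕ} {D : Set (Space d)} {ev : L2 D N × Space d → State N}
    (hev : Measurable ev) (hev' : ∀ u : L2 D N, ∀ᵐ x ∂volume.restrict D, ev (u, x) = u x)
    (γ : Measure (L2 D N)) [SFinite γ] :
    ∫⁻ z, ‖z.2‖ₑ ^ 2 ∂(jointLaw ev γ) = ∫⁻ u, ‖u‖ₑ ^ 2 ∂γ := by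
  rw [lintegral_jointLaw hev hev' γ (by fun_prop)]
  simp_rw [enorm_sq_eq_lintegral]

theorem Icc_subset_timeInterval {S : ℝ} {T : EReal} (h : (S : EReal) < T) :
    Icc 0 S ⊆ timeInterval T := fun _ ht =>
  ⟨ht.1, lt_of_le_of_lt (EReal.coe_le_coe_iff.2 ht.2) h⟩

theorem measurableSet_timeInterval (T : EReal) : MeasurableSet (timeInterval T) :=
  (measurableSet_Ici (a := (0 : ℝ))).inter
    (measurableSet_lt measurable_coe_real_ereal measurable_const)

theorem ContDiff.isTestFunction {d : ℕ} {J : Finset (Fin d)} {L : Fin d → ℝ} {S : ℝ} {T : EReal}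
    (hS : (S : EReal) < T) {Φ : ℝ × Space d → ℝ} (hΦ : ContDiff ℝ ∞ Φ) (h : IsAdmissible J L S Φ) :
    IsTestFunction J L T 1 fun z => Φ (z.2, z.1 0) where
  smooth := hΦ.comp (by fun_prop)
  periodic i j hj x t := by
    have : i = 0 := Subsingleton.elim _ _
    subst this
    simpa using h.periodic j hj t (x 0)
  support := by
    obtain ⟨R, T', hT', hR⟩ := h.support
    refine ⟨R, T', (EReal.coe_lt_coe_iff.2 hT').trans hS, fun x t hx => ?_⟩
    obtain ⟨h1, h2⟩ := hR _ _ hx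
    refine ⟨h1, fun i j hj => ?_⟩
    have : i = 0 := Subsingleton.elim _ _
    subst this
    exact h2 j hj

theorem fderiv_comp_swap_fin_one {d : ℕ} {Φ : ℝ × Space d → ℝ} (hΦ : Differentiable ℝ Φ)
    (x : Fin 1 → Space d) (t : ℝ) (w : (Fin 1 → Space d) × ℝ) :
    fderiv ℝ (fun z : (Fin 1 → Space d) × ℝ => Φ (z.2, z.1 0)) (x, t) w
      = fderiv ℝ Φ (t, x 0) (w.2, w.1 0) := by
  let A : (Fin 1 → Space d) × ℝ →L[ℝ] ℝ × Space d :=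
    (ContinuousLinearMap.snd ℝ _ _).prod
      ((ContinuousLinearMap.proj 0).comp (ContinuousLinearMap.fst ℝ _ _))
  have h := ((hΦ (A (x, t))).hasFDerivAt.comp (x, t) A.hasFDerivAt).fderiv
  have h2 := congrArg (fun B => B w) h
  simpa [A, Function.comp_def] using h2

/-- The moment equation with `k = 1`, rewritten over kernels. Once the kernels are identified with
joint laws, their second moments are those of `μbar` and `μ t`, finite by the bounded support and
the `L²` bound. Quadratic growth of `f` then makes the flux terms integrable. -/
theorem IsStatisticalSolution.exists_isWeakSolution {d N : ℕ} {f : Fin d → State N → State N}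
    {J : Finset (Fin d)} {L : Fin d → ℝ} {T : EReal} {μbar : ProbabilityMeasure (L2 (cell J L) N)}
    {μ : ℝ → ProbabilityMeasure (L2 (cell J L) N)} (hμ : IsStatisticalSolution f J L T μbar μ)
    (hf : ∀ m, Continuous (f m)) {K : ℝ} (hK : ∀ m ξ, ‖f m ξ‖ ≤ K * (1 + ‖ξ‖ ^ 2))
    {S : ℝ} (hST : (S : EReal) < T) {ev : L2 (cell J L) N × Space d → State N}
    (hev : Measurable ev)
    (hev' : ∀ u : L2 (cell J L) N, ∀ᵐ x ∂volume.restrict (cell J L), ev (u, x) = u x) :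
    ∃ (κ0 : Kernel (Space d) (State N)) (κ : Kernel (ℝ × Space d) (State N)),
      IsMarkovKernel κ0 ∧ IsMarkovKernel κ ∧ IsWeakSolution f J L S κ0 κ ∧
      volume.restrict (cell J L) ⊗ₘ κ0 = jointLaw ev (μbar : Measure (L2 (cell J L) N)) ∧
      ∀ᵐ t ∂volume.restrict (Icc 0 S), volume.restrict (cell J L) ⊗ₘ κ.sectR t
        = jointLaw ev (μ t : Measure (L2 (cell J L) N)) := by
  obtain ⟨νbar, ν, hνbar, hν, hmom⟩ := hμ.equation
  have hD := measurableSet_cell J L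
  obtain ⟨κ0', hκ0', hκ0eq⟩ := (hνbar.young 1).exists_kernel
  obtain ⟨κ', hκ', hκeq⟩ := (hν.young 1).exists_kernel
  have hev0 : Measurable fun ξ : Fin 1 → State N => ξ 0 := by fun_prop
  have hmk0 : Measurable fun x : Space d => (fun _ => x : Fin 1 → Space d) := by fun_prop
  have hmk : Measurable fun z : ℝ × Space d => (z.1, (fun _ => z.2 : Fin 1 → Space d)) := by
    fun_prop
  let κ0 : Kernel (Space d) (State N) := (κ0'.comap _ hmk0).map fun ξ => ξ 0
  let κ : Kernel (ℝ × Space d) (State N) := (κ'.comap _ hmk).map fun ξ => ξ 0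
  have hκ0M : IsMarkovKernel κ0 := Kernel.IsMarkovKernel.map _ hev0
  have hκM : IsMarkovKernel κ := Kernel.IsMarkovKernel.map _ hev0
  have hκ0ae : ∀ᵐ x ∂volume.restrict (cell J L),
      κ0 x = (νbar 1 fun _ => x).map fun ξ => ξ 0 := by
    filter_upwards [(ae_domPow_one_iff hD).1 hκ0eq] with x hx
    rw [Kernel.map_apply _ hev0, Kernel.comap_apply, hx]
  have hκae : ∀ᵐ t ∂volume.restrict (timeInterval T), ∀ᵐ x ∂volume.restrict (cell J L),
      κ (t, x) = (ν 1 t fun _ => x).map fun ξ => ξ 0 := by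
    rw [Measure.volume_eq_prod, ← Measure.prod_restrict] at hκeq
    filter_upwards [Measure.ae_ae_of_ae_prod hκeq] with t ht
    filter_upwards [(ae_domPow_one_iff hD).1 ht] with x hx
    rw [Kernel.map_apply _ hev0, Kernel.comap_apply, hx]
  have hlaw0 := compProd_eq_jointLaw hD hev hev' (μbar : Measure (L2 (cell J L) N)) hνbar.dual
    κ0 hκ0ae
  have hlaw : ∀ᵐ t ∂volume.restrict (timeInterval T), volume.restrict (cell J L) ⊗ₘ κ.sectR t
      = jointLaw ev (μ t : Measure (L2 (cell J L) N)) := by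
    filter_upwards [hκae, hν.dual] with t ht hd
    exact compProd_eq_jointLaw hD hev hev' _ hd _ (by simpa using ht)
  have hsub := ae_mono (Measure.restrict_mono (Icc_subset_timeInterval hST) (le_refl volume))
  have henergy0 : FiniteEnergy (volume.restrict (cell J L) ⊗ₘ κ0) := by
    obtain ⟨M, hM⟩ := hμ.initial_bounded
    rw [FiniteEnergy, hlaw0, lintegral_sq_jointLaw hev hev']
    refine lt_of_le_of_lt (lintegral_mono_ae (g := fun _ => ENNReal.ofReal M ^ 2) ?_) ?_
    · filter_upwards [hM] with u hu
      rw [← ofReal_norm]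
      gcongr
    · simp
  have henergy : FiniteEnergy (spaceTime J L S ⊗ₘ κ) := by
    obtain ⟨c, hc⟩ := hμ.l2_bounded
    rw [FiniteEnergy, lintegral_spaceTime_compProd J L S κ (by fun_prop)]
    refine lt_of_le_of_lt (lintegral_mono_ae (g := fun _ => (c : ℝ≥0∞)) ?_) ?_
    · filter_upwards [hsub hlaw, hsub hc] with t ht htc
      rw [ht, lintegral_sq_jointLaw hev hev']
      exact htc
    · simp [ENNReal.mul_lt_top]
  refine ⟨κ0, κ, hκ0M, hκM, ⟨henergy0, henergy, fun a Φ hΦ hadm => ?_⟩, hlaw0, hsub hlaw⟩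
  have heq := (hmom 1 one_pos fun _ => a).2.2 _ (ContDiff.isTestFunction hST hΦ hadm)
  have hdiff : Differentiable ℝ Φ := hΦ.differentiable (by simp)
  simp only [fderiv_comp_swap_fin_one hdiff, setIntegral_domPow_one hD] at heq
  simp only [moment, fluxMoment, Finset.univ_unique, Finset.prod_singleton, Finset.sum_singleton,
    Fin.default_eq_zero, Fin.isValue, Pi.single_eq_same, Pi.zero_apply, Finset.erase_singleton,
    Finset.prod_empty, mul_one] at heq
  obtain ⟨R, T', hT', hR⟩ := hadm.support
  obtain ⟨R', hR'⟩ := hadm.exists_radius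
  have hΦ' : Continuous (fderiv ℝ Φ) := hΦ.continuous_fderiv (by simp)
  have hGc : Continuous fun z : (ℝ × Space d) × State N => fluxPairing f a (fderiv ℝ Φ z.1) z.2 :=
    (continuous_fluxPairing hf a).comp ((hΦ'.comp continuous_fst).prodMk continuous_snd)
  have hK0 : 0 ≤ 1 + d * K := by
    rcases Nat.eq_zero_or_pos d with rfl | hd
    · simp
    · have : 0 ≤ K := by simpa using (norm_nonneg _).trans (hK ⟨0, hd⟩ 0)
      positivity
  obtain ⟨B, hB⟩ := ((isCompact_Icc (a := (0 : ℝ)) (b := S)).prod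
    (isCompact_closedBall (0 : Space d) R')).exists_bound_of_continuousOn hΦ'.continuousOn
  have hGint : Integrable (fun z : (ℝ × Space d) × State N =>
      fluxPairing f a (fderiv ℝ Φ z.1) z.2) (spaceTime J L S ⊗ₘ κ) := by
    refine henergy.integrable (integrable_indicator_closedBall_spaceTime J L S R'
      ((1 + d * K) * |B|)) (C := (1 + d * K) * |B|) hGc.aestronglyMeasurable ?_
    filter_upwards [ae_compProd_of_ae κ (ae_mem_spaceTime J L S)] with z hz
    refine (norm_fluxPairing_le hK a _ _).trans ?_
    by_cases hzR : ‖z.1.2‖ ≤ R'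
    · have h1 : ‖fderiv ℝ Φ z.1‖ ≤ |B| :=
        (hB z.1 ⟨hz.1, by simpa using hzR⟩).trans (le_abs_self B)
      rw [indicator_of_mem (by simpa using hzR)]
      calc (1 + d * K) * ‖fderiv ℝ Φ z.1‖ * (1 + ‖z.2‖ ^ 2)
          ≤ (1 + d * K) * |B| * (1 + ‖z.2‖ ^ 2) := by gcongr
        _ = _ := by ring
    · rw [show fderiv ℝ Φ z.1 = 0 from (hR' z.1.1 z.1.2 hz.2 (not_le.1 hzR)).2,
        indicator_of_notMem (by simpa using hzR)]
      simp only [norm_zero, mul_zero, zero_mul, zero_add]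
      positivity
  -- Almost every fibre has a finite second moment. This allows the integral of the pairing to be
  -- split into the separate moments that appear in the moment equation.
  have hsq := (Measure.integrable_compProd_iff
    henergy.integrable_sq.aestronglyMeasurable).1 henergy.integrable_sq
  have hsqae : ∀ᵐ t ∂volume.restrict (Icc 0 S), ∀ᵐ x ∂volume.restrict (cell J L),
      Integrable (fun ξ : State N => ‖ξ‖ ^ 2) (κ (t, x)) := by
    have := hsq.1
    rw [spaceTime_eq_prod] at this
    exact Measure.ae_ae_of_ae_prod this
  have hcoord : ∀ a : Fin N, Continuous fun ξ : State N => ξ a := fun a => by fun_prop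
  have hfa : ∀ m (a : Fin N), Continuous fun ξ => f m ξ a := fun m a => (hcoord a).comp (hf m)
  have hfirst : ∫ t in timeInterval T, ∫ x in cell J L,
        ((∫ ξ : Fin 1 → State N, ξ 0 a ∂ν 1 t fun _ => x) * fderiv ℝ Φ (t, x) (1, 0)
          + ∑ m, (∫ ξ : Fin 1 → State N, f m (ξ 0) a ∂ν 1 t fun _ => x)
              * fderiv ℝ Φ (t, x) (0, EuclideanSpace.single m 1))
      = ∫ z, fluxPairing f a (fderiv ℝ Φ z.1) z.2 ∂(spaceTime J L S ⊗ₘ κ) := by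
    -- The test function vanishes beyond some `T' < S`, so the time integral over `[0, T)` reduces
    -- to `[0, S]`.
    rw [(integral_spaceTime_compProd J L S κ hGc.stronglyMeasurable hGint).2.2,
      setIntegral_eq_of_subset_of_forall_sdiff_eq_zero (measurableSet_timeInterval T)
        (Icc_subset_timeInterval hST)]
    · refine integral_congr_ae ?_
      filter_upwards [hsub hκae, hsqae,
        (integral_spaceTime_compProd J L S κ hGc.stronglyMeasurable hGint).2.1] with t h1 h2 h3
      rw [Measure.integral_compProd h3]
      refine integral_congr_ae ?_
      filter_upwards [h1, h2] with x hx hx2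
      have hcomp : ∀ p : State N → ℝ, Continuous p →
          ∫ ξ : Fin 1 → State N, p (ξ 0) ∂(ν 1 t fun _ => x) = ∫ ξ, p ξ ∂κ (t, x) := by
        intro p hp
        rw [hx, integral_map hev0.aemeasurable hp.aestronglyMeasurable]
      have hint : ∀ p : State N → ℝ, Continuous p → (∀ ξ, |p ξ| ≤ (1 + |K|) * (1 + ‖ξ‖ ^ 2)) →
          Integrable p (κ (t, x)) := fun p hp hle =>
        (((integrable_const 1).add hx2).const_mul _).mono' hp.aestronglyMeasurable
          (.of_forall hle)
      have hint1 : Integrable (fun ξ : State N => ξ a) (κ (t, x)) := hint _ (hcoord a) fun ξ => by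
        refine (norm_apply_le ξ a).trans ?_
        nlinarith [sq_nonneg (‖ξ‖ - 1 / 2), abs_nonneg K, sq_nonneg ‖ξ‖,
          mul_nonneg (abs_nonneg K) (sq_nonneg ‖ξ‖)]
      have hint2 : ∀ m, Integrable (fun ξ : State N => f m ξ a) (κ (t, x)) := fun m =>
        hint _ (hfa m a) fun ξ => by
          refine ((norm_apply_le _ a).trans (hK m ξ)).trans ?_
          gcongr
          linarith [le_abs_self K]
      rw [hcomp _ (hcoord a)]
      simp_rw [fun m => hcomp _ (hfa m a), fluxPairing, Kernel.sectR_apply]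
      rw [integral_add (hint1.mul_const _) (integrable_finsetSum _ fun m _ =>
        (hint2 m).mul_const _), integral_finsetSum _ fun m _ => (hint2 m).mul_const _]
      simp only [integral_mul_const]
    · intro t ht
      have : ∀ x, fderiv ℝ Φ (t, x) = 0 := fun x => by
        by_contra hc
        exact ht.2 ⟨ht.1.1, ((IsAdmissible.fderiv_eq_zero hR t x hc).1.trans_lt hT').le⟩
      simp [this]
  have hsecond : ∫ x in cell J L, (∫ ξ : Fin 1 → State N, ξ 0 a ∂νbar 1 fun _ => x) * Φ (0, x)
      = ∫ z, z.2 a * Φ (0, z.1) ∂(volume.restrict (cell J L) ⊗ₘ κ0) := by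
    have hc : Continuous fun z : Space d × State N => z.2 a * Φ (0, z.1) :=
      ((hcoord a).comp continuous_snd).mul (hΦ.continuous.comp (by fun_prop))
    obtain ⟨B', hB'⟩ := (isCompact_closedBall (0 : Space d) R').exists_bound_of_continuousOn
      (f := fun x => Φ (0, x)) (hΦ.continuous.comp (by fun_prop)).continuousOn
    rw [Measure.integral_compProd]
    · refine integral_congr_ae ?_
      filter_upwards [hκ0ae] with x hx
      rw [integral_mul_const, hx, integral_map hev0.aemeasurable (hcoord a).aestronglyMeasurable]
    · refine henergy0.integrable (integrable_indicator_closedBall_cell J L R' |B'|) (C := |B'|)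
        hc.aestronglyMeasurable ?_
      filter_upwards [ae_compProd_of_ae κ0 (ae_restrict_mem hD)] with z hz
      by_cases hzR : ‖z.1‖ ≤ R'
      · rw [indicator_of_mem (by simpa using hzR), norm_mul]
        have h1 := (hB' z.1 (by simpa using hzR)).trans (le_abs_self B')
        have h2 := norm_apply_le z.2 a
        calc ‖z.2 a‖ * ‖Φ (0, z.1)‖ ≤ ‖z.2‖ * |B'| := by gcongr; exact h2
          _ ≤ (1 + ‖z.2‖ ^ 2) * |B'| := by
            gcongr
            nlinarith [sq_nonneg (‖z.2‖ - 1 / 2)]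
          _ = _ := by ring
      · rw [(hR' 0 z.1 hz (not_le.1 hzR)).1, indicator_of_notMem (by simpa using hzR)]
        simp only [norm_zero, mul_zero, zero_add]
        positivity
  rw [← hfirst, ← hsecond]
  exact heq

end StatSol

namespace StatSol

/-! ### Mollification of Lipschitz functions -/

section Mollify

variable {G : Type*} [NormedAddCommGroup G] [NormedSpace ℝ G] [FiniteDimensional ℝ G]
  [MeasurableSpace G] [BorelSpace G] {μ : Measure G} [μ.IsAddHaarMeasure]

theorem norm_fderiv_le_lipschitz {E F : Type*} [NormedAddCommGroup E] [NormedSpace ℝ E]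
    [NormedAddCommGroup F] [NormedSpace ℝ F] {g : E → F} {K : ℝ≥0} (hg : LipschitzWith K g)
    (x : E) : ‖fderiv ℝ g x‖ ≤ K :=
  norm_fderiv_le_of_lipschitz ℝ hg

theorem locallyIntegrable_fderiv_lipschitz {g : G → ℝ} {K : ℝ≥0} (hg : LipschitzWith K g) :
    LocallyIntegrable (fderiv ℝ g) μ := by
  have : LocallyIntegrable (fun _ : G => (K : ℝ)) μ := locallyIntegrable_const _
  refine this.mono (measurable_fderiv ℝ g).aestronglyMeasurable (.of_forall fun x => ?_)
  simpa using norm_fderiv_le_lipschitz hg x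

/-- Differentiation under the integral: Rademacher provides the derivative of `g (· - y)` at `x` for
almost every `y`, and the Lipschitz constant provides the domination. Mollification thus commutes
with the almost everywhere derivative. -/
theorem hasFDerivAt_convolution_lipschitz (φ : ContDiffBump (0 : G)) {g : G → ℝ} {K : ℝ≥0}
    (hg : LipschitzWith K g) (x : G) :
    HasFDerivAt (convolution (φ.normed μ) g (ContinuousLinearMap.lsmul ℝ ℝ) μ)
      (convolution (φ.normed μ) (fderiv ℝ g) (ContinuousLinearMap.lsmul ℝ ℝ) μ x) x := by
  have hφc : Continuous (φ.normed μ) := φ.continuous_normed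
  have hφs : HasCompactSupport (φ.normed μ) := φ.hasCompactSupport_normed
  have hint : ∀ z, Integrable (fun y => φ.normed μ y * g (z - y)) μ := fun z =>
    (hφc.mul (hg.continuous.comp (by fun_prop))).integrable_of_hasCompactSupport hφs.mul_right
  refine (hasFDerivAt_integral_of_dominated_loc_of_lip (bound := fun y => φ.normed μ y * K)
    (F := fun z y => φ.normed μ y * g (z - y))
    (F' := fun y => φ.normed μ y • fderiv ℝ g (x - y)) (s := univ) univ_mem
    (.of_forall fun z => (hint z).aestronglyMeasurable) (hint x) ?_ ?_ ?_ ?_).2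
  · exact hφc.aestronglyMeasurable.smul
      ((measurable_fderiv ℝ g).comp (by fun_prop : Measurable fun y => x - y)).aestronglyMeasurable
  · refine .of_forall fun y => LipschitzWith.lipschitzOnWith ?_
    refine LipschitzWith.of_dist_le_mul fun z w => ?_
    have h := hg.dist_le_mul (z - y) (w - y)
    rw [dist_sub_right] at h
    rw [Real.coe_nnabs, abs_of_nonneg (a := φ.normed μ y * K)
      (mul_nonneg (φ.nonneg_normed y) K.2), Real.dist_eq,
      ← mul_sub, abs_mul, abs_of_nonneg (φ.nonneg_normed y), mul_assoc, ← Real.dist_eq]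
    exact mul_le_mul_of_nonneg_left h (φ.nonneg_normed y)
  · exact (hφc.integrable_of_hasCompactSupport hφs).mul_const _
  · have hae : ∀ᵐ y ∂μ, DifferentiableAt ℝ g (x - y) :=
      (quasiMeasurePreserving_sub_left μ x).ae hg.ae_differentiableAt
    filter_upwards [hae] with y hy
    have h1 : HasFDerivAt (fun z => g (z - y)) (fderiv ℝ g (x - y)) x := by
      simpa [Function.comp_def] using hy.hasFDerivAt.comp x ((hasFDerivAt_id x).sub_const y)
    exact h1.const_mul (φ.normed μ y)

theorem norm_convolution_fderiv_le (φ : ContDiffBump (0 : G)) {g : G → ℝ} {K : ℝ≥0}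
    (hg : LipschitzWith K g) (x : G) :
    ‖convolution (φ.normed μ) (fderiv ℝ g) (ContinuousLinearMap.lsmul ℝ ℝ) μ x‖ ≤ K := by
  rw [convolution]
  refine (norm_integral_le_of_norm_le (g := fun y => φ.normed μ y * K)
    ((φ.continuous_normed.integrable_of_hasCompactSupport
      φ.hasCompactSupport_normed).mul_const _) (.of_forall fun y => ?_)).trans_eq ?_
  · rw [ContinuousLinearMap.lsmul_apply, norm_smul, Real.norm_eq_abs,
      abs_of_nonneg (φ.nonneg_normed y)]
    exact mul_le_mul_of_nonneg_left (norm_fderiv_le_lipschitz hg _) (φ.nonneg_normed y)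
  · rw [integral_mul_const, φ.integral_normed, one_mul]

end Mollify

instance isAddHaarMeasure_volume_time_space (d : ℕ) :
    (volume : Measure (ℝ × Space d)).IsAddHaarMeasure := by
  rw [Measure.volume_eq_prod]; infer_instance

/-- Convolution enlarges the support by at most the radius of the bump, which the gap between `T'`
and `S` has to absorb. Periodicity survives because it commutes with translations. -/
theorem IsAdmissible.mollify {d : ℕ} {J : Finset (Fin d)} {L : Fin d → ℝ} {S : ℝ}
    {Φ : ℝ × Space d → ℝ} (h : IsAdmissible J L S Φ) {R T' δ : ℝ}
    (hR : ∀ t x, Φ (t, x) ≠ 0 → t ≤ T' ∧ ∀ j ∉ J, |x j| ≤ R) (hδ : T' + δ < S)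
    (φ : ContDiffBump (0 : ℝ × Space d)) (hφ : φ.rOut ≤ δ) :
    IsAdmissible J L S (convolution (φ.normed volume) Φ (ContinuousLinearMap.lsmul ℝ ℝ) volume) ∧
    ∀ t x, convolution (φ.normed volume) Φ (ContinuousLinearMap.lsmul ℝ ℝ) volume (t, x) ≠ 0 →
      t ≤ T' + δ ∧ ∀ j ∉ J, |x j| ≤ R + δ := by
  have hsupp : ∀ t x, convolution (φ.normed volume) Φ (ContinuousLinearMap.lsmul ℝ ℝ) volume
      (t, x) ≠ 0 → t ≤ T' + δ ∧ ∀ j ∉ J, |x j| ≤ R + δ := by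
    intro t x hne
    obtain ⟨y, hy⟩ : ∃ y, φ.normed volume y • Φ ((t, x) - y) ≠ 0 := by
      by_contra hc
      push Not at hc
      exact hne (by simp only [convolution, ContinuousLinearMap.lsmul_apply, hc, integral_zero])
    have hy1 : φ.normed volume y ≠ 0 := left_ne_zero_of_smul hy
    have hy2 := hR _ _ (right_ne_zero_of_smul hy)
    have hyδ : ‖y‖ ≤ δ := by
      have : y ∈ Function.support (φ.normed volume) := hy1
      rw [φ.support_normed_eq] at this
      exact (by simpa using this : ‖y‖ < φ.rOut).le.trans hφ
    refine ⟨?_, fun j hj => ?_⟩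
    · have h1 : |y.1| ≤ δ := (norm_fst_le y).trans hyδ
      have h2 : t - y.1 ≤ T' := hy2.1
      linarith [le_abs_self y.1]
    · have h1 : |y.2 j| ≤ δ := (norm_apply_le y.2 j).trans ((norm_snd_le y).trans hyδ)
      have h2 : |x j - y.2 j| ≤ R := by simpa using hy2.2 j hj
      have h3 : |x j| ≤ |x j - y.2 j| + |y.2 j| := by
        simpa using abs_add_le (x j - y.2 j) (y.2 j)
      linarith
  refine ⟨⟨fun j hj t x => ?_, R + δ, T' + δ, hδ, hsupp⟩, hsupp⟩
  simp only [MeasureTheory.convolution]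
  congr 1
  funext y
  congr 1
  have := h.periodic j hj (t - y.1) (x - y.2)
  rw [sub_add_eq_add_sub] at this
  exact this

/-- Needed because `η'(v)` is only as regular as the Lipschitz function `v`. The mollified gradients
stay below the Lipschitz constant and converge at Lebesgue points. This is enough for dominated
convergence: null sets of space-time remain null for the joint law, and the majorant is a multiple
of `1 + |ξ|²` on a bounded region. -/
theorem IsWeakSolution.equation_lipschitz {d N : ℕ} {f : Fin d → State N → State N}
    {J : Finset (Fin d)} {L : Fin d → ℝ} {S : ℝ} {κ0 : Kernel (Space d) (State N)}
    {κ : Kernel (ℝ × Space d) (State N)} [IsMarkovKernel κ0] [IsMarkovKernel κ]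
    (h : IsWeakSolution f J L S κ0 κ) (hf : ∀ m, Continuous (f m)) {K : ℝ}
    (hK : ∀ m ξ, ‖f m ξ‖ ≤ K * (1 + ‖ξ‖ ^ 2)) (a : Fin N) {Φ : ℝ × Space d → ℝ} {M : ℝ≥0}
    (hΦ : LipschitzWith M Φ) (hadm : IsAdmissible J L S Φ) :
    Integrable (fun z : (ℝ × Space d) × State N => fluxPairing f a (fderiv ℝ Φ z.1) z.2)
      (spaceTime J L S ⊗ₘ κ) ∧
    Integrable (fun z : Space d × State N => z.2 a * Φ (0, z.1))
      (volume.restrict (cell J L) ⊗ₘ κ0) ∧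
    ∫ z, fluxPairing f a (fderiv ℝ Φ z.1) z.2 ∂(spaceTime J L S ⊗ₘ κ)
      + ∫ z, z.2 a * Φ (0, z.1) ∂(volume.restrict (cell J L) ⊗ₘ κ0) = 0 := by
  obtain ⟨R, T', hT', hR⟩ := hadm.support
  -- Half of the available gap, so that every mollified function still vanishes before time `S`.
  set δ : ℝ := (S - T') / 2 with hδ
  have hδ0 : 0 < δ := by rw [hδ]; linarith
  have hδS : T' + δ < S := by rw [hδ]; linarith
  let φ : ℕ → ContDiffBump (0 : ℝ × Space d) := fun n =>
    ⟨δ / (n + 1) / 2, δ / (n + 1), by positivity, half_lt_self (by positivity)⟩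
  have hφout : ∀ n, (φ n).rOut ≤ δ := fun n => div_le_self hδ0.le (by simp)
  have hφlim : Tendsto (fun n => (φ n).rOut) atTop (𝓝 0) := by
    simpa [φ, div_eq_mul_inv] using (tendsto_one_div_add_atTop_nhds_zero_nat (𝕜 := ℝ)).const_mul δ
  let Φn : ℕ → ℝ × Space d → ℝ := fun n =>
    convolution ((φ n).normed volume) Φ (ContinuousLinearMap.lsmul ℝ ℝ) volume
  have hsm : ∀ n, ContDiff ℝ ∞ (Φn n) := fun n =>
    (φ n).hasCompactSupport_normed.contDiff_convolution_left _ (φ n).contDiff_normed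
      hΦ.continuous.locallyIntegrable
  have hadmn := fun n => hadm.mollify hR hδS (φ n) (hφout n)
  have hfd : ∀ n z, fderiv ℝ (Φn n) z = convolution ((φ n).normed volume) (fderiv ℝ Φ)
      (ContinuousLinearMap.lsmul ℝ ℝ) volume z := fun n z =>
    (hasFDerivAt_convolution_lipschitz (φ n) hΦ z).fderiv
  have hfdlim : ∀ᵐ z : ℝ × Space d, Tendsto (fun n => fderiv ℝ (Φn n) z) atTop
      (𝓝 (fderiv ℝ Φ z)) := by
    simp_rw [hfd]
    -- Convergence at Lebesgue points requires the ratio of outer to inner radius of the bumps to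
    -- stay bounded; here it equals 2.
    refine ContDiffBump.ae_convolution_tendsto_right_of_locallyIntegrable (K := 2) hφlim
      (.of_forall fun n => ?_) (locallyIntegrable_fderiv_lipschitz hΦ)
    simp only [φ]; linarith
  have hlim : ∀ z, Tendsto (fun n => Φn n z) atTop (𝓝 (Φ z)) := fun z =>
    ContDiffBump.convolution_tendsto_right_of_continuous hφlim hΦ.continuous z
  have hK0 : 0 ≤ 1 + d * K := by
    rcases Nat.eq_zero_or_pos d with rfl | hd
    · simp
    · have : 0 ≤ K := by simpa using (norm_nonneg _).trans (hK ⟨0, hd⟩ 0)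
      positivity
  obtain ⟨R', hR'⟩ := exists_norm_le_of_mem_cell J L (R + δ)
  have hΦsupp : ∀ t x, Φ (t, x) ≠ 0 → t ≤ T' + δ ∧ ∀ j ∉ J, |x j| ≤ R + δ := fun t x hx =>
    ⟨by linarith [(hR t x hx).1], fun j hj => by linarith [(hR t x hx).2 j hj]⟩
  set C : ℝ := (1 + d * K) * M with hC
  have hC0 : 0 ≤ C := mul_nonneg hK0 M.2
  have hbound : ∀ Ψ : ℝ × Space d → ℝ, (∀ z, ‖fderiv ℝ Ψ z‖ ≤ M) →
      (∀ t x, Ψ (t, x) ≠ 0 → t ≤ T' + δ ∧ ∀ j ∉ J, |x j| ≤ R + δ) →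
      ∀ᵐ z ∂(spaceTime J L S ⊗ₘ κ), ‖fluxPairing f a (fderiv ℝ Ψ z.1) z.2‖
        ≤ (Metric.closedBall (0 : Space d) R').indicator (fun _ => C) z.1.2 + C * ‖z.2‖ ^ 2 := by
    intro Ψ hΨ hsupp
    filter_upwards [ae_compProd_of_ae κ (ae_mem_spaceTime J L S)] with z hz
    refine (norm_fluxPairing_le hK a _ _).trans ?_
    by_cases hzR : ‖z.1.2‖ ≤ R'
    · rw [indicator_of_mem (by simpa using hzR)]
      calc (1 + d * K) * ‖fderiv ℝ Ψ z.1‖ * (1 + ‖z.2‖ ^ 2)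
          ≤ (1 + d * K) * M * (1 + ‖z.2‖ ^ 2) := by gcongr; exact hΨ _
        _ = _ := by ring
    · have : fderiv ℝ Ψ z.1 = 0 := by
        by_contra hc
        exact hzR (hR' _ hz.2 (IsAdmissible.fderiv_eq_zero hsupp z.1.1 z.1.2 hc).2)
      rw [this, indicator_of_notMem (by simpa using hzR)]
      simp only [norm_zero, mul_zero, zero_mul, zero_add]
      positivity
  have hbndint : Integrable (fun z : (ℝ × Space d) × State N =>
      (Metric.closedBall (0 : Space d) R').indicator (fun _ => C) z.1.2 + C * ‖z.2‖ ^ 2)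
      (spaceTime J L S ⊗ₘ κ) :=
    (integrable_comp_fst_compProd κ (integrable_indicator_closedBall_spaceTime J L S R' C)).add
      (h.energy.integrable_sq.const_mul C)
  have hmeas : ∀ Ψ : ℝ × Space d → ℝ, AEStronglyMeasurable (fun z : (ℝ × Space d) × State N =>
      fluxPairing f a (fderiv ℝ Ψ z.1) z.2) (spaceTime J L S ⊗ₘ κ) := fun Ψ =>
    ((continuous_fluxPairing hf a).measurable.comp
      (((measurable_fderiv ℝ Ψ).comp measurable_fst).prodMk measurable_snd)).aestronglyMeasurable
  obtain ⟨B0, hB0⟩ := (isCompact_closedBall (0 : Space d) R').exists_bound_of_continuousOn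
      (f := fun x => Φ (0, x)) (hΦ.continuous.comp (by fun_prop)).continuousOn
  set B : ℝ := |B0| + M * δ with hB
  have hB' : 0 ≤ B := by positivity
  have hbound0 : ∀ Ψ : ℝ × Space d → ℝ, (∀ z, dist (Ψ z) (Φ z) ≤ M * δ) →
      (∀ t x, Ψ (t, x) ≠ 0 → t ≤ T' + δ ∧ ∀ j ∉ J, |x j| ≤ R + δ) →
      ∀ᵐ z ∂(volume.restrict (cell J L) ⊗ₘ κ0), ‖z.2 a * Ψ (0, z.1)‖
        ≤ (Metric.closedBall (0 : Space d) R').indicator (fun _ => B) z.1 + B * ‖z.2‖ ^ 2 := by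
    intro Ψ hΨ hsupp
    filter_upwards [ae_compProd_of_ae κ0 (ae_restrict_mem (measurableSet_cell J L))] with z hz
    by_cases hzR : ‖z.1‖ ≤ R'
    · rw [indicator_of_mem (by simpa using hzR), norm_mul]
      have h1 := (hB0 z.1 (by simpa using hzR)).trans (le_abs_self B0)
      have h2 := norm_apply_le z.2 a
      have h3 : ‖Ψ (0, z.1)‖ ≤ B := by
        have := norm_le_norm_add_norm_sub' (Ψ (0, z.1)) (Φ (0, z.1))
        have h4 := hΨ (0, z.1)
        rw [dist_eq_norm] at h4
        linarith
      calc ‖z.2 a‖ * ‖Ψ (0, z.1)‖ ≤ ‖z.2‖ * B := by gcongr; exact h2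
        _ ≤ (1 + ‖z.2‖ ^ 2) * B := by
          gcongr
          nlinarith [sq_nonneg (‖z.2‖ - 1 / 2)]
        _ = _ := by ring
    · have : Ψ (0, z.1) = 0 := by
        by_contra hc
        exact hzR (hR' _ hz (hsupp 0 z.1 hc).2)
      rw [this, indicator_of_notMem (by simpa using hzR)]
      simp only [norm_zero, mul_zero, zero_add]
      positivity
  have hbndint0 : Integrable (fun z : Space d × State N =>
      (Metric.closedBall (0 : Space d) R').indicator (fun _ => B) z.1 + B * ‖z.2‖ ^ 2)
      (volume.restrict (cell J L) ⊗ₘ κ0) :=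
    (integrable_comp_fst_compProd κ0 (integrable_indicator_closedBall_cell J L R' B)).add
      (h.energy0.integrable_sq.const_mul B)
  have hmeas0 : ∀ Ψ : ℝ × Space d → ℝ, Continuous Ψ → AEStronglyMeasurable
      (fun z : Space d × State N => z.2 a * Ψ (0, z.1))
      (volume.restrict (cell J L) ⊗ₘ κ0) := fun Ψ hΨ =>
    ((by fun_prop : Continuous fun z : Space d × State N => z.2 a).mul
      (hΨ.comp (by fun_prop))).aestronglyMeasurable
  have hdist : ∀ n z, dist (Φn n z) (Φ z) ≤ M * δ := fun n z => by
    refine ContDiffBump.dist_normed_convolution_le hΦ.continuous.aestronglyMeasurable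
      fun y hy => (hΦ.dist_le_mul y z).trans ?_
    have := (Metric.mem_ball.1 hy).le.trans (hφout n)
    gcongr
  have hΦd : ∀ z, dist (Φ z) (Φ z) ≤ M * δ := fun z => by
    rw [dist_self]; positivity
  refine ⟨hbndint.mono' (hmeas Φ) (hbound Φ (norm_fderiv_le_lipschitz hΦ) hΦsupp),
    hbndint0.mono' (hmeas0 Φ hΦ.continuous) (hbound0 Φ hΦd hΦsupp), ?_⟩
  have hl1 := tendsto_integral_of_dominated_convergence (μ := spaceTime J L S ⊗ₘ κ)
    (F := fun n z => fluxPairing f a (fderiv ℝ (Φn n) z.1) z.2)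
    (f := fun z => fluxPairing f a (fderiv ℝ Φ z.1) z.2) _ (fun n => hmeas (Φn n)) hbndint
    (fun n => hbound (Φn n) (fun z => by
      rw [hfd]; exact norm_convolution_fderiv_le (φ n) hΦ z) (hadmn n).2) (by
      filter_upwards [ae_compProd_of_ae κ (ae_restrict_of_ae hfdlim)] with z hz
      exact ((continuous_fluxPairing hf a).tendsto (fderiv ℝ Φ z.1, z.2)).comp
        (hz.prodMk_nhds tendsto_const_nhds))
  have hl2 := tendsto_integral_of_dominated_convergence
    (μ := volume.restrict (cell J L) ⊗ₘ κ0)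
    (F := fun n z => z.2 a * Φn n (0, z.1))
    (f := fun z => z.2 a * Φ (0, z.1)) _ (fun n => hmeas0 (Φn n) (hsm n).continuous) hbndint0
    (fun n => hbound0 (Φn n) (hdist n) (hadmn n).2)
    (.of_forall fun z => (hlim (0, z.1)).const_mul _)
  refine tendsto_nhds_unique (hl1.add hl2) ?_
  simp only [h.equation a _ (hsm _) (hadmn _).1]
  exact tendsto_const_nhds

end StatSol

namespace StatSol

/-! ### The divergence theorem for Lipschitz functions on the period cell -/

theorem volume_setOf_coord_eq_zero {d : ℕ} (m : Fin d) : volume {x : Space d | x m = 0} = 0 := by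
  have h := Measure.addHaar_submodule (volume : Measure (Space d))
    (LinearMap.ker (EuclideanSpace.proj m : Space d →L[ℝ] ℝ).toLinearMap) (by
      intro h
      have : (EuclideanSpace.single m 1 : Space d) ∈
          LinearMap.ker (EuclideanSpace.proj m : Space d →L[ℝ] ℝ).toLinearMap := by
        rw [h]; trivial
      simp at this)
  convert h using 2
  ext x
  simp

theorem setIntegral_comp_add_right {d : ℕ} {A B : Set (Space d)} (hA : MeasurableSet A)
    (hB : MeasurableSet B) (w : Space d) (h : ∀ x, x ∈ A ↔ x + w ∈ B) (g : Space d → ℝ) :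
    ∫ x in A, g (x + w) = ∫ x in B, g x := by
  rw [← integral_indicator hA, ← integral_indicator hB,
    ← integral_add_right_eq_self (B.indicator g) w]
  congr 1
  funext x
  by_cases hx : x ∈ A
  · rw [indicator_of_mem hx, indicator_of_mem ((h x).1 hx)]
  · rw [indicator_of_notMem hx, indicator_of_notMem (fun hc => hx ((h x).2 hc))]

/-- The integral of a periodic function over the period cell is invariant under small shifts. -/
theorem setIntegral_cell_add_right {d : ℕ} {J : Finset (Fin d)} {L : Fin d → ℝ}
    (m : Fin d) {h : ℝ} (h0 : 0 < h) (hh : m ∈ J → h < L m) {g : Space d → ℝ}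
    (hper : ∀ j ∈ J, ∀ x, g (x + EuclideanSpace.single j (L j)) = g x)
    (hg : IntegrableOn g (cell J L))
    (hg' : IntegrableOn (fun x => g (x + EuclideanSpace.single m h)) (cell J L)) :
    ∫ x in cell J L, g (x + EuclideanSpace.single m h) = ∫ x in cell J L, g x := by
  by_cases hm : m ∈ J
  -- The cell is made half-open in direction `m`, at the cost of a null hyperplane, so that a
  -- translate modulo the period matches it exactly.
  · set C : Set (Space d) := {x | (∀ j ∈ J, j ≠ m → 0 < x j ∧ x j < L j) ∧ 0 ≤ x m ∧ x m < L m}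
      with hC
    have hcoord : ∀ j, Measurable fun x : Space d => x j := fun j => by fun_prop
    have hCm : MeasurableSet C := by
      have h1 : C = (⋂ j ∈ J.erase m, {x : Space d | 0 < x j ∧ x j < L j}) ∩
          ({x | 0 ≤ x m} ∩ {x | x m < L m}) := by
        ext x
        simp only [hC, mem_ofPred_eq, mem_inter_iff, mem_iInter, Finset.mem_erase, and_imp]
        exact ⟨fun h => ⟨fun i a b => h.1 i b a, h.2⟩, fun h => ⟨fun i a b => h.1 i b a, h.2⟩⟩
      rw [h1]
      refine (Finset.measurableSet_biInter _ fun j _ => ?_).inter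
        ((measurableSet_le measurable_const (hcoord m)).inter
          (measurableSet_lt (hcoord m) measurable_const))
      exact (measurableSet_lt measurable_const (hcoord j)).inter
          (measurableSet_lt (hcoord j) measurable_const)
    have hCae : (cell J L : Set (Space d)) =ᵐ[volume] C := by
      have : ∀ᵐ x : Space d, x m ≠ 0 := by
        rw [ae_iff]; simpa using volume_setOf_coord_eq_zero m
      filter_upwards [this] with x hx
      refine propext ⟨fun hc => ⟨fun j hj _ => hc j hj, (hc m hm).1.le, (hc m hm).2⟩,
        fun hc j hj => ?_⟩
      by_cases hjm : j = m
      · subst hjm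
        exact ⟨lt_of_le_of_ne hc.2.1 (Ne.symm hx), hc.2.2⟩
      · exact hc.1 j hj hjm
    have hres := Measure.restrict_congr_set hCae
    rw [IntegrableOn, hres] at hg hg'
    rw [hres]
    -- Points of `lo` stay in the cell after the shift. The remaining slab leaves it and is brought
    -- back by one period onto the points with `x m < h`.
    set lo : Set (Space d) := {x | x m < L m - h}
    set lo' : Set (Space d) := {x | x m < h}
    have hlo : MeasurableSet lo := measurableSet_lt (hcoord m) measurable_const
    have hlo' : MeasurableSet lo' := measurableSet_lt (hcoord m) measurable_const
    rw [← integral_inter_add_sdiff hlo hg', ← integral_inter_add_sdiff hlo' hg, add_comm]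
    congr 1
    · have : ∀ x, g (x + EuclideanSpace.single m h) = g (x + EuclideanSpace.single m (h - L m)) := by
        intro x
        rw [← hper m hm (x + EuclideanSpace.single m (h - L m))]
        congr 1
        ext j
        by_cases hj : j = m
        · simp only [hj, PiLp.add_apply, PiLp.single_apply, if_true]
          ring
        · simp [hj]
      simp_rw [this]
      refine setIntegral_comp_add_right (hCm.diff hlo) (hCm.inter hlo') _ (fun x => ?_) g
      simp only [hC, lo, lo', Set.mem_sdiff, not_lt, mem_inter_iff, mem_ofPred_eq, PiLp.add_apply,
        PiLp.single_apply]
      have hlt := hh hm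
      constructor
      · rintro ⟨⟨h1, h2, h3⟩, h4⟩
        refine ⟨⟨fun j hj hjm => ?_, ?_, ?_⟩, ?_⟩
        · simpa [hjm] using h1 j hj hjm
        all_goals simp; linarith
      · rintro ⟨⟨h1, h2, h3⟩, h4⟩
        simp only [if_true] at h2 h3 h4
        refine ⟨⟨fun j hj hjm => ?_, ?_, ?_⟩, ?_⟩
        · simpa [hjm] using h1 j hj hjm
        all_goals linarith
    · refine setIntegral_comp_add_right (hCm.inter hlo) (hCm.diff hlo') _ (fun x => ?_) g
      simp only [hC, lo, lo', Set.mem_sdiff, not_lt, mem_inter_iff, mem_ofPred_eq, PiLp.add_apply,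
        PiLp.single_apply]
      have hlt := hh hm
      constructor
      · rintro ⟨⟨h1, h2, h3⟩, h4⟩
        refine ⟨⟨fun j hj hjm => ?_, ?_, ?_⟩, ?_⟩
        · simpa [hjm] using h1 j hj hjm
        all_goals simp; linarith
      · rintro ⟨⟨h1, h2, h3⟩, h4⟩
        simp only [if_true] at h2 h3 h4
        refine ⟨⟨fun j hj hjm => ?_, ?_, ?_⟩, ?_⟩
        · simpa [hjm] using h1 j hj hjm
        all_goals linarith
  · refine setIntegral_comp_add_right (measurableSet_cell J L) (measurableSet_cell J L) _
      (fun x => ?_) g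
    simp only [cell, mem_ofPred_eq, PiLp.add_apply, PiLp.single_apply]
    refine forall₂_congr fun j hj => ?_
    have : j ≠ m := fun hc => hm (hc ▸ hj)
    simp [this]

theorem integrable_spaceTime_of_bounded {d : ℕ} {J : Finset (Fin d)} {L : Fin d → ℝ} {S R B : ℝ}
    {F : ℝ × Space d → ℝ} (hm : AEStronglyMeasurable F (spaceTime J L S))
    (hB : ∀ t ∈ Icc 0 S, ∀ x ∈ cell J L, ‖x‖ ≤ R → |F (t, x)| ≤ B)
    (h0 : ∀ t ∈ Icc 0 S, ∀ x ∈ cell J L, R < ‖x‖ → F (t, x) = 0) :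
    Integrable F (spaceTime J L S) := by
  refine (integrable_indicator_closedBall_spaceTime J L S R B).mono' hm ?_
  filter_upwards [ae_mem_spaceTime J L S] with z hz
  by_cases hzR : ‖z.2‖ ≤ R
  · rw [indicator_of_mem (by simpa using hzR)]
    exact hB z.1 hz.1 z.2 hz.2 hzR
  · rw [indicator_of_notMem (by simpa using hzR)]
    simp [h0 z.1 hz.1 z.2 hz.2 (not_le.1 hzR)]

theorem IsAdmissible.integrable {d : ℕ} {J : Finset (Fin d)} {L : Fin d → ℝ} {S : ℝ}
    {P : ℝ × Space d → ℝ} (h : IsAdmissible J L S P) (hP : Continuous P) :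
    Integrable P (spaceTime J L S) := by
  obtain ⟨R, hR⟩ := h.exists_radius
  obtain ⟨B, hB⟩ := ((isCompact_Icc (a := (0 : ℝ)) (b := S)).prod
    (isCompact_closedBall (0 : Space d) R)).exists_bound_of_continuousOn hP.continuousOn
  exact integrable_spaceTime_of_bounded (R := R) (B := B) hP.aestronglyMeasurable
    (fun t ht x _ hx' => hB (t, x) ⟨ht, by simpa using hx'⟩)
    (fun t _ x hx hx' => (hR t x hx hx').1)

theorem IsAdmissible.integrableOn_cell {d : ℕ} {J : Finset (Fin d)} {L : Fin d → ℝ} {S : ℝ}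
    {P : ℝ × Space d → ℝ} (h : IsAdmissible J L S P) (hP : Continuous P) (t : ℝ) :
    IntegrableOn (fun x => P (t, x)) (cell J L) := by
  obtain ⟨R, hR⟩ := h.exists_radius
  have hc : Continuous fun x => P (t, x) := hP.comp (by fun_prop)
  obtain ⟨B, hB⟩ := (isCompact_closedBall (0 : Space d) R).exists_bound_of_continuousOn
    hc.continuousOn
  refine (integrable_indicator_closedBall_cell J L R B).mono' hc.aestronglyMeasurable ?_
  filter_upwards [ae_restrict_mem (measurableSet_cell J L)] with x hx
  by_cases hxR : ‖x‖ ≤ R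
  · rw [indicator_of_mem (by simpa using hxR)]
    exact hB x (by simpa using hxR)
  · rw [indicator_of_notMem (by simpa using hxR)]
    simp [(hR t x hx (not_le.1 hxR)).1]

theorem IsAdmissible.comp_add_right {d : ℕ} {J : Finset (Fin d)} {L : Fin d → ℝ} {S : ℝ}
    {P : ℝ × Space d → ℝ} (h : IsAdmissible J L S P) (w : Space d) :
    IsAdmissible J L S fun z => P (z.1, z.2 + w) where
  periodic j hj t x := by
    have := h.periodic j hj t (x + w)
    rwa [add_right_comm] at this
  support := by
    obtain ⟨R, T', hT', hR⟩ := h.support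
    refine ⟨R + ‖w‖, T', hT', fun t x hx => ⟨(hR _ _ hx).1, fun j hj => ?_⟩⟩
    have h1 := (hR _ _ hx).2 j hj
    simp only [PiLp.add_apply] at h1
    have h2 := norm_apply_le w j
    have h3 : |x j| ≤ |x j + w j| + |w j| := by
      simpa using abs_sub (x j + w j) (w j)
    linarith

/-- Difference quotients integrate to zero, since shifts preserve the integral over the period cell.
They are bounded by the Lipschitz constant and converge almost everywhere by Rademacher. No boundary
term has to be discussed. -/
theorem integral_fderiv_space_eq_zero {d : ℕ} {J : Finset (Fin d)} {L : Fin d → ℝ}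
    (hL : ∀ j ∈ J, 0 < L j) {S : ℝ} {P : ℝ × Space d → ℝ} {M : ℝ≥0} (hP : LipschitzWith M P)
    (h : IsAdmissible J L S P) (m : Fin d) :
    ∫ z, fderiv ℝ P z (0, EuclideanSpace.single m 1) ∂(spaceTime J L S) = 0 := by
  obtain ⟨R, T', hT', hR⟩ := h.support
  obtain ⟨R', hR'⟩ := exists_norm_le_of_mem_cell J L (R + 1)
  -- Shifts of length at most 1 keep the translated supports within `R + 1`; shifts shorter than the
  -- period wrap around at most once.
  obtain ⟨ε, hε0, hε1, hεL⟩ : ∃ ε : ℝ, 0 < ε ∧ ε ≤ 1 ∧ (m ∈ J → ε < L m) := by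
    by_cases hm : m ∈ J
    · exact ⟨min 1 (L m / 2), lt_min one_pos (half_pos (hL m hm)), min_le_left _ _, fun _ =>
        (min_le_right _ _).trans_lt (half_lt_self (hL m hm))⟩
    · exact ⟨1, one_pos, le_rfl, fun hc => absurd hc hm⟩
  let s : ℕ → ℝ := fun n => ε / (n + 1)
  have hs0 : ∀ n, 0 < s n := fun n => by positivity
  have hsε : ∀ n, s n ≤ ε := fun n => div_le_self hε0.le (by simp)
  have hslim : Tendsto s atTop (𝓝[>] 0) := by
    refine tendsto_nhdsWithin_iff.2 ⟨?_, .of_forall hs0⟩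
    simpa [s, div_eq_mul_inv] using (tendsto_one_div_add_atTop_nhds_zero_nat (𝕜 := ℝ)).const_mul ε
  let e : ℝ × Space d := (0, EuclideanSpace.single m 1)
  have he : ‖e‖ = 1 := by simp [e, Prod.norm_def]
  have hse : ∀ (n : ℕ) (z : ℝ × Space d), z + s n • e = (z.1, z.2 + EuclideanSpace.single m (s n)) := by
    intro n z
    refine Prod.ext (by simp [e]) ?_
    ext j
    by_cases hj : j = m <;> simp [e, hj]
  have hlim := tendsto_integral_of_dominated_convergence (μ := spaceTime J L S)
    (F := fun n z => (s n)⁻¹ * (P (z + s n • e) - P z)) (f := fun z => fderiv ℝ P z e)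
    (fun z => (Metric.closedBall (0 : Space d) R').indicator (fun _ => (M : ℝ)) z.2)
    (fun n => (continuous_const.mul ((hP.continuous.comp (by fun_prop)).sub
      hP.continuous)).aestronglyMeasurable)
    (integrable_indicator_closedBall_spaceTime J L S R' M) (fun n => ?_) ?_
  · refine tendsto_nhds_unique hlim ?_
    refine tendsto_const_nhds.congr fun n => ?_
    have h2 := (h.comp_add_right (EuclideanSpace.single m (s n)))
    have hc : Continuous fun z : ℝ × Space d => P (z.1, z.2 + EuclideanSpace.single m (s n)) :=
      hP.continuous.comp (by fun_prop)
    simp_rw [hse]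
    rw [integral_const_mul, integral_sub (h2.integrable hc) (h.integrable hP.continuous)]
    have i1 := h2.integrable hc
    have i2 := h.integrable hP.continuous
    rw [spaceTime_eq_prod] at i1 i2 ⊢
    rw [integral_prod _ i1, integral_prod _ i2]
    have : ∀ t, ∫ x in cell J L, P (t, x + EuclideanSpace.single m (s n))
        = ∫ x in cell J L, P (t, x) := fun t =>
      setIntegral_cell_add_right m (hs0 n) (fun hm => (hsε n).trans_lt (hεL hm))
        (g := fun x => P (t, x)) (fun j hj x => h.periodic j hj t x)
        (h.integrableOn_cell hP.continuous t) (h2.integrableOn_cell hc t)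
    simp [this]
  · filter_upwards [ae_mem_spaceTime J L S] with z hz
    by_cases hzR : ‖z.2‖ ≤ R'
    · rw [indicator_of_mem (by simpa using hzR), norm_mul, norm_inv, Real.norm_eq_abs,
        abs_of_pos (hs0 n), ← dist_eq_norm]
      have := hP.dist_le_mul (z + s n • e) z
      rw [dist_self_add_left, norm_smul, he, mul_one, Real.norm_eq_abs, abs_of_pos (hs0 n)] at this
      rw [inv_mul_le_iff₀ (hs0 n), mul_comm]
      exact this
    · have hz1 : P z = 0 := by
        by_contra hc
        exact hzR (hR' z.2 hz.2 fun j hj => by linarith [(hR z.1 z.2 hc).2 j hj])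
      have hz2 : P (z + s n • e) = 0 := by
        by_contra hc
        rw [hse] at hc
        refine hzR (hR' z.2 hz.2 fun j hj => ?_)
        have h1 := (hR _ _ hc).2 j hj
        simp only [PiLp.add_apply] at h1
        have h2 := norm_apply_le (EuclideanSpace.single m (s n) : Space d) j
        rw [PiLp.norm_single, Real.norm_eq_abs, abs_of_pos (hs0 n)] at h2
        have h3 : |z.2 j| ≤ |z.2 j + (EuclideanSpace.single m (s n) : Space d) j|
            + |(EuclideanSpace.single m (s n) : Space d) j| := by
          simpa using abs_sub (z.2 j + (EuclideanSpace.single m (s n) : Space d) j)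
            ((EuclideanSpace.single m (s n) : Space d) j)
        linarith [hsε n]
      rw [hz1, hz2, indicator_of_notMem (by simpa using hzR)]
      simp
  · have hd : ∀ᵐ z ∂spaceTime J L S, DifferentiableAt ℝ P z :=
      ae_restrict_of_ae hP.ae_differentiableAt
    filter_upwards [hd] with z hz
    have h1 := (hz.hasFDerivAt.hasLineDerivAt e).tendsto_slope_zero_right.comp hslim
    simpa [Function.comp_def] using h1

/-- On almost every time line the fundamental theorem of calculus for absolutely continuous
functions applies. The value at `S` vanishes by admissibility, so only the initial trace remains. -/
theorem integral_fderiv_time {d : ℕ} {J : Finset (Fin d)} {L : Fin d → ℝ}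
    {S : ℝ} (hS : 0 < S) {P : ℝ × Space d → ℝ} {M : ℝ≥0} (hP : LipschitzWith M P)
    (h : IsAdmissible J L S P) :
    ∫ z, fderiv ℝ P z (1, 0) ∂(spaceTime J L S) = -∫ x in cell J L, P (0, x) := by
  obtain ⟨R, T', hT', hR⟩ := h.support
  obtain ⟨R', hR'⟩ := h.exists_radius
  have hint : Integrable (fun z => fderiv ℝ P z (1, 0)) (spaceTime J L S) := by
    refine integrable_spaceTime_of_bounded (R := R') (B := M)
      ((measurable_fderiv_apply_const ℝ P (1, 0)).aestronglyMeasurable) (fun t _ x _ _ => ?_)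
      (fun t _ x hx hx' => by rw [(hR' t x hx hx').2]; simp)
    have h1 := (fderiv ℝ P (t, x)).le_opNorm (1, 0)
    have h2 := norm_fderiv_le_lipschitz hP (t, x)
    simp only [Prod.norm_def, norm_one, norm_zero, zero_le_one, sup_of_le_left, mul_one] at h1
    exact h1.trans h2
  have hd : ∀ᵐ z ∂spaceTime J L S, DifferentiableAt ℝ P z :=
    ae_restrict_of_ae hP.ae_differentiableAt
  rw [spaceTime_eq_prod] at hint hd ⊢
  rw [integral_prod_symm _ hint, ← integral_neg]
  refine integral_congr_ae ?_
  have hd' := Measure.ae_ae_of_ae_prod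
    ((Measure.measurePreserving_swap (μ := volume.restrict (cell J L))
      (ν := volume.restrict (Icc (0 : ℝ) S))).quasiMeasurePreserving.ae hd)
  filter_upwards [hd'] with x hx
  have hder : ∀ᵐ t ∂volume.restrict (Icc 0 S),
      fderiv ℝ P (t, x) (1, 0) = deriv (fun t => P (t, x)) t := by
    filter_upwards [hx] with t ht
    have h1 : HasDerivAt (fun t : ℝ => (t, x)) (1, 0) t :=
      (hasDerivAt_id t).prodMk (hasDerivAt_const t x)
    exact ((ht : DifferentiableAt ℝ P (t, x)).hasFDerivAt.comp_hasDerivAt t h1).deriv.symm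
  rw [integral_congr_ae hder, integral_Icc_eq_integral_Ioc,
    ← intervalIntegral.integral_of_le hS.le,
    AbsolutelyContinuousOnInterval.integral_deriv_eq_sub (f := fun t => P (t, x))]
  · have : P (S, x) = 0 := by
      by_contra hc
      linarith [(hR S x hc).1]
    simp [this]
  · have h1 : LipschitzWith M fun t => P (t, x) := by
      refine LipschitzWith.of_dist_le_mul fun s t => (hP.dist_le_mul _ _).trans_eq ?_
      simp [Prod.dist_eq]
    exact (h1.lipschitzOnWith (s := uIcc 0 S)).absolutelyContinuousOnInterval

end StatSol

namespace StatSol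

/-! ### Second-order estimates for the entropy and the flux -/

section Taylor

variable {V : Type*} [NormedAddCommGroup V] [NormedSpace ℝ V]

theorem quadratic_bounds {B : V →L[ℝ] V →L[ℝ] ℝ} {c C : ℝ}
    (h : ∀ w, ‖w‖ = 1 → c ≤ B w w ∧ B w w ≤ C) (w : V) :
    c * ‖w‖ ^ 2 ≤ B w w ∧ B w w ≤ C * ‖w‖ ^ 2 := by
  rcases eq_or_ne w 0 with rfl | hw
  · simp
  · have hn : 0 < ‖w‖ := norm_pos_iff.2 hw
    have h1 := h (‖w‖⁻¹ • w) (by rw [norm_smul, norm_inv, norm_norm, inv_mul_cancel₀ hn.ne'])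
    have h2 : B (‖w‖⁻¹ • w) (‖w‖⁻¹ • w) = B w w / ‖w‖ ^ 2 := by
      simp only [map_smul, smul_apply, smul_eq_mul]
      field_simp
    rw [h2, le_div_iff₀ (by positivity), div_le_iff₀ (by positivity)] at h1
    exact h1

/-- Polarization: for a symmetric nonnegative form, the bound on the diagonal bounds the operator
norm with the same constant. -/
theorem bilinear_bound {B : V →L[ℝ] V →L[ℝ] ℝ} {C : ℝ} (hs : ∀ a b, B a b = B b a)
    (h0 : ∀ w, 0 ≤ B w w) (h : ∀ w, B w w ≤ C * ‖w‖ ^ 2) (hC : 0 ≤ C) :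
    ‖B‖ ≤ C := by
  have key : ∀ a b, B a b ≤ C * ‖a‖ * ‖b‖ := by
    intro a b
    rcases eq_or_ne a 0 with rfl | ha
    · simp
    rcases eq_or_ne b 0 with rfl | hb
    · simp
    have hr : 0 < ‖a‖ * ‖b‖ := mul_pos (norm_pos_iff.2 ha) (norm_pos_iff.2 hb)
    -- The cross scaling gives both vectors the norm `‖a‖ ‖b‖`, and so prevents any loss in the
    -- constant.
    have e1 : B (‖b‖ • a + ‖a‖ • b) (‖b‖ • a + ‖a‖ • b)
        - B (‖b‖ • a - ‖a‖ • b) (‖b‖ • a - ‖a‖ • b) = 4 * (‖a‖ * ‖b‖) * B a b := by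
      simp only [map_add, map_sub, map_smul, add_apply,
        sub_apply, smul_apply, smul_eq_mul, hs b a]
      ring
    have e2 : ‖‖b‖ • a + ‖a‖ • b‖ ≤ 2 * (‖a‖ * ‖b‖) := by
      refine (norm_add_le _ _).trans ?_
      simp only [norm_smul, norm_norm]
      linarith [mul_comm ‖a‖ ‖b‖]
    have e3 := h (‖b‖ • a + ‖a‖ • b)
    have e4 := h0 (‖b‖ • a - ‖a‖ • b)
    have e5 : C * ‖‖b‖ • a + ‖a‖ • b‖ ^ 2 ≤ C * (2 * (‖a‖ * ‖b‖)) ^ 2 := by gcongr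
    have e6 : (‖a‖ * ‖b‖) * B a b ≤ (‖a‖ * ‖b‖) * (C * ‖a‖ * ‖b‖) := by nlinarith
    exact le_of_mul_le_mul_left e6 hr
  refine B.opNorm_le_bound hC fun a => (B a).opNorm_le_bound (by positivity) fun b => ?_
  rw [Real.norm_eq_abs, abs_le]
  refine ⟨?_, key a b⟩
  have := key a (-b)
  rw [map_neg, norm_neg] at this
  linarith

/-- Convex functions lie above their tangents. -/
theorem add_deriv_le_of_second_deriv_nonneg {g g' g'' : ℝ → ℝ} (hg : ∀ s, HasDerivAt g (g' s) s)
    (hg' : ∀ s, HasDerivAt g' (g'' s) s) (h0 : ∀ s, 0 ≤ g'' s) : g 0 + g' 0 ≤ g 1 := by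
  have hmono : Monotone g' := monotone_of_hasDerivAt_nonneg hg' h0
  obtain ⟨s, hs, hs'⟩ := exists_hasDerivAt_eq_slope g g' (a := 0) (b := 1) one_pos
    (fun s _ => (hg s).continuousAt.continuousWithinAt) (fun s _ => hg s)
  have := hmono hs.1.le
  rw [hs'] at this
  linarith

/-- Along the segment from `v` to `v + w`, both `η` minus the lower parabola and the upper parabola
minus `η` are convex, hence lie above their tangents at the starting point. -/
theorem taylor_bounds {η : V → ℝ} (hη : ContDiff ℝ 2 η) {c C : ℝ}
    (h : ∀ u w, c * ‖w‖ ^ 2 ≤ fderiv ℝ (fderiv ℝ η) u w w ∧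
      fderiv ℝ (fderiv ℝ η) u w w ≤ C * ‖w‖ ^ 2) (v w : V) :
    c / 2 * ‖w‖ ^ 2 ≤ η (v + w) - η v - fderiv ℝ η v w ∧
      η (v + w) - η v - fderiv ℝ η v w ≤ C / 2 * ‖w‖ ^ 2 := by
  have hd1 : Differentiable ℝ η := hη.differentiable (by norm_num)
  have hd2 : Differentiable ℝ (fderiv ℝ η) :=
    (hη.fderiv_right (m := 1) (by norm_num)).differentiable (by norm_num)
  have hline : ∀ s : ℝ, HasDerivAt (fun s : ℝ => v + s • w) w s := fun s => by
    simpa using ((hasDerivAt_id s).smul_const w).const_add v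
  have h1 : ∀ s : ℝ, HasDerivAt (fun s : ℝ => η (v + s • w)) (fderiv ℝ η (v + s • w) w) s :=
    fun s => (hd1 _).hasFDerivAt.comp_hasDerivAt s (hline s)
  have h2 : ∀ s : ℝ, HasDerivAt (fun s : ℝ => fderiv ℝ η (v + s • w) w)
      (fderiv ℝ (fderiv ℝ η) (v + s • w) w w) s := fun s => by
    have := (hd2 (v + s • w)).hasFDerivAt.comp_hasDerivAt s (hline s)
    exact (ContinuousLinearMap.apply ℝ ℝ w).hasFDerivAt.comp_hasDerivAt s this
  have hq : ∀ (k s : ℝ), HasDerivAt (fun s : ℝ => k / 2 * s ^ 2) (k * s) s := fun k s => by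
    refine ((hasDerivAt_pow 2 s).const_mul (k / 2)).congr_deriv ?_
    norm_num
    ring
  have hq' : ∀ (k s : ℝ), HasDerivAt (fun s : ℝ => k * s) k s := fun k s => by
    simpa using (hasDerivAt_id s).const_mul k
  have lo := add_deriv_le_of_second_deriv_nonneg
    (fun s => (h1 s).sub (hq (c * ‖w‖ ^ 2) s)) (fun s => (h2 s).sub (hq' (c * ‖w‖ ^ 2) s))
    (fun s => sub_nonneg.2 (h _ w).1)
  have hi := add_deriv_le_of_second_deriv_nonneg
    (fun s => (hq (C * ‖w‖ ^ 2) s).sub (h1 s)) (fun s => (hq' (C * ‖w‖ ^ 2) s).sub (h2 s))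
    (fun s => sub_nonneg.2 (h _ w).2)
  simp at lo hi
  constructor <;> linarith

theorem norm_sub_sub_fderiv_le {W : Type*} [NormedAddCommGroup W] [NormedSpace ℝ W] {f : V → W}
    (hf : Differentiable ℝ f) {K : ℝ} (hK : 0 ≤ K)
    (h : ∀ u v, ‖fderiv ℝ f u - fderiv ℝ f v‖ ≤ K * ‖u - v‖) (v ξ : V) :
    ‖f ξ - f v - fderiv ℝ f v (ξ - v)‖ ≤ K * ‖ξ - v‖ ^ 2 := by
  have := (convex_segment v ξ).norm_image_sub_le_of_norm_fderiv_le' (𝕜 := ℝ) (f := f)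
    (φ := fderiv ℝ f v) (C := K * ‖ξ - v‖) (fun x _ => hf x) (fun x hx => (h x v).trans ?_)
    (left_mem_segment ℝ v ξ) (right_mem_segment ℝ v ξ)
  · rw [pow_two, ← mul_assoc]; exact this
  · refine mul_le_mul_of_nonneg_left ?_ hK
    exact norm_sub_le_of_mem_segment hx

theorem norm_fderiv_sub_le_of_iteratedFDeriv {W : Type*} [NormedAddCommGroup W] [NormedSpace ℝ W]
    {f : V → W} (hf : ContDiff ℝ 2 f) {K : ℝ} (hK : ∀ u, ‖iteratedFDeriv ℝ 2 f u‖ ≤ K) (u v : V) :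
    ‖fderiv ℝ f u - fderiv ℝ f v‖ ≤ K * ‖u - v‖ := by
  have hd2 : Differentiable ℝ (fderiv ℝ f) :=
    (hf.fderiv_right (m := 1) (by norm_num)).differentiable (by norm_num)
  refine convex_univ.norm_image_sub_le_of_norm_fderiv_le (𝕜 := ℝ) (fun x _ => hd2 x)
    (fun x _ => ?_) (mem_univ v) (mem_univ u)
  refine le_trans (le_of_eq ?_) (hK x)
  rw [← norm_iteratedFDeriv_one, norm_iteratedFDeriv_fderiv]

theorem norm_le_of_norm_fderiv_sub_le {W : Type*} [NormedAddCommGroup W] [NormedSpace ℝ W]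
    {f : V → W} (hf : Differentiable ℝ f) {K : ℝ} (hK : 0 ≤ K)
    (h : ∀ u v, ‖fderiv ℝ f u - fderiv ℝ f v‖ ≤ K * ‖u - v‖) (ξ : V) :
    ‖f ξ‖ ≤ (‖f 0‖ + ‖fderiv ℝ f 0‖ + K) * (1 + ‖ξ‖ ^ 2) := by
  have h1 := norm_sub_sub_fderiv_le hf hK h 0 ξ
  rw [sub_zero] at h1
  have h2 : ‖f ξ‖ ≤ ‖f ξ - f 0 - fderiv ℝ f 0 ξ‖ + ‖f 0‖ + ‖fderiv ℝ f 0 ξ‖ := by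
    calc ‖f ξ‖ = ‖(f ξ - f 0 - fderiv ℝ f 0 ξ) + f 0 + fderiv ℝ f 0 ξ‖ := by congr 1; abel
      _ ≤ _ := norm_add₃_le
  have h3 := (fderiv ℝ f 0).le_opNorm ξ
  have h4 : ‖ξ‖ ≤ 1 + ‖ξ‖ ^ 2 := by nlinarith [sq_nonneg (‖ξ‖ - 1 / 2)]
  have h5 := mul_le_mul_of_nonneg_left h4 (norm_nonneg (fderiv ℝ f 0))
  nlinarith [norm_nonneg (f 0), mul_nonneg (norm_nonneg (f 0)) (sq_nonneg ‖ξ‖)]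

/-- The Hessian of an entropy symmetrizes the Jacobian of the flux. -/
theorem hessian_comp_symm {η q : V → ℝ} {f : V → V} (hη : ContDiff ℝ 2 η) (hf : ContDiff ℝ 2 f)
    (hqd : Differentiable ℝ q) (hq : ∀ u, fderiv ℝ q u = (fderiv ℝ η u).comp (fderiv ℝ f u))
    (v a b : V) :
    fderiv ℝ (fderiv ℝ η) v a (fderiv ℝ f v b) = fderiv ℝ (fderiv ℝ η) v b (fderiv ℝ f v a) := by
  have hη2 : Differentiable ℝ (fderiv ℝ η) :=
    (hη.fderiv_right (m := 1) (by norm_num)).differentiable (by norm_num)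
  have hf2 : Differentiable ℝ (fderiv ℝ f) :=
    (hf.fderiv_right (m := 1) (by norm_num)).differentiable (by norm_num)
  -- Differentiating `q' = η' f'` gives `q''(a, b) = η''(a, f' b) + η'(f''(a, b))`. Both `q''` and
  -- `f''` are symmetric, hence so is the remaining term.
  have h1 := (hη2 v).hasFDerivAt.clm_comp (hf2 v).hasFDerivAt
  have hq' : fderiv ℝ q = fun u => (fderiv ℝ η u).comp (fderiv ℝ f u) := funext hq
  rw [← hq'] at h1
  have h2 := second_derivative_symmetric (fun y => (hqd y).hasFDerivAt) h1 a b
  have h3 : fderiv ℝ (fderiv ℝ f) v a b = fderiv ℝ (fderiv ℝ f) v b a :=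
    second_derivative_symmetric
      (fun y => (hf.differentiable (by norm_num) y).hasFDerivAt) (hf2 v).hasFDerivAt a b
  simp [h3] at h2
  exact h2

theorem hessian_symm {η : V → ℝ} (hη : ContDiff ℝ 2 η) (v a b : V) :
    fderiv ℝ (fderiv ℝ η) v a b = fderiv ℝ (fderiv ℝ η) v b a :=
  second_derivative_symmetric (fun y => (hη.differentiable (by norm_num) y).hasFDerivAt)
    ((hη.fderiv_right (m := 1) (by norm_num)).differentiable (by norm_num) v).hasFDerivAt a b

end Taylor

/-! ### Integrability of the entropy at infinity -/

/-- On a space of infinite measure, `L²` is not contained in `L¹`. -/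
theorem exists_Lp_two_not_integrable {X : Type*} [MeasurableSpace X] (m : Measure X) [SigmaFinite m]
    (hm : m univ = ⊤) : ∃ g : Lp ℝ 2 m, ¬ Integrable g m := by
  -- The normalised indicator of a set of measure above `4^k` has `L¹` norm 1 and `L²` norm at most
  -- `2⁻ᵏ`. The sum over `k` therefore converges in `L²`, while its integral would exceed every `n`.
  have hA : ∀ k : ℕ, ∃ A : Set X, MeasurableSet A ∧ (4 ^ k : ℝ≥0∞) < m A ∧ m A < ⊤ := by
    intro k
    obtain ⟨A, hA, -, h1, h2⟩ := Measure.exists_subset_measure_lt_top (μ := m) (s := univ)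
      (r := 4 ^ k) MeasurableSet.univ (by rw [hm]; finiteness)
    exact ⟨A, hA, h1, h2⟩
  choose A hAm hA1 hA2 using hA
  have hreal : ∀ k, (4 ^ k : ℝ) ≤ m.real (A k) := fun k => by
    have := (ENNReal.toReal_le_toReal (by finiteness) (hA2 k).ne).2 (hA1 k).le
    simpa [Measure.real] using this
  have hpos : ∀ k, 0 < m.real (A k) := fun k => lt_of_lt_of_le (by positivity) (hreal k)
  let g : ℕ → Lp ℝ 2 m := fun k =>
    indicatorConstLp 2 (hAm k) (hA2 k).ne (m.real (A k))⁻¹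
  have hgco : ∀ k, g k =ᵐ[m] (A k).indicator fun _ => (m.real (A k))⁻¹ := fun k =>
    indicatorConstLp_coeFn
  have hgn : ∀ k, ‖g k‖ ≤ (1 / 2 : ℝ) ^ k := fun k => by
    rw [norm_indicatorConstLp (by norm_num) (by norm_num), norm_inv, Real.norm_eq_abs,
      abs_of_pos (hpos k)]
    simp only [ENNReal.toReal_ofNat]
    have hsq : (2 : ℝ) ^ k ≤ √(m.real (A k)) := by
      refine Real.le_sqrt_of_sq_le ?_
      rw [← pow_mul, mul_comm, pow_mul]
      norm_num
      exact hreal k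
    rw [← Real.sqrt_eq_rpow, inv_mul_le_iff₀ (hpos k), one_div, inv_pow, ← div_eq_mul_inv,
      le_div_iff₀ (by positivity)]
    calc √(m.real (A k)) * 2 ^ k ≤ √(m.real (A k)) * √(m.real (A k)) := by gcongr
      _ = m.real (A k) := Real.mul_self_sqrt (hpos k).le
  have hsum : Summable fun k => ‖g k‖ := Summable.of_nonneg_of_le (fun k => norm_nonneg _) hgn
    (summable_geometric_of_lt_one (by norm_num) (by norm_num))
  have hsum' : ∑' k, ‖g k‖ₑ ≠ ⊤ :=
    ENNReal.tsum_coe_ne_top_iff_summable.2 (NNReal.summable_coe.1 hsum)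
  refine ⟨∑' k, g k, fun hint => ?_⟩
  have hle : ∀ n : ℕ, (n : ℝ) ≤ ∫ x, (∑' k, g k : Lp ℝ 2 m) x ∂m := by
    intro n
    have hi : ∀ k, Integrable ((A k).indicator fun _ => (m.real (A k))⁻¹) m := fun k =>
      (integrable_indicator_iff (hAm k)).2 (integrableOn_const (hA2 k).ne)
    calc (n : ℝ) = ∑ k ∈ Finset.range n, ∫ x, (A k).indicator (fun _ => (m.real (A k))⁻¹) x ∂m := by
          simp [integral_indicator (hAm _), (hpos _).ne']
      _ = ∫ x, ∑ k ∈ Finset.range n, (A k).indicator (fun _ => (m.real (A k))⁻¹) x ∂m :=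
          (integral_finsetSum _ fun k _ => hi k).symm
      _ ≤ _ := by
          refine integral_mono_ae (integrable_finsetSum _ fun k _ => hi k) hint ?_
          filter_upwards [Lp.hasSum_coeFn_tsum hsum', ae_all_iff.2 hgco] with x hx hx2
          have h3 := sum_le_hasSum (Finset.range n) (fun k _ => ?_) hx
          · simpa only [hx2] using h3
          · rw [hx2 k]
            exact indicator_nonneg (fun _ _ => (inv_pos.2 (hpos k)).le) x
  obtain ⟨n, hn⟩ := exists_nat_gt (∫ x, (∑' k, g k : Lp ℝ 2 m) x ∂m)
  linarith [hle n]

/-- If the total entropy is defined on all of `L²(D; U)`, then either `D` has finite measure or the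
entropy vanishes to first order at the origin. -/
theorem exists_integrableOn_const_entropy {d N : ℕ} {D : Set (Space d)} {η : State N → ℝ}
    (hη : ContDiff ℝ 2 η) {C : ℝ}
    (h : ∀ u w, 0 ≤ fderiv ℝ (fderiv ℝ η) u w w ∧
      fderiv ℝ (fderiv ℝ η) u w w ≤ C * ‖w‖ ^ 2)
    (hint : ∀ u : L2 D N, IntegrableOn (fun x => η (u x)) D) :
    ∃ b : ℝ, 0 ≤ b ∧ IntegrableOn (fun _ : Space d => b) D ∧ |η 0| ≤ b ∧ ‖fderiv ℝ η 0‖ ≤ b := by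
  by_cases hD : volume D = ⊤
  -- On infinite measure the zero function already forces `η 0 = 0`.
  · have hη0 : η 0 = 0 := by
      have h0 : IntegrableOn (fun _ : Space d => η 0) D := by
        refine (hint 0).congr ?_
        filter_upwards [Lp.coeFn_zero (State N) 2 (volume.restrict D)] with x hx
        rw [hx]; rfl
      rw [integrableOn_const_iff] at h0
      simpa [hD] using h0
    refine ⟨0, le_rfl, integrableOn_zero, by simp [hη0], ?_⟩
    rw [norm_le_zero_iff]
    ext w
    by_contra hw
    simp only [zero_apply] at hw
    -- Apply the entropy to `u = g w` with `g` in `L²` but not in `L¹`. Both `η(g w)` and the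
    -- quadratic Taylor remainder are integrable, hence so is `g η'(0) w`, which is impossible
    -- unless `η'(0) w = 0`.
    obtain ⟨g, hg⟩ := exists_Lp_two_not_integrable (volume.restrict D) (by simpa using hD)
    refine hg ?_
    let u : L2 D N := (ContinuousLinearMap.toSpanSingleton ℝ w).compLp g
    have hu : ∀ᵐ x ∂volume.restrict D, u x = g x • w := by
      filter_upwards [ContinuousLinearMap.coeFn_compLp
        (ContinuousLinearMap.toSpanSingleton ℝ w) g] with x hx
      rw [hx]; simp
    have h1 : Integrable (fun x => η (g x • w)) (volume.restrict D) := by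
      refine (hint u).congr ?_
      filter_upwards [hu] with x hx
      rw [hx]
    have hgm := Lp.aestronglyMeasurable g
    have hsq : Integrable (fun x => ‖g x‖ ^ 2) (volume.restrict D) := by
      simpa using (Lp.memLp g).integrable_norm_pow (p := 2) (by norm_num)
    have h2 : Integrable (fun x => η (g x • w) - fderiv ℝ η 0 (g x • w)) (volume.restrict D) := by
      refine (hsq.const_mul (C / 2 * ‖w‖ ^ 2)).mono' ?_ (.of_forall fun x => ?_)
      · exact (by have := hη.continuous; fun_prop : Continuous fun y : ℝ =>
          η (y • w) - fderiv ℝ η 0 (y • w)).comp_aestronglyMeasurable hgm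
      · have := taylor_bounds hη (c := 0) (C := C) (by simpa using h) 0 (g x • w)
        simp only [zero_add, hη0, sub_zero, norm_smul, zero_div, zero_mul] at this
        rw [Real.norm_eq_abs, abs_of_nonneg this.1]
        refine this.2.trans_eq (by ring)
    have h3 := ((h1.sub h2).mul_const (fderiv ℝ η 0 w)⁻¹)
    refine h3.congr (.of_forall fun x => ?_)
    simp [hw]
  · refine ⟨|η 0| + ‖fderiv ℝ η 0‖, by positivity, integrableOn_const hD, ?_, ?_⟩
    · linarith [norm_nonneg (fderiv ℝ η 0)]
    · linarith [abs_nonneg (η 0)]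

end StatSol

namespace StatSol

/-! ### Quantitative entropy pairs -/

/-- An entropy pair with two-sided Hessian bounds, for a flux with Lipschitz derivative; `b` bounds
the entropy to first order at the origin. -/
structure IsUniformEntropy {d N : ℕ} (f : Fin d → State N → State N) (η : State N → ℝ)
    (q : Fin d → State N → ℝ) (b c C K : ℝ) : Prop where
  contDiff_flux : ∀ m, ContDiff ℝ 2 (f m)
  K_nonneg : 0 ≤ K
  lipschitz_flux : ∀ m u v, ‖fderiv ℝ (f m) u - fderiv ℝ (f m) v‖ ≤ K * ‖u - v‖
  contDiff_entropy : ContDiff ℝ 2 η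
  c_pos : 0 < c
  C_nonneg : 0 ≤ C
  hessian : ∀ u w, c * ‖w‖ ^ 2 ≤ fderiv ℝ (fderiv ℝ η) u w w ∧
    fderiv ℝ (fderiv ℝ η) u w w ≤ C * ‖w‖ ^ 2
  differentiable : ∀ m, Differentiable ℝ (q m)
  compat : ∀ m u, fderiv ℝ (q m) u = (fderiv ℝ η u).comp (fderiv ℝ (f m) u)
  b_nonneg : 0 ≤ b
  entropy_zero : |η 0| ≤ b
  fderiv_entropy_zero : ‖fderiv ℝ η 0‖ ≤ b

/-- The value at `ξ` of the first-order expansion of `η` at `v`. -/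
noncomputable def tangent {N : ℕ} (η : State N → ℝ) (v ξ : State N) : ℝ :=
  η v + fderiv ℝ η v (ξ - v)

/-- The flux of the first-order expansion of `η` at `v`. -/
noncomputable def tangentFlux {N : ℕ} (η q : State N → ℝ) (f : State N → State N)
    (v ξ : State N) : ℝ :=
  q v - q 0 + fderiv ℝ η v (f ξ - f v)

namespace IsUniformEntropy

variable {d N : ℕ} {f : Fin d → State N → State N} {η : State N → ℝ} {q : Fin d → State N → ℝ}
  {b c C K : ℝ}

theorem norm_hessian_le (h : IsUniformEntropy f η q b c C K) (u : State N) :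
    ‖fderiv ℝ (fderiv ℝ η) u‖ ≤ C :=
  bilinear_bound (hessian_symm h.contDiff_entropy u)
    (fun w => (mul_nonneg h.c_pos.le (sq_nonneg _)).trans (h.hessian u w).1)
    (fun w => (h.hessian u w).2) h.C_nonneg

theorem contDiff_fderiv (h : IsUniformEntropy f η q b c C K) : ContDiff ℝ 1 (fderiv ℝ η) :=
  h.contDiff_entropy.fderiv_right (by norm_num)

theorem norm_fderiv_le (h : IsUniformEntropy f η q b c C K) (v : State N) :
    ‖fderiv ℝ η v‖ ≤ b + C * ‖v‖ := by
  have h1 := convex_univ.norm_image_sub_le_of_norm_fderiv_le (𝕜 := ℝ) (f := fderiv ℝ η) (C := C)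
    (fun x _ => h.contDiff_fderiv.differentiable (by norm_num) x)
    (fun x _ => h.norm_hessian_le x) (mem_univ 0) (mem_univ v)
  rw [sub_zero] at h1
  have h2 := norm_le_norm_add_norm_sub' (fderiv ℝ η v) (fderiv ℝ η 0)
  linarith [h.fderiv_entropy_zero]

theorem taylor (h : IsUniformEntropy f η q b c C K) (v ξ : State N) :
    c / 2 * ‖ξ - v‖ ^ 2 ≤ η ξ - tangent η v ξ ∧ η ξ - tangent η v ξ ≤ C / 2 * ‖ξ - v‖ ^ 2 := by
  have := taylor_bounds h.contDiff_entropy h.hessian v (ξ - v)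
  rw [add_sub_cancel] at this
  simpa only [tangent, sub_sub] using this

theorem abs_entropy_le (h : IsUniformEntropy f η q b c C K) (ξ : State N) :
    |η ξ| ≤ 2 * b + (b + C) * ‖ξ‖ ^ 2 := by
  have h1 := h.taylor 0 ξ
  simp only [tangent, sub_zero] at h1
  have h2 : |fderiv ℝ η 0 ξ| ≤ b * ‖ξ‖ := ((fderiv ℝ η 0).le_opNorm ξ).trans
    (mul_le_mul_of_nonneg_right h.fderiv_entropy_zero (norm_nonneg _))
  have h3 : b * ‖ξ‖ ≤ b * (1 + ‖ξ‖ ^ 2) :=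
    mul_le_mul_of_nonneg_left (by nlinarith [sq_nonneg (‖ξ‖ - 1 / 2)]) h.b_nonneg
  have h4 := abs_le.1 h2
  have h5 := abs_le.1 h.entropy_zero
  have h6 : 0 ≤ c / 2 * ‖ξ‖ ^ 2 := mul_nonneg (by linarith [h.c_pos]) (sq_nonneg _)
  have h7 : 0 ≤ C * ‖ξ‖ ^ 2 := mul_nonneg h.C_nonneg (sq_nonneg _)
  rw [abs_le]
  constructor <;> nlinarith

theorem norm_sub_sq_le {N : ℕ} (v ξ : State N) : ‖ξ - v‖ ^ 2 ≤ 2 * (‖v‖ ^ 2 + ‖ξ‖ ^ 2) := by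
  have h1 := norm_sub_le ξ v
  have h2 := pow_le_pow_left₀ (norm_nonneg _) h1 2
  nlinarith [sq_nonneg (‖ξ‖ - ‖v‖)]

theorem abs_tangent_le (h : IsUniformEntropy f η q b c C K) (v ξ : State N) :
    |tangent η v ξ| ≤ 2 * b + (b + 3 * C) * (‖v‖ ^ 2 + ‖ξ‖ ^ 2) := by
  have h1 := h.taylor v ξ
  have h2 := abs_le.1 (h.abs_entropy_le ξ)
  have h3 := norm_sub_sq_le v ξ
  have h4 : C / 2 * ‖ξ - v‖ ^ 2 ≤ C / 2 * (2 * (‖v‖ ^ 2 + ‖ξ‖ ^ 2)) :=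
    mul_le_mul_of_nonneg_left h3 (by linarith [h.C_nonneg])
  have h5 : 0 ≤ c / 2 * ‖ξ - v‖ ^ 2 := mul_nonneg (by linarith [h.c_pos]) (sq_nonneg _)
  have h6 : 0 ≤ C * ‖ξ‖ ^ 2 := mul_nonneg h.C_nonneg (sq_nonneg _)
  have h7 : 0 ≤ C * ‖v‖ ^ 2 := mul_nonneg h.C_nonneg (sq_nonneg _)
  have h8 : 0 ≤ b * ‖v‖ ^ 2 := mul_nonneg h.b_nonneg (sq_nonneg _)
  rw [abs_le]
  constructor <;> nlinarith

/-- Dominates the term that carries the gradient of the spatial cutoff. The constant part has to be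
a multiple of `b`, the only constant known to be integrable over `D`; subtracting `q 0` in the flux
is what makes such a bound possible. -/
theorem exists_tangentFlux_le (h : IsUniformEntropy f η q b c C K) {R : ℝ} (hR : 0 ≤ R) :
    ∃ A : ℝ, 0 ≤ A ∧ ∀ m v ξ, ‖v‖ ≤ R →
      |tangentFlux η (q m) (f m) v ξ| ≤ A * b + A * (‖v‖ ^ 2 + ‖ξ‖ ^ 2) := by
  set F : ℝ := (∑ m, ‖fderiv ℝ (f m) 0‖) + K * R with hF
  have hF0 : 0 ≤ F := add_nonneg (Finset.sum_nonneg fun _ _ => norm_nonneg _)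
    (mul_nonneg h.K_nonneg hR)
  have hFle : ∀ m v, ‖v‖ ≤ R → ‖fderiv ℝ (f m) v‖ ≤ F := by
    intro m v hv
    have h1 := h.lipschitz_flux m v 0
    rw [sub_zero] at h1
    have h2 := norm_le_norm_add_norm_sub' (fderiv ℝ (f m) v) (fderiv ℝ (f m) 0)
    have h3 : ‖fderiv ℝ (f m) 0‖ ≤ ∑ m, ‖fderiv ℝ (f m) 0‖ :=
      Finset.single_le_sum (f := fun m => ‖fderiv ℝ (f m) 0‖) (fun _ _ => norm_nonneg _)
        (Finset.mem_univ m)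
    have h4 := mul_le_mul_of_nonneg_left hv h.K_nonneg
    linarith
  -- The constant is chosen so generously that it exceeds the sum of the estimates `t1` to `t4` by
  -- the manifestly nonnegative expression in `e2`.
  refine ⟨(F * (1 + R) + 2 * F + 2 * (b + C * R) * K) + 4 * C * F + 2 * b * F, ?_,
    fun m v ξ hv => ?_⟩
  · have := h.K_nonneg; have := h.C_nonneg; have := h.b_nonneg; positivity
  have hb := h.b_nonneg
  have hC := h.C_nonneg
  have hK := h.K_nonneg
  -- the entropy flux
  have h1 : |q m v - q m 0| ≤ (b + C * ‖v‖) * F * ‖v‖ := by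
    have := (convex_segment 0 v).norm_image_sub_le_of_norm_fderiv_le (𝕜 := ℝ) (f := q m)
      (C := (b + C * ‖v‖) * F) (fun x _ => h.differentiable m x) (fun x hx => ?_)
      (left_mem_segment ℝ 0 v) (right_mem_segment ℝ 0 v)
    · simpa using this
    · have hx' : ‖x‖ ≤ ‖v‖ := by simpa using norm_sub_le_of_mem_segment hx
      rw [h.compat]
      refine (ContinuousLinearMap.opNorm_comp_le _ _).trans ?_
      refine mul_le_mul ((h.norm_fderiv_le x).trans ?_) (hFle m x (hx'.trans hv)) (norm_nonneg _)
        (by positivity)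
      gcongr
  have h2 : ‖f m ξ - f m v‖ ≤ F * ‖ξ - v‖ + K * ‖ξ - v‖ ^ 2 := by
    have e1 := norm_sub_sub_fderiv_le ((h.contDiff_flux m).differentiable (by norm_num)) h.K_nonneg
      (h.lipschitz_flux m) v ξ
    have e2 := norm_le_norm_add_norm_sub' (f m ξ - f m v) (fderiv ℝ (f m) v (ξ - v))
    have e3 := ((fderiv ℝ (f m) v).le_opNorm (ξ - v)).trans
      (mul_le_mul_of_nonneg_right (hFle m v hv) (norm_nonneg _))
    linarith
  have h3 : |fderiv ℝ η v (f m ξ - f m v)| ≤ (b + C * ‖v‖) * (F * ‖ξ - v‖ + K * ‖ξ - v‖ ^ 2) :=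
    ((fderiv ℝ η v).le_opNorm _).trans
      (mul_le_mul (h.norm_fderiv_le v) h2 (norm_nonneg _) (by positivity))
  have h4 := norm_sub_sq_le v ξ
  have h5 : ‖ξ - v‖ ≤ 1 + ‖ξ - v‖ ^ 2 := by nlinarith [sq_nonneg (‖ξ - v‖ - 1 / 2)]
  have h6 : ‖v‖ * ‖ξ - v‖ ≤ ‖v‖ ^ 2 + ‖ξ - v‖ ^ 2 := by
    nlinarith [sq_nonneg (‖v‖ - ‖ξ - v‖), sq_nonneg ‖v‖, sq_nonneg ‖ξ - v‖]
  set X := ‖v‖ ^ 2 + ‖ξ‖ ^ 2 with hX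
  have hX0 : 0 ≤ X := by positivity
  have hvX : ‖v‖ ^ 2 ≤ X := by simp [hX]
  have t1 : (b + C * ‖v‖) * F * ‖v‖ ≤ F * R * b + C * F * X := by
    have e1 : b * F * ‖v‖ ≤ b * F * R := by gcongr
    have e2 : C * F * ‖v‖ ^ 2 ≤ C * F * X := by gcongr
    nlinarith
  have t2 : b * F * ‖ξ - v‖ ≤ b * F * (1 + 2 * X) :=
    mul_le_mul_of_nonneg_left (by linarith) (by positivity)
  have t3 : C * F * (‖v‖ * ‖ξ - v‖) ≤ C * F * (3 * X) :=
    mul_le_mul_of_nonneg_left (by linarith) (by positivity)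
  have t4 : (b + C * ‖v‖) * K * ‖ξ - v‖ ^ 2 ≤ (b + C * R) * K * (2 * X) := by gcongr
  have t5 : |tangentFlux η (q m) (f m) v ξ|
      ≤ |q m v - q m 0| + |fderiv ℝ η v (f m ξ - f m v)| := abs_add_le _ _
  have e1 : (b + C * ‖v‖) * (F * ‖ξ - v‖ + K * ‖ξ - v‖ ^ 2) = b * F * ‖ξ - v‖
      + C * F * (‖v‖ * ‖ξ - v‖) + (b + C * ‖v‖) * K * ‖ξ - v‖ ^ 2 := by ring
  have hup : |tangentFlux η (q m) (f m) v ξ| ≤ F * R * b + C * F * X + b * F * (1 + 2 * X)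
      + C * F * (3 * X) + (b + C * R) * K * (2 * X) := by linarith
  refine hup.trans (sub_nonneg.1 ?_)
  have e2 : 0 ≤ 2 * (F * b) + 2 * ((b + C * R) * K * b) + 4 * (C * F * b) + 2 * (b * F * b)
      + 3 * (F * X) + F * R * X := by positivity
  refine e2.trans_eq ?_
  ring

end IsUniformEntropy

/-! ### Lipschitz solutions and the test functions built from them -/

/-- A bounded Lipschitz solution of finite energy on `[0, S] × D`, extended to all times. -/
structure IsLipschitzSolution {d N : ℕ} (f : Fin d → State N → State N) (J : Finset (Fin d))
    (L : Fin d → ℝ) (S : ℝ) (R : ℝ≥0) (v : ℝ × Space d → State N) : Prop where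
  lipschitz : LipschitzWith R v
  bounded : ∀ z, ‖v z‖ ≤ R
  periodic : ∀ j ∈ J, ∀ (t : ℝ) (x : Space d), v (t, x + EuclideanSpace.single j (L j)) = v (t, x)
  equation : ∀ᵐ z ∂spaceTime J L S, fderiv ℝ v z (1, 0)
    + ∑ m, fderiv ℝ (f m) (v z) (fderiv ℝ v z (0, EuclideanSpace.single m 1)) = 0
  energy : Integrable (fun z => ‖v z‖ ^ 2) (spaceTime J L S)
  energy0 : Integrable (fun x => ‖v (0, x)‖ ^ 2) (volume.restrict (cell J L))

/-- A time cutoff, vanishing for times beyond some `T' < S`. -/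
structure IsTimeCutoff (S : ℝ) (θ : ℝ → ℝ) : Prop where
  smooth : ContDiff ℝ ∞ θ
  compact : HasCompactSupport θ
  nonneg : ∀ t, 0 ≤ θ t
  support : ∃ T' : ℝ, T' < S ∧ ∀ t, θ t ≠ 0 → t ≤ T'

theorem exists_lipschitzWith_mul {X : Type*} [PseudoMetricSpace X] {g h : X → ℝ} {Kg Kh : ℝ≥0}
    (hg : LipschitzWith Kg g) (hh : LipschitzWith Kh h) {Bg Bh : ℝ} (hBg : ∀ x, |g x| ≤ Bg)
    (hBh : ∀ x, |h x| ≤ Bh) : ∃ M : ℝ≥0, LipschitzWith M fun x => g x * h x := by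
  refine ⟨(Bg.toNNReal * Kh + Bh.toNNReal * Kg), LipschitzWith.of_dist_le_mul fun x y => ?_⟩
  have e : g x * h x - g y * h y = g x * (h x - h y) + h y * (g x - g y) := by ring
  have h1 := hh.dist_le_mul x y
  have h2 := hg.dist_le_mul x y
  rw [Real.dist_eq] at h1 h2
  have hBg0 : 0 ≤ Bg := (abs_nonneg _).trans (hBg x)
  have hBh0 : 0 ≤ Bh := (abs_nonneg _).trans (hBh x)
  rw [Real.dist_eq, e]
  push_cast
  rw [Real.coe_toNNReal _ hBg0, Real.coe_toNNReal _ hBh0]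
  calc |g x * (h x - h y) + h y * (g x - g y)|
      ≤ |g x| * |h x - h y| + |h y| * |g x - g y| := by
        rw [← abs_mul, ← abs_mul]; exact abs_add_le _ _
    _ ≤ Bg * (Kh * dist x y) + Bh * (Kg * dist x y) := by
        gcongr
        · exact hBg x
        · exact hBh y
    _ = _ := by ring

theorem exists_lipschitzWith_comp {X V : Type*} [PseudoMetricSpace X] [NormedAddCommGroup V]
    [NormedSpace ℝ V] [FiniteDimensional ℝ V] {G : V → ℝ} (hG : ContDiff ℝ 1 G) {v : X → V}
    {K : ℝ≥0} (hv : LipschitzWith K v) {R : ℝ} (hR : ∀ x, ‖v x‖ ≤ R) :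
    (∃ M : ℝ≥0, LipschitzWith M fun x => G (v x)) ∧ ∃ B, ∀ x, |G (v x)| ≤ B := by
  have hc := isCompact_closedBall (0 : V) R
  have hmem : ∀ x, v x ∈ Metric.closedBall (0 : V) R := fun x => by simpa using hR x
  obtain ⟨B, hB⟩ := hc.exists_bound_of_continuousOn hG.continuous.continuousOn
  obtain ⟨B', hB'⟩ := hc.exists_bound_of_continuousOn
    (hG.continuous_fderiv (by norm_num)).continuousOn
  refine ⟨⟨B'.toNNReal * K, ?_⟩, B, fun x => hB _ (hmem x)⟩
  have h1 : LipschitzOnWith B'.toNNReal G (Metric.closedBall (0 : V) R) := by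
    refine (convex_closedBall (0 : V) R).lipschitzOnWith_of_nnnorm_fderiv_le (𝕜 := ℝ)
      (fun x _ => hG.differentiable (by norm_num) x) fun x hx => ?_
    rw [← NNReal.coe_le_coe, coe_nnnorm]
    exact (hB' x hx).trans (Real.le_coe_toNNReal B')
  have h2 := h1.comp (hv.lipschitzOnWith (s := univ)) (fun x _ => hmem x)
  exact lipschitzOnWith_univ.1 h2

/-- The subspace spanned by the periodic directions. -/
def periodicDirections {d : ℕ} (J : Finset (Fin d)) : Submodule ℝ (Space d) where
  carrier := {y | ∀ j ∉ J, y j = 0}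
  add_mem' ha hb j hj := by simp [ha j hj, hb j hj]
  zero_mem' j _ := by simp
  smul_mem' c x hx j hj := by simp [hx j hj]

/-- A cutoff in the unbounded directions, at scale `r`. -/
noncomputable def spaceCutoff {d : ℕ} (J : Finset (Fin d)) (r : ℝ) (x : Space d) : ℝ :=
  max 0 (min 1 (2 - Metric.infDist x (periodicDirections J) / r))

theorem spaceCutoff_mem_Icc {d : ℕ} (J : Finset (Fin d)) (r : ℝ) (x : Space d) :
    spaceCutoff J r x ∈ Icc (0 : ℝ) 1 :=
  ⟨le_max_left _ _, max_le zero_le_one (min_le_left _ _)⟩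

theorem lipschitzWith_spaceCutoff {d : ℕ} (J : Finset (Fin d)) {r : ℝ≥0} :
    LipschitzWith r⁻¹ (spaceCutoff J r) := by
  have h1 : LipschitzWith r⁻¹ fun x : Space d =>
      2 - Metric.infDist x (periodicDirections J) / (r : ℝ) := by
    refine LipschitzWith.of_dist_le_mul fun x y => ?_
    have h := (Metric.lipschitz_infDist_pt (periodicDirections J : Set (Space d))).dist_le_mul x y
    rw [Real.dist_eq] at h ⊢
    rw [sub_sub_sub_cancel_left, ← sub_div, abs_div, abs_sub_comm, NNReal.coe_inv,
      NNReal.abs_eq, div_eq_inv_mul]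
    refine mul_le_mul_of_nonneg_left ?_ (by positivity)
    simpa using h
  exact (h1.const_min 1).const_max 0

/-- The distance to a subspace does not change under translations along it, so the cutoff is
constant in the periodic directions. -/
theorem spaceCutoff_add_single {d : ℕ} (J : Finset (Fin d)) (r : ℝ) (x : Space d) {j : Fin d}
    (hj : j ∈ J) (l : ℝ) : spaceCutoff J r (x + EuclideanSpace.single j l) = spaceCutoff J r x := by
  have key : ∀ (y : Space d) (l : ℝ), Metric.infDist (y + EuclideanSpace.single j l)
      (periodicDirections J) ≤ Metric.infDist y (periodicDirections J) := by
    intro y l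
    have hne : (periodicDirections J : Set (Space d)).Nonempty := ⟨0, (periodicDirections J).zero_mem⟩
    refine (Metric.le_infDist hne).2 fun w hw => ?_
    have hmem : w + EuclideanSpace.single j l ∈ (periodicDirections J : Set (Space d)) := by
      refine (periodicDirections J).add_mem hw fun i hi => ?_
      have : i ≠ j := fun h => hi (h ▸ hj)
      simp [this]
    refine (Metric.infDist_le_dist_of_mem hmem).trans_eq ?_
    rw [dist_add_right]
  have h1 := key x l
  have h2 := key (x + EuclideanSpace.single j l) (-l)
  have h3 : x + EuclideanSpace.single j l + EuclideanSpace.single j (-l) = x := by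
    ext i
    by_cases hi : i = j <;> simp [hi]
  rw [h3] at h2
  rw [spaceCutoff, spaceCutoff, le_antisymm h1 h2]

theorem abs_le_of_spaceCutoff_ne_zero {d : ℕ} {J : Finset (Fin d)} {r : ℝ} (hr : 0 < r)
    {x : Space d} (hx : spaceCutoff J r x ≠ 0) {j : Fin d} (hj : j ∉ J) : |x j| ≤ 2 * r := by
  have hne : (periodicDirections J : Set (Space d)).Nonempty := ⟨0, (periodicDirections J).zero_mem⟩
  have h1 : |x j| ≤ Metric.infDist x (periodicDirections J) := by
    refine (Metric.le_infDist hne).2 fun w hw => ?_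
    have := norm_apply_le (x - w) j
    rw [PiLp.sub_apply, hw j hj, sub_zero] at this
    rwa [dist_eq_norm]
  refine h1.trans ?_
  by_contra hc
  push Not at hc
  refine hx (max_eq_left ((min_le_right _ _).trans ?_))
  rw [sub_nonpos, le_div_iff₀ hr]
  exact hc.le

theorem spaceCutoff_eq_one {d : ℕ} {J : Finset (Fin d)} {r : ℝ} (hr : 0 < r)
    {x : Space d} (hx : ‖x‖ ≤ r) : spaceCutoff J r x = 1 := by
  have h1 : Metric.infDist x (periodicDirections J) ≤ ‖x‖ := by
    simpa using Metric.infDist_le_dist_of_mem (x := x) (periodicDirections J).zero_mem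
  have h2 : Metric.infDist x (periodicDirections J) / r ≤ 1 := (div_le_one hr).2 (h1.trans hx)
  rw [spaceCutoff, min_eq_left (by linarith), max_eq_right zero_le_one]

theorem IsTimeCutoff.exists_lipschitzWith {S : ℝ} {θ : ℝ → ℝ} (h : IsTimeCutoff S θ) :
    (∃ M : ℝ≥0, LipschitzWith M θ) ∧ ∃ B, ∀ t, |θ t| ≤ B := by
  have h1 : ContDiff ℝ 1 θ := h.smooth.of_le (by simp)
  exact ⟨(h1.lipschitzWith_of_hasCompactSupport h.compact (by norm_num)),
    h.compact.exists_bound_of_continuous h.smooth.continuous⟩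

/-- The test functions `θ(t) χ(x) G(v(t, x))`. -/
theorem isAdmissible_cutoff_mul {d N : ℕ} {f : Fin d → State N → State N} {J : Finset (Fin d)}
    {L : Fin d → ℝ} {S : ℝ} {R : ℝ≥0} {v : ℝ × Space d → State N}
    (hv : IsLipschitzSolution f J L S R v) {θ : ℝ → ℝ} (hθ : IsTimeCutoff S θ) {r : ℝ≥0}
    (hr : 0 < r) {G : State N → ℝ} (hG : ContDiff ℝ 1 G) :
    (∃ M : ℝ≥0, LipschitzWith M fun z : ℝ × Space d => θ z.1 * spaceCutoff J r z.2 * G (v z)) ∧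
    IsAdmissible J L S fun z : ℝ × Space d => θ z.1 * spaceCutoff J r z.2 * G (v z) := by
  constructor
  · obtain ⟨⟨M1, hM1⟩, B1, hB1⟩ := hθ.exists_lipschitzWith
    obtain ⟨⟨M2, hM2⟩, B2, hB2⟩ := exists_lipschitzWith_comp hG hv.lipschitz hv.bounded
    have hχ : ∀ x, |spaceCutoff J r x| ≤ 1 := fun x => by
      have := spaceCutoff_mem_Icc J r x
      rw [abs_of_nonneg this.1]; exact this.2
    obtain ⟨M3, hM3⟩ := exists_lipschitzWith_mul
      (hM1.comp (LipschitzWith.prod_fst (α := ℝ) (β := Space d)))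
      ((lipschitzWith_spaceCutoff J (r := r)).comp (LipschitzWith.prod_snd (α := ℝ) (β := Space d)))
      (fun x => hB1 x.1) (fun x => hχ x.2)
    refine exists_lipschitzWith_mul hM3 hM2 (Bg := B1) (fun x => ?_) hB2
    rw [abs_mul]
    have := mul_le_mul (hB1 x.1) (hχ x.2) (abs_nonneg _) ((abs_nonneg _).trans (hB1 x.1))
    simpa using this
  · refine ⟨fun j hj t x => ?_, 2 * r, ?_⟩
    · simp only [spaceCutoff_add_single J r x hj, hv.periodic j hj]
    · obtain ⟨T', hT', h⟩ := hθ.support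
      refine ⟨T', hT', fun t x hne => ?_⟩
      have h1 : θ t * spaceCutoff J r x ≠ 0 := left_ne_zero_of_mul hne
      exact ⟨h t (left_ne_zero_of_mul h1), fun j hj =>
        abs_le_of_spaceCutoff_ne_zero (by exact_mod_cast hr) (right_ne_zero_of_mul h1) hj⟩

/-- The exceptional set comes from `v` and the cutoff alone. It depends neither on `G` nor on the
direction, so all test functions built from `v` are differentiated on one set of full measure. -/
theorem ae_fderiv_cutoff_mul {d N : ℕ} {f : Fin d → State N → State N} {J : Finset (Fin d)}
    {L : Fin d → ℝ} {S : ℝ} {R : ℝ≥0} {v : ℝ × Space d → State N}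
    (hv : IsLipschitzSolution f J L S R v) {θ : ℝ → ℝ} (hθ : IsTimeCutoff S θ) {r : ℝ≥0} :
    ∀ᵐ z ∂spaceTime J L S, ∀ G : State N → ℝ, ContDiff ℝ 1 G → ∀ w : ℝ × Space d,
      fderiv ℝ (fun z : ℝ × Space d => θ z.1 * spaceCutoff J r z.2 * G (v z)) z w
        = (deriv θ z.1 * w.1 * spaceCutoff J r z.2
            + θ z.1 * fderiv ℝ (spaceCutoff J r) z.2 w.2) * G (v z)
          + θ z.1 * spaceCutoff J r z.2 * fderiv ℝ G (v z) (fderiv ℝ v z w) := by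
  have h1 : ∀ᵐ z ∂spaceTime J L S, DifferentiableAt ℝ v z :=
    ae_restrict_of_ae hv.lipschitz.ae_differentiableAt
  have h2 : ∀ᵐ z ∂spaceTime J L S, DifferentiableAt ℝ (spaceCutoff J r) z.2 := by
    rw [spaceTime_eq_prod]
    exact Measure.quasiMeasurePreserving_snd.ae
      (ae_restrict_of_ae (lipschitzWith_spaceCutoff J (r := r)).ae_differentiableAt)
  filter_upwards [h1, h2] with z hz1 hz2 G hG w
  have e1 : HasFDerivAt (fun z : ℝ × Space d => θ z.1)
      (deriv θ z.1 • ContinuousLinearMap.fst ℝ ℝ (Space d)) z :=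
    ((hθ.smooth.differentiable (by simp) z.1).hasDerivAt).comp_hasFDerivAt z hasFDerivAt_fst
  have e2 : HasFDerivAt (fun z : ℝ × Space d => spaceCutoff J r z.2)
      ((fderiv ℝ (spaceCutoff J r) z.2).comp (ContinuousLinearMap.snd ℝ ℝ (Space d))) z :=
    hz2.hasFDerivAt.comp z hasFDerivAt_snd
  have e3 : HasFDerivAt (fun z => G (v z)) ((fderiv ℝ G (v z)).comp (fderiv ℝ v z)) z :=
    (hG.differentiable (by norm_num) (v z)).hasFDerivAt.comp z hz1.hasFDerivAt
  have e4 : HasFDerivAt (fun z : ℝ × Space d => θ z.1 * spaceCutoff J r z.2 * G (v z)) _ z :=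
    (e1.mul e2).mul e3
  rw [e4.fderiv]
  simp only [add_apply, smul_apply, ContinuousLinearMap.coe_comp, Function.comp_apply, Pi.mul_apply,
    ContinuousLinearMap.coe_fst', ContinuousLinearMap.coe_snd', smul_eq_mul]
  ring

end StatSol

namespace StatSol

/-! ### Balance of the linearized entropy along a Lipschitz solution -/

theorem sum_apply_mul_single {N : ℕ} (A : State N →L[ℝ] ℝ) (ξ : State N) :
    ∑ a, ξ a * A (EuclideanSpace.single a 1) = A ξ := by
  have h : ξ = ∑ a, ξ a • EuclideanSpace.single a (1 : ℝ) := by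
    ext i
    simp [Finset.sum_apply, Pi.single_apply]
  conv_rhs => rw [h, map_sum]
  simp

/-- Assembles the scalar equations, tested with the components of a covector field `y A`, into a
pairing with the covector itself. Here `x` stands for the derivative of the scalar factor and `H`
for that of `A`; in the application `A = η'(v)`. -/
theorem sum_fluxPairing {d N : ℕ} (f : Fin d → State N → State N)
    (B : Fin N → ℝ × Space d →L[ℝ] ℝ) (ξ : State N) (x : ℝ × Space d → ℝ) (y : ℝ)
    (A : State N →L[ℝ] ℝ) (H : ℝ × Space d → State N →L[ℝ] ℝ)
    (hB : ∀ a w, B a w = x w * A (EuclideanSpace.single a 1)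
      + y * H w (EuclideanSpace.single a 1)) :
    ∑ a, fluxPairing f a (B a) ξ = x (1, 0) * A ξ + y * H (1, 0) ξ
      + ∑ m, (x (0, EuclideanSpace.single m 1) * A (f m ξ)
        + y * H (0, EuclideanSpace.single m 1) (f m ξ)) := by
  have key : ∀ (w : ℝ × Space d) (ζ : State N),
      ∑ a, ζ a * B a w = x w * A ζ + y * H w ζ := by
    intro w ζ
    rw [← sum_apply_mul_single A ζ, ← sum_apply_mul_single (H w) ζ, Finset.mul_sum,
      Finset.mul_sum, ← Finset.sum_add_distrib]
    refine Finset.sum_congr rfl fun a _ => ?_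
    rw [hB]; ring
  simp only [fluxPairing, Finset.sum_add_distrib]
  rw [Finset.sum_comm, key]
  simp only [key, Finset.sum_add_distrib]

theorem IsAdmissible.integrable_fderiv {d : ℕ} {J : Finset (Fin d)} {L : Fin d → ℝ} {S : ℝ}
    {P : ℝ × Space d → ℝ} {M : ℝ≥0} (hP : LipschitzWith M P) (h : IsAdmissible J L S P)
    (w : ℝ × Space d) : Integrable (fun z => fderiv ℝ P z w) (spaceTime J L S) := by
  obtain ⟨R', hR'⟩ := h.exists_radius
  refine integrable_spaceTime_of_bounded (R := R') (B := M * ‖w‖)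
    ((measurable_fderiv_apply_const ℝ P w).aestronglyMeasurable) (fun t _ x _ _ => ?_)
    (fun t _ x hx hx' => by rw [(hR' t x hx hx').2]; simp)
  exact ((fderiv ℝ P (t, x)).le_opNorm w).trans
    (mul_le_mul_of_nonneg_right (norm_fderiv_le_lipschitz hP (t, x)) (norm_nonneg _))

theorem IsUniformEntropy.continuous_tangent {d N : ℕ} {f : Fin d → State N → State N}
    {η : State N → ℝ} {q : Fin d → State N → ℝ} {b c C K : ℝ}
    (h : IsUniformEntropy f η q b c C K) :
    Continuous fun p : State N × State N => tangent η p.1 p.2 := by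
  have h1 := h.contDiff_entropy.continuous
  have h2 := h.contDiff_fderiv.continuous
  unfold tangent
  exact (h1.comp continuous_fst).add
    ((h2.comp continuous_fst).clm_apply (continuous_snd.sub continuous_fst))

theorem IsUniformEntropy.exists_flux_growth {d N : ℕ} {f : Fin d → State N → State N}
    {η : State N → ℝ} {q : Fin d → State N → ℝ} {b c C K : ℝ}
    (h : IsUniformEntropy f η q b c C K) :
    ∃ Kf : ℝ, ∀ m ξ, ‖f m ξ‖ ≤ Kf * (1 + ‖ξ‖ ^ 2) := by
  refine ⟨∑ m, (‖f m 0‖ + ‖fderiv ℝ (f m) 0‖ + K), fun m ξ => ?_⟩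
  refine (norm_le_of_norm_fderiv_sub_le ((h.contDiff_flux m).differentiable (by norm_num))
    h.K_nonneg (h.lipschitz_flux m) ξ).trans ?_
  refine mul_le_mul_of_nonneg_right ?_ (by positivity)
  exact Finset.single_le_sum (f := fun m => ‖f m 0‖ + ‖fderiv ℝ (f m) 0‖ + K)
    (fun m _ => by have := h.K_nonneg; positivity) (Finset.mem_univ m)

section Balance

set_option linter.unusedSectionVars false

variable {d N : ℕ} {f : Fin d → State N → State N} {η : State N → ℝ} {q : Fin d → State N → ℝ}
  {b c C K : ℝ} {J : Finset (Fin d)} {L : Fin d → ℝ} {S : ℝ} {κ0 : Kernel (Space d) (State N)}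
  {κ : Kernel (ℝ × Space d) (State N)} [IsMarkovKernel κ0] [IsMarkovKernel κ] {R : ℝ≥0}
  {v : ℝ × Space d → State N} {θ : ℝ → ℝ}

theorem integrable_const_spaceTime (hb : IntegrableOn (fun _ => b) (cell J L)) :
    Integrable (fun _ : ℝ × Space d => b) (spaceTime J L S) := by
  rw [spaceTime_eq_prod]
  have := (integrable_const (μ := volume.restrict (Icc 0 S)) (1 : ℝ)).mul_prod hb
  simpa using this

theorem integrable_energy (hw : IsWeakSolution f J L S κ0 κ)
    (hv : IsLipschitzSolution f J L S R v) :
    Integrable (fun z : (ℝ × Space d) × State N => ‖v z.1‖ ^ 2 + ‖z.2‖ ^ 2)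
      (spaceTime J L S ⊗ₘ κ) :=
  (integrable_comp_fst_compProd κ hv.energy).add hw.energy.integrable_sq

theorem integrable_energy_zero (hw : IsWeakSolution f J L S κ0 κ)
    (hv : IsLipschitzSolution f J L S R v) :
    Integrable (fun z : Space d × State N => ‖v (0, z.1)‖ ^ 2 + ‖z.2‖ ^ 2)
      (volume.restrict (cell J L) ⊗ₘ κ0) :=
  (integrable_comp_fst_compProd κ0 hv.energy0).add hw.energy0.integrable_sq

theorem integrable_norm_sub_sq (hw : IsWeakSolution f J L S κ0 κ)
    (hv : IsLipschitzSolution f J L S R v) :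
    Integrable (fun z : (ℝ × Space d) × State N => ‖z.2 - v z.1‖ ^ 2)
      (spaceTime J L S ⊗ₘ κ) := by
  refine ((integrable_energy hw hv).const_mul 2).mono' ?_ (ae_of_all _ fun z => ?_)
  · have := hv.lipschitz.continuous
    exact (by fun_prop : Continuous fun z : (ℝ × Space d) × State N =>
      ‖z.2 - v z.1‖ ^ 2).aestronglyMeasurable
  · rw [Real.norm_of_nonneg (by positivity)]
    exact IsUniformEntropy.norm_sub_sq_le _ _

theorem integrable_tangent (hη : IsUniformEntropy f η q b c C K)
    (hb : IntegrableOn (fun _ => b) (cell J L)) (hw : IsWeakSolution f J L S κ0 κ)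
    (hv : IsLipschitzSolution f J L S R v) :
    Integrable (fun z : (ℝ × Space d) × State N => tangent η (v z.1) z.2)
      (spaceTime J L S ⊗ₘ κ) := by
  have h1 := integrable_comp_fst_compProd κ (integrable_const_spaceTime (S := S) hb)
  refine ((h1.const_mul 2).add ((integrable_energy hw hv).const_mul (b + 3 * C))).mono' ?_
    (ae_of_all _ fun z => hη.abs_tangent_le _ _)
  have := hv.lipschitz.continuous
  exact (hη.continuous_tangent.comp (by fun_prop :
    Continuous fun z : (ℝ × Space d) × State N => (v z.1, z.2))).aestronglyMeasurable

theorem integrable_tangent_zero (hη : IsUniformEntropy f η q b c C K)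
    (hb : IntegrableOn (fun _ => b) (cell J L)) (hw : IsWeakSolution f J L S κ0 κ)
    (hv : IsLipschitzSolution f J L S R v) :
    Integrable (fun z : Space d × State N => tangent η (v (0, z.1)) z.2)
      (volume.restrict (cell J L) ⊗ₘ κ0) := by
  have h1 := integrable_comp_fst_compProd κ0 hb
  refine ((h1.const_mul 2).add ((integrable_energy_zero hw hv).const_mul (b + 3 * C))).mono' ?_
    (ae_of_all _ fun z => hη.abs_tangent_le _ _)
  have := hv.lipschitz.continuous
  exact (hη.continuous_tangent.comp (by fun_prop :
    Continuous fun z : Space d × State N => (v (0, z.1), z.2))).aestronglyMeasurable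

/-- The quadratic error in the balance of the linearized entropy. -/
noncomputable def tangentDefect (f : Fin d → State N → State N) (η : State N → ℝ)
    (v : ℝ × Space d → State N) (z : ℝ × Space d) (ξ : State N) : ℝ :=
  ∑ m, fderiv ℝ (fderiv ℝ η) (v z) (fderiv ℝ v z (0, EuclideanSpace.single m 1))
    (f m ξ - f m (v z) - fderiv ℝ (f m) (v z) (ξ - v z))

/-- Each of the `d` directions contributes the Hessian bound `C`, the gradient bound `R` of `v` and
the Taylor remainder `K |ξ - v|²` of the flux. This is where the Lipschitz regularity of `v` enters
the Gronwall rate. -/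
theorem abs_tangentDefect_le (hη : IsUniformEntropy f η q b c C K)
    (hv : IsLipschitzSolution f J L S R v) (z : ℝ × Space d) (ξ : State N) :
    |tangentDefect f η v z ξ| ≤ d * C * R * K * ‖ξ - v z‖ ^ 2 := by
  have h1 : ∀ m : Fin d, |fderiv ℝ (fderiv ℝ η) (v z)
      (fderiv ℝ v z (0, EuclideanSpace.single m 1))
      (f m ξ - f m (v z) - fderiv ℝ (f m) (v z) (ξ - v z))| ≤ C * R * (K * ‖ξ - v z‖ ^ 2) := by
    intro m
    have e1 := norm_sub_sub_fderiv_le ((hη.contDiff_flux m).differentiable (by norm_num))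
      hη.K_nonneg (hη.lipschitz_flux m) (v z) ξ
    have e2 : ‖fderiv ℝ v z (0, EuclideanSpace.single m 1)‖ ≤ R := by
      have := (fderiv ℝ v z).le_opNorm (0, EuclideanSpace.single m 1)
      simp only [Prod.norm_def, norm_zero, PiLp.norm_single, norm_one, zero_le_one,
        sup_of_le_right, mul_one] at this
      exact this.trans (norm_fderiv_le_lipschitz hv.lipschitz z)
    refine ((fderiv ℝ (fderiv ℝ η) (v z)).le_opNorm₂ _ _).trans ?_
    have := hη.C_nonneg
    exact mul_le_mul (mul_le_mul (hη.norm_hessian_le _) e2 (norm_nonneg _) this) e1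
      (norm_nonneg _) (by positivity)
  refine (Finset.abs_sum_le_sum_abs _ _).trans ((Finset.sum_le_sum fun m _ => h1 m).trans_eq ?_)
  simp; ring

theorem fderiv_entropy_apply (hη : IsUniformEntropy f η q b c C K) (w : State N) :
    ContDiff ℝ 1 (fun u => fderiv ℝ η u w) ∧
    ∀ u h, fderiv ℝ (fun u => fderiv ℝ η u w) u h = fderiv ℝ (fderiv ℝ η) u h w := by
  refine ⟨hη.contDiff_fderiv.clm_apply contDiff_const, fun u h => ?_⟩
  have := ((hη.contDiff_fderiv.differentiable (by norm_num) u).hasFDerivAt).clm_apply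
    (hasFDerivAt_const w u)
  rw [this.fderiv]
  simp

/-- The part of `tangent` free of `ξ`. The two contributions of `η'` cancel and only the Hessian
survives. -/
theorem fderiv_entropy_sub (hη : IsUniformEntropy f η q b c C K) :
    ContDiff ℝ 1 (fun u => η u - fderiv ℝ η u u) ∧
    ∀ u h, fderiv ℝ (fun u => η u - fderiv ℝ η u u) u h = -fderiv ℝ (fderiv ℝ η) u h u := by
  refine ⟨(hη.contDiff_entropy.of_le (by norm_num)).sub
    (hη.contDiff_fderiv.clm_apply contDiff_id), fun u h => ?_⟩
  have h1 := ((hη.contDiff_fderiv.differentiable (by norm_num) u).hasFDerivAt).clm_apply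
    (hasFDerivAt_id u)
  have h2 := (hη.contDiff_entropy.differentiable (by norm_num) u).hasFDerivAt.sub h1
  have h3 : HasFDerivAt (fun u => η u - fderiv ℝ η u u) _ u := h2
  rw [h3.fderiv]
  simp

/-- The part of `tangentFlux` free of `ξ`. The relation `q' = η' f'` cancels the terms containing
`f'`. -/
theorem fderiv_entropyFlux_sub (hη : IsUniformEntropy f η q b c C K) (m : Fin d) :
    ContDiff ℝ 1 (fun u => q m u - q m 0 - fderiv ℝ η u (f m u)) ∧
    ∀ u h, fderiv ℝ (fun u => q m u - q m 0 - fderiv ℝ η u (f m u)) u h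
      = -fderiv ℝ (fderiv ℝ η) u h (f m u) := by
  have hq : ContDiff ℝ 1 (q m) := by
    rw [contDiff_one_iff_fderiv]
    refine ⟨hη.differentiable m, ?_⟩
    have : fderiv ℝ (q m) = fun u => (fderiv ℝ η u).comp (fderiv ℝ (f m) u) :=
      funext (hη.compat m)
    rw [this]
    exact hη.contDiff_fderiv.continuous.clm_comp ((hη.contDiff_flux m).continuous_fderiv
      (by norm_num))
  refine ⟨(hq.sub contDiff_const).sub
    (hη.contDiff_fderiv.clm_apply ((hη.contDiff_flux m).of_le (by norm_num))), fun u h => ?_⟩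
  have h1 := ((hη.contDiff_fderiv.differentiable (by norm_num) u).hasFDerivAt).clm_apply
    ((hη.contDiff_flux m).differentiable (by norm_num) u).hasFDerivAt
  have h2 := ((hη.differentiable m u).hasFDerivAt.sub_const (q m 0)).sub h1
  have h3 : HasFDerivAt (fun u => q m u - q m 0 - fderiv ℝ η u (f m u)) _ u := h2
  rw [h3.fderiv, hη.compat]
  simp

/-- The balance of the linearized entropy, localized in space. -/
theorem localized_balance (hη : IsUniformEntropy f η q b c C K) (hL : ∀ j ∈ J, 0 < L j)
    (hS : 0 < S) (hw : IsWeakSolution f J L S κ0 κ) (hv : IsLipschitzSolution f J L S R v)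
    (hθ : IsTimeCutoff S θ) {r : ℝ≥0} (hr : 0 < r) :
    Integrable (fun z : (ℝ × Space d) × State N =>
      deriv θ z.1.1 * spaceCutoff J r z.1.2 * tangent η (v z.1) z.2
      + θ z.1.1 * ∑ m, fderiv ℝ (spaceCutoff J r) z.1.2 (EuclideanSpace.single m 1)
          * tangentFlux η (q m) (f m) (v z.1) z.2
      + θ z.1.1 * spaceCutoff J r z.1.2 * tangentDefect f η v z.1 z.2) (spaceTime J L S ⊗ₘ κ) ∧
    ∫ z : (ℝ × Space d) × State N,
      (deriv θ z.1.1 * spaceCutoff J r z.1.2 * tangent η (v z.1) z.2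
      + θ z.1.1 * ∑ m, fderiv ℝ (spaceCutoff J r) z.1.2 (EuclideanSpace.single m 1)
          * tangentFlux η (q m) (f m) (v z.1) z.2
      + θ z.1.1 * spaceCutoff J r z.1.2 * tangentDefect f η v z.1 z.2) ∂(spaceTime J L S ⊗ₘ κ)
    + ∫ z : Space d × State N, θ 0 * spaceCutoff J r z.1 * tangent η (v (0, z.1)) z.2
      ∂(volume.restrict (cell J L) ⊗ₘ κ0) = 0 := by
  -- The linearized entropy and its flux are split into a part linear in `ξ` and `f(ξ)`, treated by
  -- the weak equation with the test functions `Φ a`, and parts `P0`, `P m` depending on space-time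
  -- only, treated by the divergence theorem.
  obtain ⟨Φ, hΦd⟩ : ∃ Φ : Fin N → ℝ × Space d → ℝ, ∀ a, Φ a = fun z =>
    θ z.1 * spaceCutoff J r z.2 * fderiv ℝ η (v z) (EuclideanSpace.single a 1) :=
    ⟨_, fun _ => rfl⟩
  obtain ⟨P0, hP0d⟩ : ∃ P0 : ℝ × Space d → ℝ, P0 = fun z =>
    θ z.1 * spaceCutoff J r z.2 * (η (v z) - fderiv ℝ η (v z) (v z)) := ⟨_, rfl⟩
  obtain ⟨P, hPd⟩ : ∃ P : Fin d → ℝ × Space d → ℝ, ∀ m, P m = fun z =>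
    θ z.1 * spaceCutoff J r z.2 * (q m (v z) - q m 0 - fderiv ℝ η (v z) (f m (v z))) :=
    ⟨_, fun _ => rfl⟩
  have hΦ : ∀ a, (∃ M : ℝ≥0, LipschitzWith M (Φ a)) ∧ IsAdmissible J L S (Φ a) := fun a => by
    rw [hΦd]
    exact isAdmissible_cutoff_mul hv hθ hr
      (fderiv_entropy_apply hη (EuclideanSpace.single a 1)).1
  have hP0 : (∃ M : ℝ≥0, LipschitzWith M P0) ∧ IsAdmissible J L S P0 := by
    rw [hP0d]
    exact isAdmissible_cutoff_mul hv hθ hr (fderiv_entropy_sub hη).1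
  have hP : ∀ m, (∃ M : ℝ≥0, LipschitzWith M (P m)) ∧ IsAdmissible J L S (P m) := fun m => by
    rw [hPd]
    exact isAdmissible_cutoff_mul hv hθ hr (fderiv_entropyFlux_sub hη m).1
  obtain ⟨Kf, hKf⟩ := hη.exists_flux_growth
  have hfc : ∀ m, Continuous (f m) := fun m => (hη.contDiff_flux m).continuous
  choose MΦ hMΦ using fun a => (hΦ a).1
  obtain ⟨M0, hM0⟩ := hP0.1
  choose MP hMP using fun m => (hP m).1
  have E1 := fun a => hw.equation_lipschitz hfc hKf a (hMΦ a) (hΦ a).2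
  have E2 := integral_fderiv_time hS hM0 hP0.2
  have E3 := fun m => integral_fderiv_space_eq_zero hL (hMP m) (hP m).2 m
  have I2 := IsAdmissible.integrable_fderiv hM0 hP0.2 (1, 0)
  have I3 := fun m => IsAdmissible.integrable_fderiv (hMP m) (hP m).2
    (0, EuclideanSpace.single m 1)
  have I2' := integrable_comp_fst_compProd κ I2
  have I3' := fun m => integrable_comp_fst_compProd κ (I3 m)
  have I20 := hP0.2.integrableOn_cell hM0.continuous 0
  have I20' := integrable_comp_fst_compProd κ0 I20
  have hsum := (integrable_finsetSum Finset.univ (fun a _ => (E1 a).1))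
  have hsum3 := (integrable_finsetSum Finset.univ (fun m _ => I3' m))
  have hsum0 := (integrable_finsetSum Finset.univ (fun a _ => (E1 a).2.1))
  have hae : ∀ᵐ z ∂(spaceTime J L S ⊗ₘ κ),
      ((∑ a, fluxPairing f a (fderiv ℝ (Φ a) z.1) z.2) + fderiv ℝ P0 z.1 (1, 0))
        + ∑ m, fderiv ℝ (P m) z.1 (0, EuclideanSpace.single m 1)
      = deriv θ z.1.1 * spaceCutoff J r z.1.2 * tangent η (v z.1) z.2
      + θ z.1.1 * ∑ m, fderiv ℝ (spaceCutoff J r) z.1.2 (EuclideanSpace.single m 1)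
          * tangentFlux η (q m) (f m) (v z.1) z.2
      + θ z.1.1 * spaceCutoff J r z.1.2 * tangentDefect f η v z.1 z.2 := by
    filter_upwards [ae_compProd_of_ae κ (ae_fderiv_cutoff_mul hv hθ (r := r)),
      ae_compProd_of_ae κ hv.equation] with z hz heq
    have e0 := hz _ (fderiv_entropy_sub hη).1 (1, 0)
    rw [← hP0d] at e0
    have em := fun m => hz _ (fderiv_entropyFlux_sub hη m).1 (0, EuclideanSpace.single m 1)
    simp only [← hPd] at em
    rw [sum_fluxPairing f (fun a => fderiv ℝ (Φ a) z.1) z.2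
      (fun w => deriv θ z.1.1 * w.1 * spaceCutoff J r z.1.2
            + θ z.1.1 * fderiv ℝ (spaceCutoff J r) z.1.2 w.2)
      (θ z.1.1 * spaceCutoff J r z.1.2) (fderiv ℝ η (v z.1))
      (fun w => fderiv ℝ (fderiv ℝ η) (v z.1) (fderiv ℝ v z.1 w))
      (fun a w => by
        rw [← (fderiv_entropy_apply hη (EuclideanSpace.single a 1)).2, hΦd]
        exact hz _ (fderiv_entropy_apply hη (EuclideanSpace.single a 1)).1 w)]
    -- The cancellation at the heart of the method: `∂_t v` is replaced through the equation, and
    -- the symmetry of `η'' f'` moves `f'(v)` onto `ξ - v`, where it removes the linear part of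
    -- `f(ξ) - f(v)`.
    have hD : tangentDefect f η v z.1 z.2
        = fderiv ℝ (fderiv ℝ η) (v z.1) (fderiv ℝ v z.1 (1, 0)) (z.2 - v z.1)
          + ∑ m, fderiv ℝ (fderiv ℝ η) (v z.1)
              (fderiv ℝ v z.1 (0, EuclideanSpace.single m 1)) (f m z.2 - f m (v z.1)) := by
      rw [eq_neg_of_add_eq_zero_left heq, tangentDefect, map_neg, map_sum, neg_apply,
        sum_apply, ← Finset.sum_neg_distrib, ← Finset.sum_add_distrib]
      refine Finset.sum_congr rfl fun m _ => ?_
      rw [map_sub _ (f m z.2 - f m (v z.1)), hessian_symm hη.contDiff_entropy (v z.1)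
        (fderiv ℝ (f m) (v z.1) _),
        hessian_comp_symm hη.contDiff_entropy (hη.contDiff_flux m) (hη.differentiable m)
        (hη.compat m)]
      ring
    rw [add_right_comm _ (∑ m, _) (fderiv ℝ P0 z.1 (1, 0)), add_assoc _ (∑ m, _) (∑ m, _),
      ← Finset.sum_add_distrib, hD, mul_add, ← add_assoc, add_right_comm _ (_ * ∑ m, _) (_ * _),
      add_assoc _ (_ * ∑ m, _) (_ * ∑ m, _), Finset.mul_sum, Finset.mul_sum,
      ← Finset.sum_add_distrib, e0]
    congr 1
    · simp only [(fderiv_entropy_sub hη).2, tangent, map_sub]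
      simp; ring
    · refine Finset.sum_congr rfl fun m _ => ?_
      rw [em]
      simp only [(fderiv_entropyFlux_sub hη _).2, tangentFlux, map_sub]
      simp; ring
  have hint := (hsum.add I2').add hsum3
  refine ⟨hint.congr hae, ?_⟩
  rw [← integral_congr_ae hae]
  have h0 : ∀ z : Space d × State N, θ 0 * spaceCutoff J r z.1 * tangent η (v (0, z.1)) z.2
      = (∑ a, z.2 a * Φ a (0, z.1)) + P0 (0, z.1) := by
    intro z
    have := sum_apply_mul_single (fderiv ℝ η (v (0, z.1))) z.2
    simp only [hΦd, hP0d, tangent, map_sub]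
    have h1 : ∑ a, z.2 a * (θ 0 * spaceCutoff J r z.1
        * fderiv ℝ η (v (0, z.1)) (EuclideanSpace.single a 1))
        = θ 0 * spaceCutoff J r z.1 * fderiv ℝ η (v (0, z.1)) z.2 := by
      rw [← this, Finset.mul_sum]
      exact Finset.sum_congr rfl fun a _ => by ring
    rw [h1]
    ring
  have h3 : ∫ z, ∑ m, fderiv ℝ (P m) z.1 (0, EuclideanSpace.single m 1)
      ∂(spaceTime J L S ⊗ₘ κ) = 0 := by
    rw [integral_finsetSum _ (fun m _ => I3' m)]
    refine Finset.sum_eq_zero fun m _ => ?_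
    rw [integral_comp_fst_compProd κ (I3 m).aestronglyMeasurable, E3 m]
  simp only [h0]
  rw [integral_add (f := fun z => _ + _) (hsum.add I2') hsum3, integral_add hsum I2', integral_finsetSum _
    (fun a _ => (E1 a).1), h3, integral_add hsum0 I20',
    integral_finsetSum _ (fun a _ => (E1 a).2.1),
    integral_comp_fst_compProd κ I2.aestronglyMeasurable, E2,
    integral_comp_fst_compProd κ0 I20.aestronglyMeasurable]
  have := Finset.sum_congr rfl (fun a (_ : a ∈ Finset.univ) => (E1 a).2.2)
  rw [Finset.sum_add_distrib, Finset.sum_const_zero] at this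
  linarith

theorem spaceCutoff_tendsto (x : Space d) :
    Tendsto (fun n : ℕ => spaceCutoff J ((n : ℝ≥0) + 1 : ℝ≥0) x) atTop (𝓝 1) := by
  refine tendsto_const_nhds.congr' ?_
  obtain ⟨n0, hn0⟩ := exists_nat_ge ‖x‖
  filter_upwards [eventually_ge_atTop n0] with n hn
  have : (n0 : ℝ) ≤ n := by exact_mod_cast hn
  refine (spaceCutoff_eq_one ?_ ?_).symm
  · positivity
  · push_cast; linarith

theorem abs_fderiv_spaceCutoff_le {r : ℝ≥0} (x : Space d) (m : Fin d) :
    |fderiv ℝ (spaceCutoff J r) x (EuclideanSpace.single m 1)| ≤ (r⁻¹ : ℝ≥0) := by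
  have := (fderiv ℝ (spaceCutoff J r) x).le_opNorm (EuclideanSpace.single m 1)
  simp only [PiLp.norm_single, norm_one, mul_one] at this
  exact this.trans (norm_fderiv_le_lipschitz (lipschitzWith_spaceCutoff J) x)

theorem abs_spaceCutoff_le (r : ℝ) (x : Space d) : |spaceCutoff J r x| ≤ 1 := by
  have := spaceCutoff_mem_Icc J r x
  rw [abs_of_nonneg this.1]
  exact this.2

/-- The linearized entropy is balanced up to a quadratic error. -/
theorem tangent_balance (hη : IsUniformEntropy f η q b c C K)
    (hb : IntegrableOn (fun _ => b) (cell J L)) (hL : ∀ j ∈ J, 0 < L j)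
    (hS : 0 < S) (hw : IsWeakSolution f J L S κ0 κ) (hv : IsLipschitzSolution f J L S R v)
    (hθ : IsTimeCutoff S θ) :
    |∫ z, deriv θ z.1.1 * tangent η (v z.1) z.2 ∂(spaceTime J L S ⊗ₘ κ)
      + θ 0 * ∫ z, tangent η (v (0, z.1)) z.2 ∂(volume.restrict (cell J L) ⊗ₘ κ0)|
      ≤ d * C * R * K * ∫ z, θ z.1.1 * ‖z.2 - v z.1‖ ^ 2 ∂(spaceTime J L S ⊗ₘ κ) := by
  obtain ⟨-, B, hB⟩ := hθ.exists_lipschitzWith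
  have hB0 : 0 ≤ B := (abs_nonneg _).trans (hB 0)
  obtain ⟨B', hB'⟩ : ∃ B', ∀ t, |deriv θ t| ≤ B' :=
    hθ.compact.deriv.exists_bound_of_continuous (hθ.smooth.continuous_deriv (by simp))
  have hB'0 : 0 ≤ B' := (abs_nonneg _).trans (hB' 0)
  obtain ⟨A, hA0, hA⟩ := hη.exists_tangentFlux_le R.2
  set Q : ℝ := d * C * R * K with hQ
  have hQ0 : 0 ≤ Q := by
    have := hη.C_nonneg; have := hη.K_nonneg; positivity
  let Y : (ℝ × Space d) × State N → ℝ := fun z => ‖v z.1‖ ^ 2 + ‖z.2‖ ^ 2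
  have hY : Integrable Y (spaceTime J L S ⊗ₘ κ) := integrable_energy hw hv
  have hY0 : ∀ z, 0 ≤ Y z := fun z => by positivity
  have hbΓ := integrable_comp_fst_compProd κ (integrable_const_spaceTime (S := S) hb)
  have hbal := fun n : ℕ => localized_balance hη hL hS hw hv hθ (r := (n : ℝ≥0) + 1)
    (by positivity)
  -- At scale `n + 1` the cutoff has gradient at most `1 / (n + 1)` and equals one on any fixed
  -- bounded set eventually, so the spatial flux term disappears in the limit.
  have hptw : ∀ z : (ℝ × Space d) × State N, Tendsto (fun n : ℕ =>
      deriv θ z.1.1 * spaceCutoff J ((n : ℝ≥0) + 1 : ℝ≥0) z.1.2 * tangent η (v z.1) z.2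
      + θ z.1.1 * ∑ m, fderiv ℝ (spaceCutoff J ((n : ℝ≥0) + 1 : ℝ≥0)) z.1.2
          (EuclideanSpace.single m 1) * tangentFlux η (q m) (f m) (v z.1) z.2
      + θ z.1.1 * spaceCutoff J ((n : ℝ≥0) + 1 : ℝ≥0) z.1.2 * tangentDefect f η v z.1 z.2) atTop
      (𝓝 (deriv θ z.1.1 * tangent η (v z.1) z.2 + θ z.1.1 * tangentDefect f η v z.1 z.2)) := by
    intro z
    have h1 := spaceCutoff_tendsto (J := J) z.1.2
    have h2 : ∀ m : Fin d, Tendsto (fun n : ℕ => fderiv ℝ (spaceCutoff J ((n : ℝ≥0) + 1 : ℝ≥0))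
        z.1.2 (EuclideanSpace.single m 1)) atTop (𝓝 0) := fun m => by
      refine squeeze_zero_norm (fun n => abs_fderiv_spaceCutoff_le z.1.2 m) ?_
      simpa [one_div] using tendsto_one_div_add_atTop_nhds_zero_nat (𝕜 := ℝ)
    have h3 := ((h1.const_mul (deriv θ z.1.1)).mul_const (tangent η (v z.1) z.2)).add
      ((tendsto_finsetSum Finset.univ fun m _ =>
        (h2 m).mul_const (tangentFlux η (q m) (f m) (v z.1) z.2)).const_mul (θ z.1.1))
    have h4 := h3.add ((h1.const_mul (θ z.1.1)).mul_const (tangentDefect f η v z.1 z.2))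
    simpa using h4
  -- The majorant combines only `b` and `|v|² + |ξ|²`, which are integrable over all of `[0, S] × D`
  -- even when `D` has infinite measure.
  have hlim1 := tendsto_integral_of_dominated_convergence
    (f := fun z : (ℝ × Space d) × State N => deriv θ z.1.1 * tangent η (v z.1) z.2
      + θ z.1.1 * tangentDefect f η v z.1 z.2)
    (fun z => B' * (2 * b + (b + 3 * C) * Y z) + B * (d * (A * b + A * Y z))
      + B * (Q * (2 * Y z)))
    (fun n => (hbal n).1.aestronglyMeasurable)
    (((((hbΓ.const_mul 2).add (hY.const_mul (b + 3 * C))).const_mul B').add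
      ((((hbΓ.const_mul A).add (hY.const_mul A)).const_mul d).const_mul B)).add
      (((hY.const_mul 2).const_mul Q).const_mul B))
    (fun n => ae_of_all _ fun z => ?_) (ae_of_all _ hptw)
  rotate_left
  · have hχ := abs_spaceCutoff_le (J := J) ((n : ℝ≥0) + 1 : ℝ≥0) z.1.2
    rw [Real.norm_eq_abs]
    refine (abs_add_three _ _ _).trans (add_le_add_three ?_ ?_ ?_)
    · rw [abs_mul, abs_mul]
      refine mul_le_mul ?_ (hη.abs_tangent_le _ _) (abs_nonneg _) hB'0
      simpa using mul_le_mul (hB' z.1.1) hχ (abs_nonneg _) hB'0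
    · rw [abs_mul]
      refine mul_le_mul (hB z.1.1) ?_ (abs_nonneg _) hB0
      refine (Finset.abs_sum_le_sum_abs _ _).trans ((Finset.sum_le_sum (g := fun _ =>
        A * b + A * Y z) fun m _ => ?_).trans_eq (by simp; ring))
      rw [abs_mul]
      have h1 : |fderiv ℝ (spaceCutoff J ((n : ℝ≥0) + 1 : ℝ≥0)) z.1.2
          (EuclideanSpace.single m 1)| ≤ 1 := by
        refine (abs_fderiv_spaceCutoff_le z.1.2 m).trans ?_
        exact_mod_cast inv_le_one_of_one_le₀ (by simp)
      have h2 := hA m (v z.1) z.2 (hv.bounded z.1)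
      simpa using mul_le_mul h1 h2 (abs_nonneg _) zero_le_one
    · rw [abs_mul, abs_mul]
      refine mul_le_mul (by simpa using mul_le_mul (hB z.1.1) hχ (abs_nonneg _) hB0)
        ((abs_tangentDefect_le hη hv _ _).trans ?_) (abs_nonneg _) hB0
      exact mul_le_mul_of_nonneg_left (IsUniformEntropy.norm_sub_sq_le _ _) hQ0
  have hlim2 := tendsto_integral_of_dominated_convergence
    (μ := volume.restrict (cell J L) ⊗ₘ κ0)
    (F := fun (n : ℕ) z => θ 0 * spaceCutoff J ((n : ℝ≥0) + 1 : ℝ≥0) z.1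
      * tangent η (v (0, z.1)) z.2)
    (f := fun z : Space d × State N => θ 0 * tangent η (v (0, z.1)) z.2)
    (fun z => B * ‖tangent η (v (0, z.1)) z.2‖) (fun n => ?_)
    ((integrable_tangent_zero hη hb hw hv).norm.const_mul B)
    (fun n => ae_of_all _ fun z => ?_) (ae_of_all _ fun z => ?_)
  rotate_left
  · refine AEStronglyMeasurable.mul ?_ (integrable_tangent_zero hη hb hw hv).aestronglyMeasurable
    have := (lipschitzWith_spaceCutoff J (r := (n : ℝ≥0) + 1)).continuous
    exact (by fun_prop : Continuous fun z : Space d × State N =>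
      θ 0 * spaceCutoff J ((n : ℝ≥0) + 1 : ℝ≥0) z.1).aestronglyMeasurable
  · have hχ := abs_spaceCutoff_le (J := J) ((n : ℝ≥0) + 1 : ℝ≥0) z.1
    rw [norm_mul]
    refine mul_le_mul_of_nonneg_right ?_ (norm_nonneg _)
    rw [Real.norm_eq_abs, abs_mul]
    simpa using mul_le_mul (hB 0) hχ (abs_nonneg _) hB0
  · have h1 := spaceCutoff_tendsto (J := J) z.1
    simpa using (h1.const_mul (θ 0)).mul_const (tangent η (v (0, z.1)) z.2)
  have hzero := tendsto_nhds_unique (hlim1.add hlim2)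
    (tendsto_const_nhds.congr fun n => ((hbal n).2).symm)
  have hmeasθ' : AEStronglyMeasurable (fun z : (ℝ × Space d) × State N => deriv θ z.1.1)
      (spaceTime J L S ⊗ₘ κ) := by
    have := hθ.smooth.continuous_deriv (by simp)
    exact (by fun_prop : Continuous fun z : (ℝ × Space d) × State N =>
      deriv θ z.1.1).aestronglyMeasurable
  have hmeasθ : AEStronglyMeasurable (fun z : (ℝ × Space d) × State N => θ z.1.1)
      (spaceTime J L S ⊗ₘ κ) := by
    have := hθ.smooth.continuous
    exact (by fun_prop : Continuous fun z : (ℝ × Space d) × State N =>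
      θ z.1.1).aestronglyMeasurable
  have hI1 : Integrable (fun z : (ℝ × Space d) × State N =>
      deriv θ z.1.1 * tangent η (v z.1) z.2) (spaceTime J L S ⊗ₘ κ) :=
    (integrable_tangent hη hb hw hv).bdd_mul hmeasθ' (ae_of_all _ fun z => hB' z.1.1)
  have hI2 : Integrable (fun z : (ℝ × Space d) × State N =>
      θ z.1.1 * ‖z.2 - v z.1‖ ^ 2) (spaceTime J L S ⊗ₘ κ) :=
    (integrable_norm_sub_sq hw hv).bdd_mul hmeasθ (ae_of_all _ fun z => hB z.1.1)
  have hle : ‖∫ z : (ℝ × Space d) × State N, θ z.1.1 * tangentDefect f η v z.1 z.2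
      ∂(spaceTime J L S ⊗ₘ κ)‖ ≤ ∫ z : (ℝ × Space d) × State N,
        Q * (θ z.1.1 * ‖z.2 - v z.1‖ ^ 2) ∂(spaceTime J L S ⊗ₘ κ) := by
    refine norm_integral_le_of_norm_le (hI2.const_mul Q) (ae_of_all _ fun z => ?_)
    rw [norm_mul, Real.norm_of_nonneg (hθ.nonneg _), mul_left_comm]
    exact mul_le_mul_of_nonneg_left (abs_tangentDefect_le hη hv _ _) (hθ.nonneg _)
  have hI4 : Integrable (fun z : (ℝ × Space d) × State N => θ z.1.1 * tangentDefect f η v z.1 z.2)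
      (spaceTime J L S ⊗ₘ κ) := by
    -- Measurability of the defect is inherited from the localized integrands, of whose limit it is
    -- a summand.
    have hm := aestronglyMeasurable_of_tendsto_ae atTop
      (fun n => (hbal n).1.aestronglyMeasurable) (ae_of_all _ hptw)
    refine (hI2.const_mul Q).mono' ((hm.sub hI1.aestronglyMeasurable).congr
      (ae_of_all _ fun z => by simp)) (ae_of_all _ fun z => ?_)
    rw [norm_mul, Real.norm_of_nonneg (hθ.nonneg _), mul_left_comm]
    exact mul_le_mul_of_nonneg_left (abs_tangentDefect_le hη hv _ _) (hθ.nonneg _)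
  rw [integral_add hI1 hI4, integral_const_mul (θ 0)] at hzero
  rw [integral_const_mul] at hle
  refine le_trans (le_of_eq ?_) hle
  rw [← norm_neg, ← Real.norm_eq_abs]
  congr 1
  linarith

end Balance

end StatSol

namespace StatSol

/-! ### A Gronwall inequality in the sense of distributions -/

/-- A function whose distributional derivative on `[0, S)`, with initial value `E0`, is nonpositive
is tested against a probability density. -/
theorem integral_mul_le_of_cutoff {S E0 : ℝ} {F : ℝ → ℝ}
    (h : ∀ ζ, IsTimeCutoff S ζ → 0 ≤ (∫ t in Icc 0 S, F t * deriv ζ t) + E0 * ζ 0)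
    {φ : ℝ → ℝ} (hφ : ContDiff ℝ ∞ φ) (hφ0 : ∀ t, 0 ≤ φ t) {a b : ℝ} (ha : 0 < a) (hab : a ≤ b)
    (hb : b < S) (hsupp : ∀ t, t ∉ Icc a b → φ t = 0) (hint : ∫ t in a..b, φ t = 1) :
    ∫ t in Icc 0 S, F t * φ t ≤ E0 := by
  -- This function falls from 1 to 0 across `[a, b]` with `ζ' = -φ`; testing with it produces the
  -- average of `F` against `φ`.
  let ζ : ℝ → ℝ := fun t => 1 - ∫ s in a..t, φ s
  have hii : ∀ x y, IntervalIntegrable φ volume x y :=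
    fun x y => hφ.continuous.intervalIntegrable x y
  have hζd : ∀ t, HasDerivAt ζ (-φ t) t := fun t => by
    have := (intervalIntegral.integral_hasDerivAt_right (hii a t)
      (hφ.continuous.stronglyMeasurableAtFilter _ _) hφ.continuous.continuousAt).const_sub 1
    exact this
  have hζd' : deriv ζ = fun t => -φ t := funext fun t => (hζd t).deriv
  have hζs : ContDiff ℝ ∞ ζ :=
    contDiff_infty_iff_deriv.2 ⟨fun t => (hζd t).differentiableAt, by rw [hζd']; exact hφ.neg⟩
  have hζa : ∀ t ≤ a, ζ t = 1 := fun t ht => by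
    have : ∫ s in a..t, φ s = ∫ s in a..t, (0 : ℝ) := by
      refine intervalIntegral.integral_congr_ae ?_
      have hne : ∀ᵐ s : ℝ, s ≠ a := by simp [ae_iff]
      filter_upwards [hne] with s hs hs'
      rw [uIoc_of_ge ht] at hs'
      exact hsupp s fun hc => hs (le_antisymm hs'.2 hc.1)
    simp [ζ, this]
  have hζb : ∀ t, b ≤ t → ζ t = 0 := fun t ht => by
    have : ∫ s in b..t, φ s = ∫ s in b..t, (0 : ℝ) := by
      refine intervalIntegral.integral_congr_ae (ae_of_all _ fun s hs => ?_)
      rw [uIoc_of_le ht] at hs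
      exact hsupp s fun hc => hs.1.not_ge hc.2
    simp only [ζ]
    rw [← intervalIntegral.integral_add_adjacent_intervals (hii a b) (hii b t), hint, this]
    simp
  have hζ0 : ∀ t, 0 ≤ ζ t := fun t => by
    have hanti : Antitone ζ := antitone_of_deriv_nonpos (hζs.differentiable (by simp))
      (fun t => by rw [hζd']; simpa using hφ0 t)
    rcases le_total b t with hbt | hbt
    · exact (hζb t hbt).ge
    · exact (hζb b le_rfl).ge.trans (hanti hbt)
  -- Since `ζ` equals 1 for all negative times, it is multiplied by a bump to obtain compact
  -- support; the bump is 1 on `[-1, S]` and changes nothing there.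
  let χ : ContDiffBump (0 : ℝ) := ⟨|S| + 1, |S| + 2, by positivity, by linarith⟩
  have hχ1 : ∀ t ∈ Icc (-1 : ℝ) S, χ t = 1 := fun t ht => by
    refine χ.one_of_mem_closedBall ?_
    rw [mem_closedBall_zero_iff, Real.norm_eq_abs, abs_le]
    exact ⟨by linarith [ht.1, abs_nonneg S], ht.2.trans ((le_abs_self S).trans (by simp [χ]))⟩
  have hcut : IsTimeCutoff S fun t => χ t * ζ t := by
    refine ⟨χ.contDiff.mul hζs, χ.hasCompactSupport.mul_right,
      fun t => mul_nonneg χ.nonneg (hζ0 t), b, hb, fun t ht => ?_⟩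
    by_contra hc
    exact ht (by rw [hζb t (not_le.1 hc).le, mul_zero])
  have h1 := h _ hcut
  have h00 : χ 0 * ζ 0 = 1 := by
    rw [hχ1 0 ⟨by norm_num, by linarith⟩, hζa 0 ha.le, mul_one]
  have h2 : ∫ t in Icc 0 S, F t * deriv (fun t => χ t * ζ t) t
      = ∫ t in Icc 0 S, -(F t * φ t) := by
    rw [integral_Icc_eq_integral_Ioo, integral_Icc_eq_integral_Ioo]
    refine setIntegral_congr_fun measurableSet_Ioo fun t ht => ?_
    have : (fun t => χ t * ζ t) =ᶠ[𝓝 t] ζ := by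
      filter_upwards [Ioo_mem_nhds ht.1 ht.2] with s hs
      rw [hχ1 s ⟨by linarith [hs.1], hs.2.le⟩, one_mul]
    simp only [this.deriv_eq, hζd', mul_neg]
  rw [h2, integral_neg, h00] at h1
  linarith

/-- Averages of `F` against mollifiers centred at `t` are at most `E0`, and they converge to `F t`
at Lebesgue points. The bump must eventually fit inside `(0, S)`, so the endpoints are discarded. -/
theorem ae_le_of_cutoff {S E0 : ℝ} {F : ℝ → ℝ} (hF : IntegrableOn F (Icc 0 S))
    (h : ∀ ζ, IsTimeCutoff S ζ → 0 ≤ (∫ t in Icc 0 S, F t * deriv ζ t) + E0 * ζ 0) :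
    ∀ᵐ t ∂(volume.restrict (Icc 0 S)), F t ≤ E0 := by
  let φ : ℕ → ContDiffBump (0 : ℝ) := fun n =>
    ⟨1 / (n + 1 : ℝ) / 2, 1 / (n + 1 : ℝ), by positivity, half_lt_self (by positivity)⟩
  have hout : Tendsto (fun n => (φ n).rOut) atTop (𝓝 0) := tendsto_one_div_add_atTop_nhds_zero_nat
  have hg : LocallyIntegrable ((Icc 0 S).indicator F) volume :=
    ((integrable_indicator_iff measurableSet_Icc).2 hF).locallyIntegrable
  have hae := ContDiffBump.ae_convolution_tendsto_right_of_locallyIntegrable (K := 2) hout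
    (Eventually.of_forall fun n => by simp only [φ]; linarith) hg
  have hends : ∀ᵐ t : ℝ, t ≠ 0 ∧ t ≠ S := by
    have h1 : ∀ᵐ t : ℝ, t ≠ 0 := by simp [ae_iff]
    have h2 : ∀ᵐ t : ℝ, t ≠ S := by simp [ae_iff]
    filter_upwards [h1, h2] with t ha hb using ⟨ha, hb⟩
  rw [ae_restrict_iff' measurableSet_Icc]
  filter_upwards [hae, hends] with t ht hne htS
  have ht0 : 0 < t := lt_of_le_of_ne htS.1 (Ne.symm hne.1)
  have htS' : t < S := lt_of_le_of_ne htS.2 hne.2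
  rw [indicator_of_mem htS] at ht
  refine le_of_tendsto ht ?_
  have hev : ∀ᶠ n in atTop, (φ n).rOut < min t (S - t) :=
    hout.eventually_lt_const (lt_min ht0 (sub_pos.2 htS'))
  filter_upwards [hev] with n hn
  have hn1 := hn.trans_le (min_le_left _ _)
  have hn2 := hn.trans_le (min_le_right _ _)
  have hr0 := (φ n).rOut_pos
  have hsupp : ∀ s, s ∉ Icc (t - (φ n).rOut) (t + (φ n).rOut) → (φ n).normed volume (t - s) = 0 := by
    intro s hs
    rw [← Function.notMem_support, (φ n).support_normed_eq, Metric.mem_ball, dist_zero_right,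
      Real.norm_eq_abs, abs_lt]
    exact fun hc => hs ⟨by linarith [hc.2], by linarith [hc.1]⟩
  have hint1 : ∫ s, (φ n).normed volume (t - s) = 1 := by
    rw [integral_sub_left_eq_self (fun s => (φ n).normed volume s) volume t]
    exact (φ n).integral_normed
  have key := integral_mul_le_of_cutoff h (φ := fun s => (φ n).normed volume (t - s))
    ((φ n).contDiff_normed.comp (contDiff_const.sub contDiff_id))
    (fun s => (φ n).nonneg_normed _) (a := t - (φ n).rOut) (b := t + (φ n).rOut)
    (by linarith) (by linarith) (by linarith) hsupp (by
      rw [intervalIntegral.integral_of_le (by linarith), ← integral_Icc_eq_integral_Ioc,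
        setIntegral_eq_integral_of_forall_compl_eq_zero hsupp, hint1])
  rw [convolution_lsmul_swap]
  refine le_trans (le_of_eq ?_) key
  rw [← integral_indicator measurableSet_Icc]
  refine integral_congr_ae (ae_of_all _ fun s => ?_)
  by_cases hs : s ∈ Icc 0 S
  · simp [indicator_of_mem hs, mul_comm]
  · simp [indicator_of_notMem hs]

/-- Integrating factor: with the test function `exp(-k t) ζ(t)` the zeroth-order term cancels, and
`exp(-k t) E(t)` is nonincreasing from `E0` in the sense of the preceding lemma. No sign of `E` is
needed. -/
theorem ae_le_exp_mul_of_cutoff {S E0 k : ℝ} {E : ℝ → ℝ} (hE : IntegrableOn E (Icc 0 S))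
    (h : ∀ θ, IsTimeCutoff S θ →
      0 ≤ (∫ t in Icc 0 S, E t * deriv θ t) + E0 * θ 0 + k * ∫ t in Icc 0 S, θ t * E t) :
    ∀ᵐ t ∂(volume.restrict (Icc 0 S)), E t ≤ Real.exp (k * t) * E0 := by
  have hexp : Continuous fun t : ℝ => Real.exp (-(k * t)) := by fun_prop
  have hbd : ∀ g : ℝ → ℝ, Continuous g → IntegrableOn (fun t => E t * g t) (Icc 0 S) :=
    fun g hg => hE.mul_continuousOn hg.continuousOn isCompact_Icc
  have key := ae_le_of_cutoff (S := S) (E0 := E0) (F := fun t => E t * Real.exp (-(k * t)))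
    (hbd _ hexp) fun ζ hζ => ?_
  · filter_upwards [key] with t ht
    have h1 := mul_le_mul_of_nonneg_left ht (Real.exp_pos (k * t)).le
    rwa [mul_left_comm, ← Real.exp_add, add_neg_cancel, Real.exp_zero, mul_one] at h1
  · have hcut : IsTimeCutoff S fun t => Real.exp (-(k * t)) * ζ t := by
      obtain ⟨T', hT', h'⟩ := hζ.support
      refine ⟨?_, hζ.compact.mul_left, fun t => mul_nonneg (Real.exp_pos _).le (hζ.nonneg t), T',
        hT', fun t ht => h' t (right_ne_zero_of_mul ht)⟩
      have h1 : ContDiff ℝ ∞ fun t : ℝ => Real.exp (-(k * t)) := by fun_prop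
      exact h1.mul hζ.smooth
    have hd : ∀ t, deriv (fun t => Real.exp (-(k * t)) * ζ t) t
        = Real.exp (-(k * t)) * deriv ζ t - k * (Real.exp (-(k * t)) * ζ t) := fun t => by
      have h1 : HasDerivAt (fun t => Real.exp (-(k * t))) (Real.exp (-(k * t)) * (-(k * 1))) t :=
        (((hasDerivAt_id t).const_mul k).neg).exp
      have h2 : HasDerivAt (fun t => Real.exp (-(k * t)) * ζ t) _ t :=
        h1.mul (hζ.smooth.differentiable (by simp) t).hasDerivAt
      rw [h2.deriv]; ring
    have h1 := h _ hcut
    have hc1 : Continuous ζ := hζ.smooth.continuous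
    have hc2 : Continuous (deriv ζ) := hζ.smooth.continuous_deriv (by simp)
    have e1 : ∫ t in Icc 0 S, E t * deriv (fun t => Real.exp (-(k * t)) * ζ t) t
        = (∫ t in Icc 0 S, E t * Real.exp (-(k * t)) * deriv ζ t)
          - k * ∫ t in Icc 0 S, Real.exp (-(k * t)) * ζ t * E t := by
      rw [← integral_const_mul, ← integral_sub]
      · refine integral_congr_ae (ae_of_all _ fun t => ?_)
        simp only [hd]; ring
      · have := hbd _ (hexp.mul hc2)
        simpa only [IntegrableOn, Pi.mul_apply, mul_assoc] using this
      · refine Integrable.const_mul ?_ k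
        have := hbd _ (hexp.mul hc1)
        simpa only [IntegrableOn, Pi.mul_apply, mul_comm] using this
    rw [e1] at h1
    simp only [mul_zero, neg_zero, Real.exp_zero, one_mul] at h1
    linarith

end StatSol

namespace StatSol

/-! ### Relative entropy of a statistical solution and a Lipschitz solution -/

section Relative

variable {d N : ℕ} {f : Fin d → State N → State N} {η : State N → ℝ} {q : Fin d → State N → ℝ}
  {b c C K : ℝ} {J : Finset (Fin d)} {L : Fin d → ℝ} {S : ℝ} {R : ℝ≥0}
  {v : ℝ × Space d → State N}

instance instSeparableSpaceL2 (D : Set (Space d)) (N : ℕ) :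
    TopologicalSpace.SeparableSpace (L2 D N) := by
  have : Fact ((2 : ℝ≥0∞) ≠ ⊤) := ⟨by norm_num⟩
  infer_instance

/-- The mean squared distance to the function `w`. -/
noncomputable def meanSqDist {D : Set (Space d)} (γ : Measure (L2 D N)) (w : L2 D N) : ℝ :=
  (∫⁻ u, edist u w ^ 2 ∂γ).toReal

theorem integral_norm_sub_sq_jointLaw {D : Set (Space d)} {ev : L2 D N × Space d → State N}
    (hev : Measurable ev) (hev' : ∀ u : L2 D N, ∀ᵐ x ∂volume.restrict D, ev (u, x) = u x)
    (γ : Measure (L2 D N)) [SFinite γ] {w : L2 D N} {v : Space d → State N} (hv : Continuous v)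
    (hw : w =ᵐ[volume.restrict D] v) :
    ∫ z, ‖z.2 - v z.1‖ ^ 2 ∂(jointLaw ev γ) = meanSqDist γ w := by
  have hc : Continuous fun z : Space d × State N => ‖z.2 - v z.1‖ ^ 2 := by fun_prop
  rw [integral_eq_lintegral_of_nonneg_ae (ae_of_all _ fun z => by positivity)
    hc.aestronglyMeasurable, meanSqDist]
  congr 1
  have h1 : ∀ z : Space d × State N, ENNReal.ofReal (‖z.2 - v z.1‖ ^ 2) = ‖z.2 - v z.1‖ₑ ^ 2 :=
    fun z => by rw [ENNReal.ofReal_pow (norm_nonneg _), ofReal_norm]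
  simp_rw [h1]
  have hm : Measurable fun z : Space d × State N => ‖z.2 - v z.1‖ₑ ^ 2 :=
    (by fun_prop : Continuous fun z : Space d × State N => ‖z.2 - v z.1‖ₑ ^ 2).measurable
  rw [lintegral_jointLaw hev hev' γ hm]
  refine lintegral_congr fun u => ?_
  rw [edist_eq_enorm_sub, enorm_sub_sq_eq_lintegral]
  refine lintegral_congr_ae ?_
  filter_upwards [hw] with x hx
  rw [hx]

/-- Reduces the comparison to scalar functions of time: `g` is the mean linearized entropy. The
entropy and `g` are kept apart, since a component of a decomposition has a balance for `g` but no
entropy inequality of its own. -/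
theorem exists_relative_entropy (hη : IsUniformEntropy f η q b c C K)
    (hb : IntegrableOn (fun _ => b) (cell J L)) (hL : ∀ j ∈ J, 0 < L j) (hS : 0 < S) {T : EReal}
    (hST : (S : EReal) < T) {μbar : ProbabilityMeasure (L2 (cell J L) N)}
    {μ : ℝ → ProbabilityMeasure (L2 (cell J L) N)} (hμ : IsStatisticalSolution f J L T μbar μ)
    (hv : IsLipschitzSolution f J L S R v) {V : ℝ → L2 (cell J L) N}
    (hV : ∀ t ∈ Icc 0 S, V t =ᵐ[volume.restrict (cell J L)] fun x => v (t, x)) :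
    Integrable (fun u : L2 (cell J L) N => ∫ x in cell J L, η (u x))
      (μbar : Measure (L2 (cell J L) N)) ∧
    (∀ᵐ t ∂(volume.restrict (Icc 0 S)), Integrable
      (fun u : L2 (cell J L) N => ∫ x in cell J L, η (u x)) (μ t : Measure (L2 (cell J L) N))) ∧
    IntegrableOn (fun t => ∫ u, ∫ x in cell J L, η (u x) ∂volume
      ∂(μ t : Measure (L2 (cell J L) N))) (Icc 0 S) ∧
    IntegrableOn (fun t => meanSqDist (μ t : Measure (L2 (cell J L) N)) (V t)) (Icc 0 S) ∧
    ∃ (g : ℝ → ℝ) (g0 : ℝ), IntegrableOn g (Icc 0 S) ∧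
      (∀ᵐ t ∂(volume.restrict (Icc 0 S)),
        c / 2 * meanSqDist (μ t : Measure (L2 (cell J L) N)) (V t)
          ≤ (∫ u, ∫ x in cell J L, η (u x) ∂volume ∂(μ t : Measure (L2 (cell J L) N))) - g t) ∧
      ((∫ u, ∫ x in cell J L, η (u x) ∂volume ∂(μbar : Measure (L2 (cell J L) N))) - g0
        ≤ C / 2 * meanSqDist (μbar : Measure (L2 (cell J L) N)) (V 0)) ∧
      ∀ θ, IsTimeCutoff S θ → |(∫ t in Icc 0 S, g t * deriv θ t) + g0 * θ 0|
        ≤ d * C * R * K *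
          ∫ t in Icc 0 S, θ t * meanSqDist (μ t : Measure (L2 (cell J L) N)) (V t) := by
  obtain ⟨ev, hev, hev'⟩ := exists_measurable_eval (E := State N)
    ((volume : Measure (Space d)).restrict (cell J L))
  obtain ⟨Kf, hKf⟩ := hη.exists_flux_growth
  obtain ⟨κ0, κ, hκ0, hκ, hw, hΓ0, hΓt⟩ := hμ.exists_isWeakSolution
    (fun m => (hη.contDiff_flux m).continuous) hKf hST hev hev'
  have hvc := hv.lipschitz.continuous
  have hηc := hη.contDiff_entropy.continuous
  -- the entropy
  have hηm : Measurable fun z : Space d × State N => η z.2 :=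
    (hηc.comp continuous_snd).measurable
  have hIη0 : Integrable (fun z : Space d × State N => η z.2)
      (volume.restrict (cell J L) ⊗ₘ κ0) :=
    hw.energy0.integrable (hb.const_mul 2) hηm.aestronglyMeasurable
      (ae_of_all _ fun z => hη.abs_entropy_le z.2)
  have hηsm : StronglyMeasurable fun z : (ℝ × Space d) × State N => η z.2 :=
    (hηc.comp continuous_snd).stronglyMeasurable
  have hIη : Integrable (fun z : (ℝ × Space d) × State N => η z.2) (spaceTime J L S ⊗ₘ κ) :=
    hw.energy.integrable ((integrable_const_spaceTime (S := S) hb).const_mul 2)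
      hηsm.aestronglyMeasurable (ae_of_all _ fun z => hη.abs_entropy_le z.2)
  obtain ⟨A1, A2, -⟩ := integral_spaceTime_compProd J L S κ hηsm hIη
  have B0 := integral_jointLaw hev hev' (μbar : Measure (L2 (cell J L) N)) hηm
    (by rw [← hΓ0]; exact hIη0)
  have B1 : ∀ᵐ t ∂(volume.restrict (Icc 0 S)),
      Integrable (fun u : L2 (cell J L) N => ∫ x in cell J L, η (u x))
        (μ t : Measure (L2 (cell J L) N)) ∧
      ∫ z, η z.2 ∂(volume.restrict (cell J L) ⊗ₘ κ.sectR t)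
        = ∫ u, ∫ x in cell J L, η (u x) ∂volume ∂(μ t : Measure (L2 (cell J L) N)) := by
    filter_upwards [A2, hΓt] with t h1 h2
    rw [h2] at h1 ⊢
    exact integral_jointLaw hev hev' (μ t : Measure (L2 (cell J L) N)) hηm h1
  -- the squared distance
  have hdc : Continuous fun z : (ℝ × Space d) × State N => ‖z.2 - v z.1‖ ^ 2 := by fun_prop
  have hId := integrable_norm_sub_sq hw hv
  obtain ⟨D1, D2, -⟩ := integral_spaceTime_compProd J L S κ hdc.stronglyMeasurable hId
  have B2 : ∀ᵐ t ∂(volume.restrict (Icc 0 S)),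
      ∫ z, ‖z.2 - v (t, z.1)‖ ^ 2 ∂(volume.restrict (cell J L) ⊗ₘ κ.sectR t)
        = meanSqDist (μ t : Measure (L2 (cell J L) N)) (V t) := by
    filter_upwards [hΓt, ae_restrict_mem measurableSet_Icc] with t h2 ht
    rw [h2]
    exact integral_norm_sub_sq_jointLaw hev hev' _ (v := fun x => v (t, x)) (by fun_prop) (hV t ht)
  have B20 : ∫ z, ‖z.2 - v (0, z.1)‖ ^ 2 ∂(volume.restrict (cell J L) ⊗ₘ κ0)
        = meanSqDist (μbar : Measure (L2 (cell J L) N)) (V 0) := by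
    rw [hΓ0]
    exact integral_norm_sub_sq_jointLaw hev hev' _ (v := fun x => v (0, x)) (by fun_prop)
      (hV 0 ⟨le_rfl, hS.le⟩)
  -- the linearized entropy
  have htc : Continuous fun z : (ℝ × Space d) × State N => tangent η (v z.1) z.2 :=
    hη.continuous_tangent.comp (by fun_prop :
      Continuous fun z : (ℝ × Space d) × State N => (v z.1, z.2))
  have hIt := integrable_tangent hη hb hw hv
  obtain ⟨T1, T2, -⟩ := integral_spaceTime_compProd J L S κ htc.stronglyMeasurable hIt
  refine ⟨B0.1, B1.mono fun t ht => ht.1, (A1.congr (B1.mono fun t ht => ht.2)), D1.congr B2,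
    fun t => ∫ z, tangent η (v (t, z.1)) z.2 ∂(volume.restrict (cell J L) ⊗ₘ κ.sectR t),
    ∫ z, tangent η (v (0, z.1)) z.2 ∂(volume.restrict (cell J L) ⊗ₘ κ0), T1, ?_, ?_,
    fun θ hθ => ?_⟩
  · filter_upwards [B1, B2, A2, D2, T2] with t h1 h2 h3 h4 h5
    rw [← h1.2, ← h2, ← integral_const_mul, ← integral_sub h3 h5]
    exact integral_mono (h4.const_mul _) (h3.sub h5) fun z => (hη.taylor _ _).1
  · have hId0 : Integrable (fun z : Space d × State N => ‖z.2 - v (0, z.1)‖ ^ 2)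
        (volume.restrict (cell J L) ⊗ₘ κ0) := by
      refine ((integrable_energy_zero hw hv).const_mul 2).mono' ?_ (ae_of_all _ fun z => ?_)
      · exact (by fun_prop : Continuous fun z : Space d × State N =>
          ‖z.2 - v (0, z.1)‖ ^ 2).aestronglyMeasurable
      · rw [Real.norm_of_nonneg (by positivity)]
        exact IsUniformEntropy.norm_sub_sq_le _ _
    have hIt0 := integrable_tangent_zero hη hb hw hv
    rw [← B0.2, ← hΓ0, ← B20, ← integral_const_mul, ← integral_sub hIη0 hIt0]
    exact integral_mono (hIη0.sub hIt0) (hId0.const_mul _) fun z => (hη.taylor _ _).2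
  · have key := tangent_balance hη hb hL hS hw hv hθ
    obtain ⟨-, B, hB⟩ := hθ.exists_lipschitzWith
    have hθc := hθ.smooth.continuous
    have hθ'c := hθ.smooth.continuous_deriv (by simp)
    obtain ⟨B', hB'⟩ : ∃ B', ∀ t, |deriv θ t| ≤ B' :=
      hθ.compact.deriv.exists_bound_of_continuous hθ'c
    have hc1 : Continuous fun z : (ℝ × Space d) × State N =>
      deriv θ z.1.1 * tangent η (v z.1) z.2 := by fun_prop
    have hc2 : Continuous fun z : (ℝ × Space d) × State N =>
      θ z.1.1 * ‖z.2 - v z.1‖ ^ 2 := by fun_prop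
    have hi1 := hIt.bdd_mul (f := fun z => deriv θ z.1.1)
      (by fun_prop : Continuous fun z : (ℝ × Space d) × State N =>
        deriv θ z.1.1).aestronglyMeasurable (ae_of_all _ fun z => hB' z.1.1)
    have hi2 := hId.bdd_mul (f := fun z => θ z.1.1)
      (by fun_prop : Continuous fun z : (ℝ × Space d) × State N =>
        θ z.1.1).aestronglyMeasurable (ae_of_all _ fun z => hB z.1.1)
    rw [(integral_spaceTime_compProd J L S κ hc1.stronglyMeasurable hi1).2.2,
      (integral_spaceTime_compProd J L S κ hc2.stronglyMeasurable hi2).2.2] at key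
    simp only [integral_const_mul] at key
    have e2 : ∫ t in Icc 0 S, θ t *
          ∫ z, ‖z.2 - v (t, z.1)‖ ^ 2 ∂(volume.restrict (cell J L) ⊗ₘ κ.sectR t)
        = ∫ t in Icc 0 S, θ t * meanSqDist (μ t : Measure (L2 (cell J L) N)) (V t) := by
      refine integral_congr_ae ?_
      filter_upwards [B2] with t ht
      rw [ht]
    rw [e2] at key
    simpa only [mul_comm] using key

end Relative

end StatSol

/-! ### Gronwall estimate for a mixture, and time clamping of classical solutions -/

namespace StatSol

/-- The entropy inequality `hent` is available only for the weighted sum, whereas `hbal` holds for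
each component. Subtracting the weighted balances yields a differential inequality for `∑ α i (e i -
g i)`. Its error is bounded by the quantity itself, because `w i ≤ (2 / c)(e i - g i)`; this makes
the rate `Q (2 / c)`. -/
theorem ae_sum_sqDist_le {ι : Type*} [Fintype ι] {α : ι → ℝ} (hα : ∀ i, 0 ≤ α i)
    {e g w : ι → ℝ → ℝ} {e0 g0 w0 : ι → ℝ} {S c C Q : ℝ} (hc : 0 < c) (hQ : 0 ≤ Q)
    (he : ∀ i, IntegrableOn (e i) (Icc 0 S)) (hg : ∀ i, IntegrableOn (g i) (Icc 0 S))
    (hw : ∀ i, IntegrableOn (w i) (Icc 0 S))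
    (hlow : ∀ i, ∀ᵐ t ∂(volume.restrict (Icc 0 S)), c / 2 * w i t ≤ e i t - g i t)
    (hup : ∀ i, e0 i - g0 i ≤ C / 2 * w0 i)
    (hbal : ∀ i θ, IsTimeCutoff S θ → |(∫ t in Icc 0 S, g i t * deriv θ t) + g0 i * θ 0|
      ≤ Q * ∫ t in Icc 0 S, θ t * w i t)
    (hent : ∀ θ, IsTimeCutoff S θ →
      0 ≤ (∫ t in Icc 0 S, (∑ i, α i * e i t) * deriv θ t) + (∑ i, α i * e0 i) * θ 0) :
    ∀ᵐ t ∂(volume.restrict (Icc 0 S)), ∑ i, α i * w i t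
      ≤ 2 / c * (Real.exp (Q * (2 / c) * t) * (C / 2 * ∑ i, α i * w0 i)) := by
  have hsum : ∀ h : ι → ℝ → ℝ, (∀ i, IntegrableOn (h i) (Icc 0 S)) →
      IntegrableOn (fun t => ∑ i, α i * h i t) (Icc 0 S) := fun h hh =>
    integrable_finsetSum _ fun i _ => (hh i).const_mul (α i)
  have hmul : ∀ h θ : ℝ → ℝ, IntegrableOn h (Icc 0 S) → Continuous θ →
      IntegrableOn (fun t => h t * θ t) (Icc 0 S) := fun h θ hh hθ =>
    hh.mul_continuousOn hθ.continuousOn isCompact_Icc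
  have hsumeq : ∀ (h : ι → ℝ → ℝ) (θ : ℝ → ℝ), (∀ i, IntegrableOn (h i) (Icc 0 S)) →
      Continuous θ → ∫ t in Icc 0 S, (∑ i, α i * h i t) * θ t
        = ∑ i, α i * ∫ t in Icc 0 S, h i t * θ t := by
    intro h θ hh hθ
    simp_rw [← integral_const_mul]
    rw [← integral_finsetSum _ fun i _ => (hmul _ _ (hh i) hθ).const_mul (α i)]
    refine integral_congr_ae (ae_of_all _ fun t => ?_)
    simp only [Finset.sum_mul, mul_assoc]
  have hlow' : ∀ᵐ t ∂(volume.restrict (Icc 0 S)),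
      ∑ i, α i * w i t ≤ 2 / c * ∑ i, α i * (e i t - g i t) := by
    filter_upwards [ae_all_iff.2 hlow] with t ht
    rw [Finset.mul_sum]
    refine Finset.sum_le_sum fun i _ => ?_
    rw [mul_left_comm]
    refine mul_le_mul_of_nonneg_left ?_ (hα i)
    have := mul_le_mul_of_nonneg_left (ht i) (by positivity : 0 ≤ 2 / c)
    rwa [← mul_assoc, div_mul_div_cancel₀ hc.ne', div_self two_ne_zero, one_mul] at this
  have hEint := hsum (fun i t => e i t - g i t) fun i => (he i).sub (hg i)
  have hE0 : ∑ i, α i * (e0 i - g0 i) ≤ C / 2 * ∑ i, α i * w0 i := by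
    rw [Finset.mul_sum]
    refine Finset.sum_le_sum fun i _ => ?_
    rw [mul_left_comm]
    exact mul_le_mul_of_nonneg_left (hup i) (hα i)
  have key := ae_le_exp_mul_of_cutoff (k := Q * (2 / c)) (E0 := ∑ i, α i * (e0 i - g0 i)) hEint
    fun θ hθ => ?_
  · filter_upwards [key, hlow'] with t h1 h2
    refine h2.trans (mul_le_mul_of_nonneg_left (h1.trans ?_) (by positivity))
    exact mul_le_mul_of_nonneg_left hE0 (Real.exp_pos _).le
  · have hθc := hθ.smooth.continuous
    have hθ'c := hθ.smooth.continuous_deriv (by simp)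
    have h1 := hent θ hθ
    have h2 : ∑ i, α i * ((∫ t in Icc 0 S, g i t * deriv θ t) + g0 i * θ 0)
        ≤ ∑ i, α i * (Q * ∫ t in Icc 0 S, θ t * w i t) :=
      Finset.sum_le_sum fun i _ => mul_le_mul_of_nonneg_left
        ((le_abs_self _).trans (hbal i θ hθ)) (hα i)
    have h3 : ∑ i, α i * (Q * ∫ t in Icc 0 S, θ t * w i t)
        ≤ Q * (2 / c) * ∫ t in Icc 0 S, θ t * ∑ i, α i * (e i t - g i t) := by
      have e1 : ∑ i, α i * (Q * ∫ t in Icc 0 S, θ t * w i t)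
          = Q * ∫ t in Icc 0 S, (∑ i, α i * w i t) * θ t := by
        rw [hsumeq w θ hw hθc, Finset.mul_sum]
        refine Finset.sum_congr rfl fun i _ => ?_
        rw [mul_left_comm]
        simp only [mul_comm]
      rw [e1, mul_assoc, ← integral_const_mul (2 / c)]
      refine mul_le_mul_of_nonneg_left (integral_mono_ae (hmul _ _ (hsum w hw) hθc) ?_ ?_) hQ
      · have := (hmul _ _ hEint hθc).const_mul (2 / c)
        simpa only [IntegrableOn, mul_comm (θ _)] using this
      · filter_upwards [hlow'] with t ht
        have := mul_le_mul_of_nonneg_right ht (hθ.nonneg t)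
        linarith
    have h4 : ∫ t in Icc 0 S, (∑ i, α i * (e i t - g i t)) * deriv θ t
        = (∫ t in Icc 0 S, (∑ i, α i * e i t) * deriv θ t)
          - ∑ i, α i * ∫ t in Icc 0 S, g i t * deriv θ t := by
      rw [← hsumeq g _ hg hθ'c, ← integral_sub (hmul _ _ (hsum e he) hθ'c)
        (hmul _ _ (hsum g hg) hθ'c)]
      refine integral_congr_ae (ae_of_all _ fun t => ?_)
      simp only [mul_sub, Finset.sum_sub_distrib, sub_mul]
    simp only [mul_add, Finset.sum_add_distrib] at h2
    have h5 : ∑ i, α i * (g0 i * θ 0) = (∑ i, α i * g0 i) * θ 0 := by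
      rw [Finset.sum_mul]; simp only [mul_assoc]
    rw [h4]
    simp only [mul_sub, Finset.sum_sub_distrib, sub_mul] at h3 ⊢
    linarith

/-! ### Classical solutions -/

/-- Clamping the time to `[0, S]` turns a classical solution into a Lipschitz solution. -/
theorem IsClassicalSolution.isLipschitzSolution {d N : ℕ} {f : Fin d → State N → State N}
    (hf : ∀ m, Differentiable ℝ (f m)) {J : Finset (Fin d)} {L : Fin d → ℝ} {T : EReal} {R : ℝ≥0}
    {v : ℝ → Space d → State N} (hv : IsClassicalSolution f J L T R v) {S : ℝ} (hS : 0 < S)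
    (hST : (S : EReal) < T) {V : ℝ → L2 (cell J L) N}
    (hV : ∀ t ∈ timeInterval T, V t =ᵐ[volume.restrict (cell J L)] v t) {B : ℝ≥0}
    (hB : ∀ᵐ t ∂(volume.restrict (timeInterval T)), ‖V t‖ₑ ^ 2 ≤ B) :
    IsLipschitzSolution f J L S R fun z => v (max 0 (min z.1 S)) z.2 := by
  have hmem : ∀ t : ℝ, max 0 (min t S) ∈ timeInterval T := fun t =>
    Icc_subset_timeInterval hST ⟨le_max_left _ _, max_le hS.le (min_le_right _ _)⟩
  have hclamp : ∀ t ∈ Icc 0 S, max 0 (min t S) = t := fun t ht => by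
    rw [min_eq_left ht.2, max_eq_right ht.1]
  have hlip : LipschitzWith R fun z : ℝ × Space d => v (max 0 (min z.1 S)) z.2 := by
    have h1 : LipschitzWith 1 fun z : ℝ × Space d => (max 0 (min z.1 S), z.2) := by
      have e1 : LipschitzWith 1 fun z : ℝ × Space d => max 0 (min z.1 S) :=
        (LipschitzWith.prod_fst.min_const S).const_max 0
      have := e1.prodMk (LipschitzWith.prod_snd (α := ℝ) (β := Space d))
      simpa using this
    have h2 := hv.lipschitz.comp (h1.lipschitzOnWith (s := univ))
      (fun z _ => ⟨hmem z.1, mem_univ _⟩)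
    rw [mul_one] at h2
    exact lipschitzOnWith_univ.1 h2
  have hcont := hlip.continuous
  have hsq : ∀ t ∈ Icc 0 S, ∫⁻ x in cell J L, ‖v (max 0 (min t S)) x‖ₑ ^ 2 = ‖V t‖ₑ ^ 2 := by
    intro t ht
    rw [enorm_sq_eq_lintegral, hclamp t ht]
    refine lintegral_congr_ae ?_
    filter_upwards [hV t (Icc_subset_timeInterval hST ht)] with x hx
    rw [hx]
  refine ⟨hlip, fun z => hv.bounded _ (hmem _) _, fun j hj t x => hv.periodic _ (hmem t) j hj x,
    ?_, ?_, ?_⟩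
  · have h1 : ∀ᵐ z ∂spaceTime J L S, DifferentiableAt ℝ
        (fun z : ℝ × Space d => v (max 0 (min z.1 S)) z.2) z :=
      ae_restrict_of_ae hlip.ae_differentiableAt
    have h2 := ae_restrict_of_ae_restrict_of_subset
      (prod_mono (Icc_subset_timeInterval hST) (Subset.refl (cell J L))) hv.equation
    -- The clamped function agrees with `v` in a time neighbourhood only at interior times, so only
    -- there do the time derivatives coincide.
    have h3 : ∀ᵐ z ∂spaceTime J L S, z.1 ≠ 0 ∧ z.1 ≠ S := by
      rw [spaceTime_eq_prod]
      refine Measure.quasiMeasurePreserving_fst.ae (p := fun t : ℝ => t ≠ 0 ∧ t ≠ S)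
        (ae_restrict_of_ae ?_)
      have ha : ∀ᵐ t : ℝ, t ≠ 0 := by simp [ae_iff]
      have hb : ∀ᵐ t : ℝ, t ≠ S := by simp [ae_iff]
      filter_upwards [ha, hb] with t ha hb using ⟨ha, hb⟩
    have h2' : ∀ᵐ z : ℝ × Space d ∂spaceTime J L S, deriv (fun s => v s z.2) z.1
      + ∑ m, fderiv ℝ (fun y => f m (v z.1 y)) z.2 (EuclideanSpace.single m 1) = 0 := h2
    filter_upwards [h1, h2', h3, ae_mem_spaceTime J L S] with z hd heq hne hz
    obtain ⟨t, x⟩ := z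
    have ht0 : 0 < t := lt_of_le_of_ne hz.1.1 (Ne.symm hne.1)
    have htS : t < S := lt_of_le_of_ne hz.1.2 hne.2
    have e1 : deriv (fun s => v s x) t
        = fderiv ℝ (fun z : ℝ × Space d => v (max 0 (min z.1 S)) z.2) (t, x) (1, 0) := by
      have hg : HasDerivAt (fun s : ℝ => (s, x)) ((1 : ℝ), (0 : Space d)) t :=
        (hasDerivAt_id t).prodMk (hasDerivAt_const t x)
      have h := hd.hasFDerivAt.comp_hasDerivAt t hg
      have hev : (fun s => v s x) =ᶠ[𝓝 t]
          (fun z : ℝ × Space d => v (max 0 (min z.1 S)) z.2) ∘ fun s : ℝ => (s, x) := by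
        filter_upwards [Ioo_mem_nhds ht0 htS] with s hs
        simp only [Function.comp_apply, hclamp s ⟨hs.1.le, hs.2.le⟩]
      rw [hev.deriv_eq, h.deriv]
    have e2 : ∀ m, fderiv ℝ (fun y => f m (v t y)) x (EuclideanSpace.single m 1)
        = fderiv ℝ (f m) (v (max 0 (min t S)) x)
          (fderiv ℝ (fun z : ℝ × Space d => v (max 0 (min z.1 S)) z.2) (t, x)
            (0, EuclideanSpace.single m 1)) := by
      intro m
      have hg : HasFDerivAt (fun y : Space d => (t, y))
          (ContinuousLinearMap.inr ℝ ℝ (Space d)) x := hasFDerivAt_prodMk_right t x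
      have h := (hf m (v (max 0 (min t S)) x)).hasFDerivAt.comp x (hd.hasFDerivAt.comp x hg)
      have hev : (fun y => f m (v t y)) = f m ∘ v (max 0 (min t S)) := by
        funext y
        simp only [Function.comp_apply, hclamp t hz.1]
      have h' : HasFDerivAt (f m ∘ v (max 0 (min t S))) _ x := h
      rw [hev, h'.fderiv]
      simp
    simp only [← e1, ← e2]
    exact heq
  · refine ⟨(hcont.norm.pow 2).aestronglyMeasurable, ?_⟩
    have h1 : ∫⁻ z, ‖v (max 0 (min z.1 S)) z.2‖ₑ ^ 2 ∂spaceTime J L S ≤ ∫⁻ _ in Icc 0 S, B := by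
      rw [spaceTime_eq_prod, lintegral_prod _ (hcont.enorm.measurable.pow_const 2).aemeasurable]
      refine lintegral_mono_ae ?_
      filter_upwards [ae_restrict_of_ae_restrict_of_subset (Icc_subset_timeInterval hST) hB,
        ae_restrict_mem measurableSet_Icc] with t h1 ht
      rwa [hsq t ht]
    have h2 : ∫⁻ _ in Icc 0 S, (B : ℝ≥0∞) < ⊤ := by
      simp [ENNReal.mul_lt_top]
    simpa [HasFiniteIntegral] using h1.trans_lt h2
  · have hc0 : Continuous fun x : Space d => v (max 0 (min 0 S)) x :=
      hcont.comp (by fun_prop : Continuous fun x : Space d => ((0 : ℝ), x))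
    refine ⟨(hc0.norm.pow 2).aestronglyMeasurable, ?_⟩
    have h1 := hsq 0 ⟨le_rfl, hS.le⟩
    have h2 : ‖V 0‖ₑ ^ 2 < ⊤ := by simp
    rw [← h1] at h2
    simpa [HasFiniteIntegral] using h2

end StatSol

namespace StatSol

/-! ### Transport plans -/

/-- The slack between `ε ^ 2` and `ε'` avoids any appeal to the existence of an optimal plan. -/
theorem exists_coupling_of_wasserstein_le {X : Type*} [MeasurableSpace X] [EDist X]
    {μ ρ : Measure X} {ε ε' : ℝ≥0∞} (h : wasserstein 2 μ ρ ≤ ε) (hε : ε ^ 2 < ε') :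
    ∃ π ∈ couplings μ ρ, ∫⁻ z, edist z.1 z.2 ^ 2 ∂π ≤ ε' := by
  rw [wasserstein, one_div, ENNReal.rpow_inv_le_iff two_pos, ENNReal.rpow_two] at h
  obtain ⟨π, hπ⟩ := iInf_lt_iff.1 (h.trans_lt hε)
  obtain ⟨hπ1, hπ2⟩ := iInf_lt_iff.1 hπ
  exact ⟨π, hπ1, by simpa only [ENNReal.rpow_two] using hπ2.le⟩

section Couplings

variable {X : Type*} [MetricSpace X] [MeasurableSpace X] [BorelSpace X] [SecondCountableTopology X]

/-- The elementary bound `d ≤ ε + d² / ε` replaces Cauchy–Schwarz, at the price of a factor 2. The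
integrals of `h` may be infinite, so two additive inequalities stand in for a bound on the
difference. -/
theorem lintegral_le_of_mem_couplings {μ ρ : Measure X} [IsProbabilityMeasure μ]
    {π : Measure (X × X)} (hπ : π ∈ couplings μ ρ) {ε : ℝ≥0∞} (hε0 : ε ≠ 0) (hε : ε ≠ ⊤)
    (hcost : ∫⁻ z, edist z.1 z.2 ^ 2 ∂π ≤ ε ^ 2) {h : X → ℝ≥0} {K : ℝ≥0} (hh : LipschitzWith K h) :
    ∫⁻ x, h x ∂μ ≤ ∫⁻ x, h x ∂ρ + K * (2 * ε) ∧ ∫⁻ x, h x ∂ρ ≤ ∫⁻ x, h x ∂μ + K * (2 * ε) := by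
  have hm : Measurable fun x => (h x : ℝ≥0∞) := hh.continuous.measurable.coe_nnreal_ennreal
  have hd : Measurable fun z : X × X => edist z.1 z.2 := measurable_edist
  have hprob : π univ = 1 := by
    have : (π.map Prod.fst) univ = 1 := by rw [hπ.1]; exact measure_univ
    rwa [Measure.map_apply measurable_fst MeasurableSet.univ, preimage_univ] at this
  have hdist : ∫⁻ z, edist z.1 z.2 ∂π ≤ 2 * ε := by
    have h1 : ∀ z : X × X, edist z.1 z.2 ≤ ε + ε⁻¹ * edist z.1 z.2 ^ 2 := by
      intro z
      rcases le_total (edist z.1 z.2) ε with hle | hle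
      · exact hle.trans le_self_add
      · refine le_trans ?_ le_add_self
        calc edist z.1 z.2 = ε⁻¹ * (ε * edist z.1 z.2) := by
              rw [← mul_assoc, ENNReal.inv_mul_cancel hε0 hε, one_mul]
          _ ≤ ε⁻¹ * edist z.1 z.2 ^ 2 := by rw [sq]; gcongr
    calc ∫⁻ z, edist z.1 z.2 ∂π ≤ ∫⁻ z, (ε + ε⁻¹ * edist z.1 z.2 ^ 2) ∂π := lintegral_mono h1
      _ = ε + ε⁻¹ * ∫⁻ z, edist z.1 z.2 ^ 2 ∂π := by
          rw [lintegral_add_left measurable_const, lintegral_const, hprob, mul_one,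
            lintegral_const_mul _ (hd.pow_const 2)]
      _ ≤ ε + ε⁻¹ * ε ^ 2 := by gcongr
      _ = 2 * ε := by
          rw [sq, ← mul_assoc, ENNReal.inv_mul_cancel hε0 hε, one_mul, two_mul]
  have e1 : ∫⁻ x, h x ∂μ = ∫⁻ z, h z.1 ∂π := by
    rw [← hπ.1, lintegral_map hm measurable_fst]
  have e2 : ∫⁻ x, h x ∂ρ = ∫⁻ z, h z.2 ∂π := by
    rw [← hπ.2, lintegral_map hm measurable_snd]
  have hlip : ∀ x y, (h x : ℝ≥0∞) ≤ h y + K * edist x y := fun x y => by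
    have h1 := hh x y
    rw [edist_nndist, NNReal.nndist_eq, ENNReal.coe_max] at h1
    have h2 := (le_max_left _ _).trans h1
    rw [ENNReal.coe_sub, tsub_le_iff_left] at h2
    exact h2
  have hK : ∫⁻ z, K * edist z.1 z.2 ∂π ≤ K * (2 * ε) := by
    rw [lintegral_const_mul _ hd]
    gcongr
  rw [e1, e2]
  constructor
  · calc ∫⁻ z, h z.1 ∂π ≤ ∫⁻ z, (h z.2 + K * edist z.1 z.2) ∂π :=
          lintegral_mono fun z => hlip z.1 z.2
      _ = ∫⁻ z, h z.2 ∂π + ∫⁻ z, K * edist z.1 z.2 ∂π :=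
          lintegral_add_left (hm.comp measurable_snd) _
      _ ≤ _ := by gcongr
  · calc ∫⁻ z, h z.2 ∂π ≤ ∫⁻ z, (h z.1 + K * edist z.1 z.2) ∂π :=
          lintegral_mono fun z => by rw [edist_comm]; exact hlip z.2 z.1
      _ = ∫⁻ z, h z.1 ∂π + ∫⁻ z, K * edist z.1 z.2 ∂π :=
          lintegral_add_left (hm.comp measurable_fst) _
      _ ≤ _ := by gcongr

/-- Two probability measures with arbitrarily cheap transport to common measures agree. -/
theorem eq_of_couplings {μ γ : Measure X} [IsProbabilityMeasure μ] [IsProbabilityMeasure γ]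
    (h : ∀ ε : ℝ≥0, 0 < ε → ∃ ρ, (∃ π ∈ couplings μ ρ, ∫⁻ z, edist z.1 z.2 ^ 2 ∂π ≤ ε ^ 2) ∧
      ∃ π ∈ couplings γ ρ, ∫⁻ z, edist z.1 z.2 ^ 2 ∂π ≤ ε ^ 2) : γ = μ := by
  have key : ∀ (g : X → ℝ≥0) (K : ℝ≥0), LipschitzWith K g → ∫⁻ x, g x ∂γ = ∫⁻ x, g x ∂μ := by
    intro g K hg
    have hle : ∀ ε : ℝ≥0, 0 < ε → ∫⁻ x, g x ∂γ ≤ ∫⁻ x, g x ∂μ + ((4 * K * ε : ℝ≥0) : ℝ≥0∞) ∧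
        ∫⁻ x, g x ∂μ ≤ ∫⁻ x, g x ∂γ + ((4 * K * ε : ℝ≥0) : ℝ≥0∞) := by
      intro ε hε
      obtain ⟨ρ, ⟨π1, hπ1, hc1⟩, π2, hπ2, hc2⟩ := h ε hε
      have hε0 : (ε : ℝ≥0∞) ≠ 0 := by exact_mod_cast hε.ne'
      have a1 := lintegral_le_of_mem_couplings hπ1 hε0 ENNReal.coe_ne_top hc1 hg
      have a2 := lintegral_le_of_mem_couplings hπ2 hε0 ENNReal.coe_ne_top hc2 hg
      have e : ((4 * K * ε : ℝ≥0) : ℝ≥0∞) = K * (2 * ε) + K * (2 * ε) := by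
        push_cast; ring
      rw [e, ← add_assoc, ← add_assoc]
      exact ⟨a2.1.trans (by gcongr; exact a1.2), a1.1.trans (by gcongr; exact a2.2)⟩
    have hlim : ∀ δ : ℝ≥0, 0 < δ → ∃ ε : ℝ≥0, 0 < ε ∧ 4 * K * ε ≤ δ := by
      intro δ hδ
      refine ⟨δ / (4 * K + 1), by positivity, ?_⟩
      rw [mul_div_assoc']
      refine div_le_of_le_mul₀ (by positivity) (by positivity) ?_
      rw [mul_comm]
      gcongr
      exact le_self_add
    refine le_antisymm ?_ ?_ <;>
    · refine ENNReal.le_of_forall_pos_le_add fun δ hδ _ => ?_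
      obtain ⟨ε, hε, hε'⟩ := hlim δ hδ
      have := hle ε hε
      first
      | exact this.1.trans (by gcongr)
      | exact this.2.trans (by gcongr)
  -- Thickened indicators are Lipschitz and their integrals converge to the measure of the closed
  -- set, so equality on Lipschitz functions passes to closed sets, a π-system generating the Borel
  -- sets.
  have hclosed : ∀ F : Set X, IsClosed F → γ F = μ F := by
    intro F hF
    have hδ : ∀ n : ℕ, 0 < 1 / ((n : ℝ) + 1) := fun n => by positivity
    have t1 := tendsto_lintegral_thickenedIndicator_of_isClosed γ hF hδ
      tendsto_one_div_add_atTop_nhds_zero_nat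
    have t2 := tendsto_lintegral_thickenedIndicator_of_isClosed μ hF hδ
      tendsto_one_div_add_atTop_nhds_zero_nat
    refine tendsto_nhds_unique t1 (t2.congr fun n => ?_)
    exact (key _ _ (lipschitzWith_thickenedIndicator (hδ n) F)).symm
  refine ext_of_generate_finite {s | IsClosed s} ?_ isPiSystem_isClosed (fun s hs => hclosed s hs)
    (by simp)
  rw [← borel_eq_generateFrom_isClosed]
  exact BorelSpace.measurable_eq

/-- A transport plan to a finite combination of Dirac masses decomposes its first marginal. -/
theorem exists_mem_decompositions {M : ℕ} {α : Fin M → ℝ≥0} (hα : ∀ i, 0 < α i)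
    (V : Fin M → X) {μ : ProbabilityMeasure X} {π : Measure (X × X)}
    (hπ : π ∈ couplings (μ : Measure X) (∑ i, α i • Measure.dirac (V i))) :
    ∃ μs ∈ decompositions α μ,
      ∑ i, α i * ∫⁻ u, edist u (V i) ^ 2 ∂(μs i : Measure X) = ∫⁻ z, edist z.1 z.2 ^ 2 ∂π := by
  classical
  let A : X → Set (X × X) := fun w => Prod.snd ⁻¹' {w}
  have hA : ∀ w, MeasurableSet (A w) := fun w => measurable_snd (measurableSet_singleton w)
  -- The atoms `V i` need not be distinct: the fibre over `w` carries the total weight of all atoms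
  -- located at `w`.
  have hβ : ∀ w, π (A w) = ∑ i, if V i = w then (α i : ℝ≥0∞) else 0 := by
    intro w
    rw [← Measure.map_apply measurable_snd (measurableSet_singleton w), hπ.2,
      Measure.finsetSum_apply]
    refine Finset.sum_congr rfl fun i _ => ?_
    rw [Measure.smul_apply, Measure.dirac_apply' _ (measurableSet_singleton w)]
    by_cases hw : V i = w
    · simp [hw, ENNReal.smul_def]
    · simp [hw]
  have hβ0 : ∀ i, π (A (V i)) ≠ 0 := by
    intro i hi
    rw [hβ, Finset.sum_eq_zero_iff] at hi
    have := hi i (Finset.mem_univ i)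
    rw [if_pos rfl] at this
    exact (hα i).ne' (by exact_mod_cast this)
  have hβt : ∀ w, π (A w) ≠ ⊤ := by
    intro w
    rw [hβ]
    refine ENNReal.sum_ne_top.2 fun i _ => ?_
    split_ifs <;> simp
  have hrange : ∀ᵐ z ∂π, ∃ i, z.2 = V i := by
    have h1 : ∀ᵐ w ∂(π.map Prod.snd), ∃ i, w = V i := by
      rw [hπ.2, ae_iff, Measure.finsetSum_apply]
      refine Finset.sum_eq_zero fun i _ => ?_
      rw [Measure.smul_apply, Measure.dirac_apply' _ ?_]
      · simp
      · have : {w | ¬∃ i, w = V i} = (range V)ᶜ := by ext w; simp [eq_comm]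
        rw [this]
        exact (finite_range V).measurableSet.compl
    exact ae_of_ae_map measurable_snd.aemeasurable h1
  -- Conditioning on the second coordinate. At a given point the factors `α i / π (A (V i))` over
  -- the indices with `V i = z.2` add up to one, so coinciding atoms share their fibre in proportion
  -- to their weights.
  have hdec : ∀ h : X × X → ℝ≥0∞, Measurable h →
      ∑ i, α i * ((π (A (V i)))⁻¹ * ∫⁻ z in A (V i), h z ∂π) = ∫⁻ z, h z ∂π := by
    intro h hh
    simp_rw [← lintegral_indicator (hA _), ← lintegral_const_mul _ (hh.indicator (hA _)),
      ← lintegral_const_mul _ ((hh.indicator (hA _)).const_mul _)]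
    rw [← lintegral_finsetSum _ fun i _ => ((hh.indicator (hA _)).const_mul _).const_mul _]
    refine lintegral_congr_ae ?_
    filter_upwards [hrange] with z hz
    obtain ⟨i0, hi0⟩ := hz
    have h1 : ∀ i, (α i : ℝ≥0∞) * ((π (A (V i)))⁻¹ * (A (V i)).indicator h z)
        = (if V i = z.2 then (α i : ℝ≥0∞) else 0) * ((π (A z.2))⁻¹ * h z) := by
      intro i
      by_cases hi : V i = z.2
      · rw [if_pos hi, hi, indicator_of_mem (show z ∈ A z.2 from rfl)]
      · rw [if_neg hi, indicator_of_notMem (fun hc : z ∈ A (V i) => hi hc.symm)]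
        simp
    simp_rw [h1]
    rw [← Finset.sum_mul, ← hβ, ← mul_assoc,
      ENNReal.mul_inv_cancel (by rw [hi0]; exact hβ0 i0) (hβt _), one_mul]
  let ν : Fin M → Measure X := fun i => (π (A (V i)))⁻¹ • (π.restrict (A (V i))).map Prod.fst
  have hν : ∀ i, IsProbabilityMeasure (ν i) := fun i => ⟨by
    rw [Measure.smul_apply, Measure.map_apply measurable_fst MeasurableSet.univ, preimage_univ,
      Measure.restrict_apply_univ, smul_eq_mul, ENNReal.inv_mul_cancel (hβ0 i) (hβt _)]⟩
  refine ⟨fun i => ⟨ν i, hν i⟩, ?_, ?_⟩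
  · change ∑ i, α i • ν i = (μ : Measure X)
    ext s hs
    have h1 := hdec ((Prod.fst ⁻¹' s).indicator 1) (measurable_one.indicator (measurable_fst hs))
    rw [lintegral_indicator_one (measurable_fst hs),
      ← Measure.map_apply measurable_fst hs, hπ.1] at h1
    rw [← h1, Measure.finsetSum_apply]
    refine Finset.sum_congr rfl fun i _ => ?_
    rw [Measure.smul_apply, lintegral_indicator_one (measurable_fst hs), ENNReal.smul_def,
      smul_eq_mul]
    congr 1
    rw [Measure.smul_apply, Measure.map_apply measurable_fst hs, smul_eq_mul]
  · have hd : Measurable fun z : X × X => edist z.1 z.2 ^ 2 := measurable_edist.pow_const 2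
    rw [← hdec _ hd]
    refine Finset.sum_congr rfl fun i _ => ?_
    congr 1
    change ∫⁻ u, edist u (V i) ^ 2 ∂(ν i) = _
    rw [lintegral_smul_measure, lintegral_map ((measurable_edist_left).pow_const 2) measurable_fst,
      smul_eq_mul]
    congr 1
    refine setLIntegral_congr_fun (hA _) fun z hz => ?_
    have hz' : z.2 = V i := hz
    simp only [hz']

/-- Each component is sent entirely to its own atom. This turns the summed estimate at time `t` back
into a transport cost. -/
theorem exists_coupling_sum_dirac {M : ℕ} {α : Fin M → ℝ≥0}
    {γ : ProbabilityMeasure X} {γs : Fin M → ProbabilityMeasure X} (hγ : γs ∈ decompositions α γ)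
    (V : Fin M → X) :
    ∃ π ∈ couplings (γ : Measure X) (∑ i, α i • Measure.dirac (V i)),
      ∫⁻ z, edist z.1 z.2 ^ 2 ∂π = ∑ i, α i * ∫⁻ u, edist u (V i) ^ 2 ∂(γs i : Measure X) := by
  have hm : ∀ i, Measurable fun u : X => (u, V i) := fun i => by fun_prop
  refine ⟨∑ i, α i • (γs i : Measure X).map fun u => (u, V i), ⟨?_, ?_⟩, ?_⟩
  · rw [Measure.map_finset_sum measurable_fst.aemeasurable]
    have hγ' : ∑ i, α i • (γs i : Measure X) = (γ : Measure X) := hγ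
    rw [← hγ']
    refine Finset.sum_congr rfl fun i _ => ?_
    rw [Measure.map_smul, Measure.map_map measurable_fst (hm i)]
    congr 1
    exact Measure.map_id
  · rw [Measure.map_finset_sum measurable_snd.aemeasurable]
    refine Finset.sum_congr rfl fun i _ => ?_
    rw [Measure.map_smul, Measure.map_map measurable_snd (hm i)]
    congr 1
    have : (Prod.snd ∘ fun u : X => (u, V i)) = fun _ => V i := rfl
    rw [this, Measure.map_const, measure_univ, one_smul]
  · rw [lintegral_finsetSum_measure]
    refine Finset.sum_congr rfl fun i _ => ?_
    rw [lintegral_smul_measure, lintegral_map (measurable_edist.pow_const 2) (hm i)]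
    rfl

end Couplings

end StatSol

namespace StatSol

/-! ### Stability of dissipative statistical solutions -/

/-- Dissipativity speaks of strictly positive weights only, while the approximating combinations may
contain zero weights. The sums to be reindexed take values in numbers and in measures, hence the
general monoid. -/
theorem exists_pos_weights {M : ℕ} (α : Fin M → ℝ≥0) :
    ∃ (M' : ℕ) (e : Fin M' → Fin M), (∀ j, 0 < α (e j)) ∧
      ∀ {A : Type} [AddCommMonoid A] (F : Fin M → A), (∀ i, α i = 0 → F i = 0) →
        ∑ j, F (e j) = ∑ i, F i := by
  classical
  let e := (Fintype.equivFin {i // α i ≠ 0}).symm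
  refine ⟨_, fun j => (e j : Fin M), fun j => pos_iff_ne_zero.2 (e j).2, fun F hF => ?_⟩
  refine Fintype.sum_of_injective (fun j => (e j : Fin M))
    (Subtype.val_injective.comp e.injective) _ _ (fun i hi => ?_) fun _ => rfl
  refine hF i ?_
  by_contra hc
  exact hi ⟨e.symm ⟨i, hc⟩, by simp⟩

/-- Finiteness ensures that nothing is lost in the `toReal` of `meanSqDist`. -/
theorem lintegral_edist_sq_lt_top {d N : ℕ} {D : Set (Space d)} {μ : ProbabilityMeasure (L2 D N)}
    (h : BoundedSupport μ) (w : L2 D N) : ∫⁻ u, edist u w ^ 2 ∂(μ : Measure (L2 D N)) < ⊤ := by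
  obtain ⟨M, hM⟩ := h
  have h1 : ∫⁻ u, edist u w ^ 2 ∂(μ : Measure (L2 D N))
      ≤ ∫⁻ _, ENNReal.ofReal (M + ‖w‖) ^ 2 ∂(μ : Measure (L2 D N)) := by
    refine lintegral_mono_ae ?_
    filter_upwards [hM] with u hu
    rw [edist_dist]
    gcongr
    exact (dist_le_norm_add_norm u w).trans (by linarith)
  refine h1.trans_lt ?_
  rw [lintegral_const, measure_univ, mul_one]
  exact ENNReal.pow_lt_top ENNReal.ofReal_lt_top

theorem sum_mul_lintegral_eq_ofReal {d N M : ℕ} {D : Set (Space d)} (α : Fin M → ℝ≥0)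
    (μs : Fin M → Measure (L2 D N)) (V : Fin M → L2 D N)
    (h : ∀ i, ∫⁻ u, edist u (V i) ^ 2 ∂(μs i) ≠ ⊤) :
    ∑ i, α i * ∫⁻ u, edist u (V i) ^ 2 ∂(μs i)
      = ENNReal.ofReal (∑ i, (α i : ℝ) * meanSqDist (μs i) (V i)) := by
  have h0 : ∀ i ∈ Finset.univ, 0 ≤ (α i : ℝ) * meanSqDist (μs i) (V i) := fun i _ =>
    mul_nonneg (α i).2 ENNReal.toReal_nonneg
  rw [ENNReal.ofReal_sum_of_nonneg h0]
  refine Finset.sum_congr rfl fun i _ => ?_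
  rw [ENNReal.ofReal_mul (NNReal.coe_nonneg _), meanSqDist, ENNReal.ofReal_toReal (h i),
    ENNReal.ofReal_coe_nnreal]

/-- The quantitative core: closeness of `μbar` to the initial atoms propagates to `γ t`. The
constants involve `R` but neither the number of atoms nor their weights. -/
theorem exists_coupling_stability {d N : ℕ} {f : Fin d → State N → State N} {η : State N → ℝ}
    {q : Fin d → State N → ℝ} {b c C K : ℝ} (hη : IsUniformEntropy f η q b c C K)
    {J : Finset (Fin d)} {L : Fin d → ℝ} (hb : IntegrableOn (fun _ => b) (cell J L))
    (hL : ∀ j ∈ J, 0 < L j) {S : ℝ} (hS : 0 < S) {T : EReal} (hST : (S : EReal) < T) {R : ℝ≥0}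
    {μbar : ProbabilityMeasure (L2 (cell J L) N)} {γ : ℝ → ProbabilityMeasure (L2 (cell J L) N)}
    (hγ : IsDissipativeStatisticalSolution f η J L T μbar γ) {M : ℕ} {α : Fin M → ℝ≥0}
    (hα : ∀ i, 0 < α i) (hα1 : ∑ i, α i = 1) {v : Fin M → ℝ → Space d → State N}
    {V : Fin M → ℝ → L2 (cell J L) N} (hv : ∀ i, IsClassicalSolution f J L T R (v i))
    (hV : ∀ i, ∀ t ∈ timeInterval T, V i t =ᵐ[volume.restrict (cell J L)] v i t)
    (hbd : ∀ i, ∃ B : ℝ≥0, ∀ᵐ t ∂(volume.restrict (timeInterval T)), ‖V i t‖ₑ ^ 2 ≤ B)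
    {π : Measure (L2 (cell J L) N × L2 (cell J L) N)}
    (hπ : π ∈ couplings (μbar : Measure (L2 (cell J L) N)) (∑ i, α i • Measure.dirac (V i 0)))
    {δ : ℝ} (hδ : 0 ≤ δ) (hcost : ∫⁻ z, edist z.1 z.2 ^ 2 ∂π ≤ ENNReal.ofReal δ) :
    ∀ᵐ t ∂(volume.restrict (Icc 0 S)),
      ∃ π ∈ couplings (γ t : Measure (L2 (cell J L) N)) (∑ i, α i • Measure.dirac (V i t)),
        ∫⁻ z, edist z.1 z.2 ^ 2 ∂π ≤ ENNReal.ofReal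
          (2 / c * (Real.exp (d * C * R * K * (2 / c) * t) * (C / 2 * δ))) := by
  have : SecondCountableTopology (L2 (cell J L) N) :=
    UniformSpace.secondCountable_of_separable _
  obtain ⟨μs, hμs, hcost'⟩ := exists_mem_decompositions hα (fun i => V i 0) hπ
  obtain ⟨γs, hγs, hsol⟩ := hγ.decomposition M α hα hα1 μs hμs
  have hcl := fun i => (hbd i).elim fun B hB => (hv i).isLipschitzSolution
    (fun m => (hη.contDiff_flux m).differentiable (by norm_num)) hS hST (hV i) hB
  have hrel := fun i => exists_relative_entropy hη hb hL hS hST (hsol i) (hcl i) (V := V i)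
    (fun t ht => by
      have h := hV i t (Icc_subset_timeInterval hST ht)
      simpa only [min_eq_left ht.2, max_eq_right ht.1] using h)
  choose hE0 hEt hE hW g g0 hg hlow hup hbal using hrel
  have hC := hη.C_nonneg
  have hK := hη.K_nonneg
  -- Total entropy is linear in the measure, so the entropy inequality for `γ` becomes one for the
  -- weighted sum of the component entropies.
  have hsum0 : ∫ u, ∫ x in cell J L, η (u x) ∂volume ∂(μbar : Measure (L2 (cell J L) N))
      = ∑ i, (α i : ℝ) * ∫ u, ∫ x in cell J L, η (u x) ∂volume
        ∂(μs i : Measure (L2 (cell J L) N)) := by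
    have h1 : ∑ i, α i • (μs i : Measure (L2 (cell J L) N)) = (μbar : Measure (L2 (cell J L) N)) :=
      hμs
    rw [← h1, integral_finsetSum_measure fun i _ => (hE0 i).smul_measure_nnreal]
    exact Finset.sum_congr rfl fun i _ => by rw [integral_smul_nnreal_measure]; rfl
  have hsumt : ∀ᵐ t ∂(volume.restrict (Icc 0 S)),
      ∫ u, ∫ x in cell J L, η (u x) ∂volume ∂(γ t : Measure (L2 (cell J L) N))
      = ∑ i, (α i : ℝ) * ∫ u, ∫ x in cell J L, η (u x) ∂volume
        ∂(γs i t : Measure (L2 (cell J L) N)) := by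
    filter_upwards [ae_all_iff.2 hEt, ae_restrict_mem measurableSet_Icc] with t ht htS
    have h1 : ∑ i, α i • (γs i t : Measure (L2 (cell J L) N))
        = (γ t : Measure (L2 (cell J L) N)) := hγs t (Icc_subset_timeInterval hST htS)
    rw [← h1, integral_finsetSum_measure fun i _ => (ht i).smul_measure_nnreal]
    exact Finset.sum_congr rfl fun i _ => by rw [integral_smul_nnreal_measure]; rfl
  have key := ae_sum_sqDist_le (α := fun i => (α i : ℝ)) (fun i => (α i).2) hη.c_pos
    (by positivity) hE hg hW hlow hup hbal fun θ hθ => by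
      obtain ⟨T', hT', hsupp⟩ := hθ.support
      have h1 := hγ.entropy θ hθ.smooth hθ.nonneg
        ⟨T', (EReal.coe_lt_coe_iff.2 hT').trans hST, hsupp⟩
      rw [hsum0, setIntegral_eq_of_subset_of_forall_sdiff_eq_zero (measurableSet_timeInterval T)
        (Icc_subset_timeInterval hST) (fun t ht => ?_)] at h1
      · convert h1 using 2
        refine integral_congr_ae ?_
        filter_upwards [hsumt] with t ht
        rw [ht]
      · have htS : S < t := by
          by_contra hc
          exact ht.2 ⟨ht.1.1, not_lt.1 hc⟩
        have hev : θ =ᶠ[𝓝 t] fun _ => 0 := by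
          filter_upwards [Ioi_mem_nhds htS] with s hs
          by_contra hc
          exact (hT'.trans hs).not_ge (hsupp s hc)
        rw [hev.deriv_eq]
        simp
  have hfin0 : ∀ i, ∫⁻ u, edist u (V i 0) ^ 2 ∂(μs i : Measure (L2 (cell J L) N)) ≠ ⊤ :=
    fun i => (lintegral_edist_sq_lt_top (hsol i).initial_bounded _).ne
  have hδ0 : ∑ i, (α i : ℝ) * meanSqDist (μs i : Measure (L2 (cell J L) N)) (V i 0)
      ≤ δ := by
    rw [← hcost', sum_mul_lintegral_eq_ofReal α _ _ hfin0] at hcost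
    have h0 : 0 ≤ ∑ i, (α i : ℝ) * meanSqDist (μs i : Measure (L2 (cell J L) N)) (V i 0) :=
      Finset.sum_nonneg fun i _ => mul_nonneg (α i).2 ENNReal.toReal_nonneg
    have := ENNReal.toReal_mono ENNReal.ofReal_ne_top hcost
    rwa [ENNReal.toReal_ofReal h0, ENNReal.toReal_ofReal hδ] at this
  have hc := hη.c_pos
  filter_upwards [key, ae_restrict_mem measurableSet_Icc] with t ht htS
  have htT := Icc_subset_timeInterval hST htS
  obtain ⟨π', hπ', hc'⟩ := exists_coupling_sum_dirac (hγs t htT) (fun i => V i t)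
  refine ⟨π', hπ', ?_⟩
  rw [hc', sum_mul_lintegral_eq_ofReal α _ _ fun i =>
    (lintegral_edist_sq_lt_top ((hsol i).bounded t htT) _).ne]
  refine ENNReal.ofReal_le_ofReal (ht.trans ?_)
  gcongr

end StatSol

namespace StatSol

/-! ### Weak-strong uniqueness -/

theorem exists_isUniformEntropy {d N : ℕ} {D : Set (Space d)} {f : Fin d → State N → State N}
    (hf : ∀ m, ContDiff ℝ 2 (f m)) (hf2 : ∃ K : ℝ, ∀ m u, ‖iteratedFDeriv ℝ 2 (f m) u‖ ≤ K)
    {η : State N → ℝ} {q : Fin d → State N → ℝ} (hη : ContDiff ℝ 2 η)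
    (hpair : IsEntropyPair f η q)
    (hη2 : ∃ c C : ℝ, 0 < c ∧ 0 < C ∧ ∀ u w : State N, ‖w‖ = 1 →
      c ≤ fderiv ℝ (fderiv ℝ η) u w w ∧ fderiv ℝ (fderiv ℝ η) u w w ≤ C)
    (hint : ∀ u : L2 D N, IntegrableOn (fun x => η (u x)) D) :
    ∃ b c C K, IsUniformEntropy f η q b c C K ∧ IntegrableOn (fun _ : Space d => b) D := by
  obtain ⟨K, hK⟩ := hf2
  obtain ⟨c, C, hc, hC, hcC⟩ := hη2
  have hess := fun u => quadratic_bounds (hcC u)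
  obtain ⟨b, hb0, hb, hb1, hb2⟩ := exists_integrableOn_const_entropy hη
    (fun u w => ⟨(mul_nonneg hc.le (sq_nonneg _)).trans (hess u w).1, (hess u w).2⟩) hint
  -- For `d = 0` the hypothesis does not force `K` to be nonnegative.
  refine ⟨b, c, C, max K 0, ⟨hf, le_max_right _ _, fun m u v => ?_, hη, hc, hC.le, hess,
    hpair.differentiable, hpair.compat, hb0, hb1, hb2⟩, hb⟩
  exact norm_fderiv_sub_le_of_iteratedFDeriv (hf m) (fun u => (hK m u).trans (le_max_left _ _)) u v

/-- The second moment of `ρ t` dominates `α i ‖V i t‖²`. This is the source of the finite energy of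
the classical solutions, which boundedness alone does not give on an unbounded domain. -/
theorem exists_enorm_sq_le_of_L2Bounded {d N M : ℕ} {D : Set (Space d)} {T : EReal}
    {α : Fin M → ℝ≥0} {V : Fin M → ℝ → L2 D N} {ρ : ℝ → ProbabilityMeasure (L2 D N)}
    (hρ : ∀ t ∈ timeInterval T, (ρ t : Measure (L2 D N)) = ∑ i, α i • Measure.dirac (V i t))
    (h : L2Bounded D T ρ) {i : Fin M} (hi : 0 < α i) :
    ∃ B : ℝ≥0, ∀ᵐ t ∂(volume.restrict (timeInterval T)), ‖V i t‖ₑ ^ 2 ≤ B := by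
  obtain ⟨c, hc⟩ := h
  refine ⟨c / α i, ?_⟩
  filter_upwards [hc, ae_restrict_mem (measurableSet_timeInterval T)] with t ht htT
  rw [hρ t htT, lintegral_finsetSum_measure] at ht
  have h1 := (Finset.single_le_sum (f := fun i => ∫⁻ u, ‖u‖ₑ ^ 2 ∂(α i • Measure.dirac (V i t)))
    (fun _ _ => zero_le) (Finset.mem_univ i)).trans ht
  rw [lintegral_smul_measure, lintegral_dirac' _ (by fun_prop), ENNReal.smul_def,
    smul_eq_mul] at h1
  rw [ENNReal.coe_div hi.ne', ENNReal.le_div_iff_mul_le (by left; exact_mod_cast hi.ne')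
    (by left; simp), mul_comm]
  exact h1

/-- The radius `R` is fixed before `n`, so the exponential factor does not change as the
approximation improves. -/
theorem ae_exists_couplings {d N : ℕ} {f : Fin d → State N → State N} {η : State N → ℝ}
    {q : Fin d → State N → ℝ} {b c C K : ℝ} (hη : IsUniformEntropy f η q b c C K)
    {J : Finset (Fin d)} {L : Fin d → ℝ} (hb : IntegrableOn (fun _ => b) (cell J L))
    (hL : ∀ j ∈ J, 0 < L j) {S : ℝ} (hS : 0 < S) {T : EReal} (hST : (S : EReal) < T)
    {μbar : ProbabilityMeasure (L2 (cell J L) N)} {μ γ : ℝ → ProbabilityMeasure (L2 (cell J L) N)}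
    (hμ : IsStrongStatisticalSolution f J L T μbar μ)
    (hγ : IsDissipativeStatisticalSolution f η J L T μbar γ) :
    ∃ R : ℝ≥0, ∀ n : ℕ, ∀ᵐ t ∂(volume.restrict (Icc 0 S)), ∃ ρ,
      (∃ π ∈ couplings (μ t : Measure (L2 (cell J L) N)) ρ,
        ∫⁻ z, edist z.1 z.2 ^ 2 ∂π ≤ ENNReal.ofReal (4 / (n + 1) ^ 2)) ∧
      ∃ π ∈ couplings (γ t : Measure (L2 (cell J L) N)) ρ,
        ∫⁻ z, edist z.1 z.2 ^ 2 ∂π ≤ ENNReal.ofReal (2 / c *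
          (Real.exp (d * C * R * K * (2 / c) * t) * (C / 2 * (4 / (n + 1) ^ 2)))) := by
  obtain ⟨R, -, happ⟩ := hμ.approx
  refine ⟨R, fun n => ?_⟩
  obtain ⟨M, α, v, V, ρ, hα1, hv, hV, hρ, hPT, hW⟩ := happ (n + 1) n.succ_pos
  obtain ⟨M', e, he, hsum⟩ := exists_pos_weights α
  have hW' : ∀ t ∈ timeInterval T, ∃ π ∈ couplings (μ t : Measure (L2 (cell J L) N))
      (∑ j, α (e j) • Measure.dirac (V (e j) t)),
        ∫⁻ z, edist z.1 z.2 ^ 2 ∂π ≤ ENNReal.ofReal (4 / (n + 1) ^ 2) := by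
    intro t ht
    rw [hsum (fun i => α i • Measure.dirac (V i t)) (fun i hi => by rw [hi, zero_smul]), ← hρ t ht]
    -- The factor 4 leaves room above `(1 / (n + 1))²` for a plan that is not optimal.
    refine exists_coupling_of_wasserstein_le (hW t ht) ?_
    rw [← ENNReal.ofReal_natCast, ← ENNReal.ofReal_inv_of_pos (by positivity),
      ← ENNReal.ofReal_pow (by positivity), ENNReal.ofReal_lt_ofReal_iff (by positivity), inv_pow,
      inv_eq_one_div]
    push_cast
    gcongr
    norm_num
  have h0 : (0 : ℝ) ∈ timeInterval T := Icc_subset_timeInterval hST ⟨le_rfl, hS.le⟩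
  obtain ⟨π, hπ, hcost⟩ := hW' 0 h0
  rw [hμ.solution.initial] at hπ
  have key := exists_coupling_stability hη hb hL hS hST (R := R) hγ he
    ((hsum α fun _ hi => hi).trans hα1) (fun j => hv (e j)) (fun j => hV (e j))
    (fun j => exists_enorm_sq_le_of_L2Bounded hρ hPT.1 (he j)) hπ (by positivity) hcost
  filter_upwards [key, ae_restrict_mem measurableSet_Icc] with t ht htS
  exact ⟨_, hW' t (Icc_subset_timeInterval hST htS), ht⟩

theorem ae_eq_on_Icc {d N : ℕ} {f : Fin d → State N → State N} {η : State N → ℝ}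
    {q : Fin d → State N → ℝ} {b c C K : ℝ} (hη : IsUniformEntropy f η q b c C K)
    {J : Finset (Fin d)} {L : Fin d → ℝ} (hb : IntegrableOn (fun _ => b) (cell J L))
    (hL : ∀ j ∈ J, 0 < L j) {S : ℝ} (hS : 0 < S) {T : EReal} (hST : (S : EReal) < T)
    {μbar : ProbabilityMeasure (L2 (cell J L) N)} {μ γ : ℝ → ProbabilityMeasure (L2 (cell J L) N)}
    (hμ : IsStrongStatisticalSolution f J L T μbar μ)
    (hγ : IsDissipativeStatisticalSolution f η J L T μbar γ) :
    ∀ᵐ t ∂(volume.restrict (Icc 0 S)), γ t = μ t := by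
  have : SecondCountableTopology (L2 (cell J L) N) :=
    UniformSpace.secondCountable_of_separable _
  obtain ⟨R, hR⟩ := ae_exists_couplings hη hb hL hS hST hμ hγ
  filter_upwards [ae_all_iff.2 hR] with t ht
  refine Subtype.ext (eq_of_couplings (μ := (μ t : Measure (L2 (cell J L) N)))
    (γ := (γ t : Measure (L2 (cell J L) N))) fun ε hε => ?_)
  set A : ℝ := 2 / c * (Real.exp (d * C * R * K * (2 / c) * t) * (C / 2)) with hA
  have hA0 : 0 ≤ A := by
    have := hη.c_pos; have := hη.C_nonneg; positivity
  have hε' : (0 : ℝ) < ε := hε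
  -- Chosen so that the costs `4 / (n + 1)²` and `4 A / (n + 1)²` both fall below `ε²`. The
  -- full-measure set of times was fixed for all `n` beforehand.
  obtain ⟨n, hn⟩ := exists_nat_gt (4 * (1 + A) / (ε : ℝ) ^ 2)
  have hn' : 4 * (1 + A) / ((n : ℝ) + 1) ^ 2 ≤ (ε : ℝ) ^ 2 := by
    rw [div_lt_iff₀ (by positivity)] at hn
    rw [div_le_iff₀ (by positivity)]
    have h1 : (n : ℝ) ≤ ((n : ℝ) + 1) ^ 2 := by nlinarith [(Nat.cast_nonneg n : (0 : ℝ) ≤ n)]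
    have h2 := mul_le_mul_of_nonneg_left h1 (sq_nonneg (ε : ℝ))
    linarith
  have hle : ∀ x : ℝ, x ≤ 4 * (1 + A) / ((n : ℝ) + 1) ^ 2 →
      ENNReal.ofReal x ≤ (ε : ℝ≥0∞) ^ 2 := fun x hx => by
    refine (ENNReal.ofReal_le_ofReal (hx.trans hn')).trans_eq ?_
    rw [ENNReal.ofReal_pow hε'.le, ENNReal.ofReal_coe_nnreal]
  obtain ⟨ρ, ⟨π1, hπ1, hc1⟩, π2, hπ2, hc2⟩ := ht n
  refine ⟨ρ, ⟨π1, hπ1, hc1.trans (hle _ ?_)⟩, π2, hπ2, hc2.trans (hle _ ?_)⟩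
  · gcongr
    linarith
  · have e1 : 2 / c * (Real.exp (d * C * R * K * (2 / c) * t) * (C / 2 * (4 / ((n : ℝ) + 1) ^ 2)))
        = 4 * A / ((n : ℝ) + 1) ^ 2 := by rw [hA]; ring
    rw [e1]
    gcongr
    linarith

end StatSol
theorem theorem3p4 {d N : ℕ}
    -- the spatial domain: periods `L j` in the directions `j ∈ J`, unbounded otherwise
    (J : Finset (Fin d)) (L : Fin d → ℝ) (hL : ∀ j ∈ J, 0 < L j)
    (T : EReal) (hT : 0 < T)
    -- the flux has a bounded Hessian
    (f : Fin d → StatSol.State N → StatSol.State N) (hf : ∀ m, ContDiff ℝ 2 (f m))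
    (hf2 : ∃ K : ℝ, ∀ m u, ‖iteratedFDeriv ℝ 2 (f m) u‖ ≤ K)
    -- there is a uniformly convex entropy with bounded Hessian
    (η : StatSol.State N → ℝ) (q : Fin d → StatSol.State N → ℝ)
    (hη : ContDiff ℝ 2 η) (hpair : StatSol.IsEntropyPair f η q)
    (hη2 : ∃ c C : ℝ, 0 < c ∧ 0 < C ∧ ∀ u w : StatSol.State N, ‖w‖ = 1 →
      c ≤ fderiv ℝ (fderiv ℝ η) u w w ∧ fderiv ℝ (fderiv ℝ η) u w w ≤ C)
    -- the total entropy is defined on all of `L²(D; U)` (automatic if `D` has finite measure)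
    (hηint : ∀ u : StatSol.L2 (StatSol.cell J L) N,
      MeasureTheory.IntegrableOn (fun x => η (u x)) (StatSol.cell J L))
    (μbar : MeasureTheory.ProbabilityMeasure (StatSol.L2 (StatSol.cell J L) N))
    (μ : ℝ → MeasureTheory.ProbabilityMeasure (StatSol.L2 (StatSol.cell J L) N))
    (hμ : StatSol.IsStrongStatisticalSolution f J L T μbar μ)
    (γ : ℝ → MeasureTheory.ProbabilityMeasure (StatSol.L2 (StatSol.cell J L) N))
    (hγ : StatSol.IsDissipativeStatisticalSolution f η J L T μbar γ) :
    ∀ᵐ t ∂(MeasureTheory.volume.restrict (StatSol.timeInterval T)), γ t = μ t := by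
  obtain ⟨b, c, C, K, hU, hb⟩ := StatSol.exists_isUniformEntropy hf hf2 hη hpair hη2 hηint
  -- The estimates require a finite end time strictly below `T`, which may be infinite. Rational end
  -- times exhaust `[0, T)` and produce only countably many null sets.
  have key : ∀ᵐ t : ℝ, ∀ r : ℚ, (0 : ℝ) < r → (((r : ℝ) : EReal) < T) → t ∈ Icc (0 : ℝ) r →
      γ t = μ t := by
    refine ae_all_iff.2 fun r => ?_
    by_cases hr : (0 : ℝ) < r ∧ ((r : ℝ) : EReal) < T
    · have h := StatSol.ae_eq_on_Icc hU hb hL hr.1 hr.2 hμ hγ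
      rw [ae_restrict_iff' measurableSet_Icc] at h
      filter_upwards [h] with t ht _ _ htr using ht htr
    · exact ae_of_all _ fun t h1 h2 => absurd ⟨h1, h2⟩ hr
  rw [ae_restrict_iff' (StatSol.measurableSet_timeInterval T)]
  filter_upwards [key] with t ht htT
  obtain ⟨r, hr1, hr2⟩ := EReal.lt_iff_exists_rat_btwn.1 htT.2
  have hr1' : t < r := EReal.coe_lt_coe_iff.1 hr1
  exact ht r (htT.1.trans_lt hr1') hr2 ⟨htT.1, hr1'.le⟩
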